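/- Let $k$ be a field of characteristic $0$ with algebraic closure $\bar k$ and $G_k=\mathrm{Gal}(\bar k/k)$. A cubic rational map $\phi=[F_0:F_1]$ over $\bar k$ ($F_0,F_1\in\bar k[X_0,X_1]$ cubic forms without common factor) is encoded by the pair of forms $f=\partial F_0/\partial X_0+\partial F_1/\partial X_1$ and $g=X_1F_0-X_0F_1$, of degrees $2$ and $4$; the 8-tuple $[v_1,\dots,v_8]$ denotes $f=v_1X_0^2+v_2X_0X_1+v_3X_1^2$, $g=v_4X_0^4+v_5X_0^3X_1+v_6X_0^2X_1^2+v_7X_0X_1^3+v_8X_1^4$. With the $r$-th transvectant $$(F,G)_r=\frac{(m-r)!\,(n-r)!}{m!\,n!}\sum_{s=0}^r(-1)^s\binom rs\frac{\partial^rF}{\partial X_0^{r-s}\partial X_1^s}\cdot\frac{\partial^rG}{\partial X_0^{s}\partial X_1^{r-s}}$$ of forms of orders $m,n$, and $H=(g,g)_2$, $T=(g,H)_1$, put $d=(f,f)_2$, $i=(g,g)_4$, $j=(H,g)_4$, $a=(g,f^2)_4$, $b=(H,f^2)_4$, $c=(T,f^3)_6$, $\tilde c=\frac16d^2i-\frac12a^2+\frac12db$.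 For $\gamma\in\mathrm{PGL}_2(\bar k)$ let $\phi^\gamma=\gamma^{-1}\circ\phi\circ\gamma$ and $\mathrm{Aut}(\phi)=\{\gamma:\phi^\gamma=\phi\}$. Let $M_3(\bar k)$ be the set of classes $[\phi]$ of cubic rational maps over $\bar k$ under $\mathrm{PGL}_2(\bar k)$-conjugation, and $M_3(k)$ the set of its $G_k$-fixed points. A model of $P$ is a $\phi$ with $[\phi]=P$; it is a $k$-model if $F_0,F_1$ can be chosen in $k[X_0,X_1]$. Values in $k$ are weighted projective coordinates of $P$, written $P=[\mathbf d:\mathbf i:\mathbf j:\mathbf a:\mathbf b:\mathbf c]$, if they agree with the invariants $(d,i,j,a,b,c)$ of a model up to the action of $\alpha\in\bar k^\times$ with weights $(2,2,3,3,4,6)$. The loci $\mathsf C_2^{(1)},\mathsf D_4^{(1)},\mathsf D_4^{(2)},\mathsf D_8,\mathsf A_4\subset M_3$ are the zero loci of the ideals $(c,\tilde c)$, $(a,j,c,\tilde c)$, $(d,a,b,c)$, $(d,j,a,b,c)$, $(c,b,a,i,d)$. **Proposition.** Let $P\in\mathsf C_2^{(1)}(k)$, with weighted projective coordinates $P=[\mathbf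 d:\mathbf i:\mathbf j:\mathbf a:\mathbf b:0]$ in $k$. 1. Suppose $\mathbf d\ne0$ and consider the conic $$9\mathbf d^3X^2+8\mathbf d^2Y^2-24\mathbf d\mathbf aYZ+(-36\mathbf d^2\mathbf i+72\mathbf a^2)Z^2=0.\qquad(*)$$ $P$ has a $k$-model if and only if, for some choice of weighted projective coordinates of $P$ in $k$, the conic $(*)$ has a $k$-point. If $P\notin\mathsf D_4^{(1)}$, this holds for every choice: $P$ has a $k$-model if and only if the conic $(*)$ of the given coordinates has a $k$-point. If $P\in\mathsf D_4^{(1)}$, then $P$ always has a $k$-model. In all cases, if the conic $(*)$ of the given coordinates has a $k$-point, it has one with $z\neq0$, and for every $k$-point $(x:y:z)$ with $z\ne0$, setting $c_5=x/z$, $c_6=y/z$, $c_3=\mathbf d/2$, $c_4=\frac{2\mathbf a}{\mathbf d^2}-\frac1{3\mathbf d}c_6$, the tuple $[1,0,c_3,c_4,c_5,c_6,-c_3c_5,c_3^2c_4]$ is a $k$-model of $P$. 2. If $\mathbf d=0$, then $P\in\mathsf D_4^{(2)}(k)$. If moreover $\mathbf i\ne0$ and $\mathbf j\neq0$, then $[0,0,0,-27\mathbf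 i^3,-27\mathbf i^3,0,24\mathbf j^2,0]$ is a $k$-model of $P$. 3. If $\mathbf d=\mathbf j=0$, then $P\in\mathsf D_8(k)$ and $[0,0,0,1,0,0,0,1]$ is a $k$-model of $P$. 4. If $\mathbf d=\mathbf i=0$, then $P\in\mathsf A_4(k)$. For either square root $\sqrt{-3}\in\bar k$, $[0,0,0,1,0,2\sqrt{-3},0,1]$ is a model of $P$ over $\bar k$, and its automorphism group is $G_k$-stable. For every model $\phi$ of $P$ over $\bar k$ whose automorphism group $A=\mathrm{Aut}(\phi)$ is $G_k$-stable, the obstruction set $I_k(\phi)$ contains a class corresponding to the conic $$X^2+3Y^2-2Z^2=0.$$ Here $N(A)$ is the normalizer of $A$ in $\mathrm{PGL}_2(\bar k)$, $Q(A)=N(A)/A$, $c_\phi\in H^1(G_k,Q(A))$ is the class of $\sigma\mapsto\gamma_\sigma$ with $\sigma(\phi)=\phi^{\gamma_\sigma}$, and $I_k(\phi)=\iota(p^{-1}(c_\phi))$ for the natural maps $p:H^1(G_k,N(A))\to H^1(G_k,Q(A))$ and $\iota:H^1(G_k,N(A))\to H^1(G_k,\mathrm{PGL}_2(\bar k))$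 (continuous cohomology). A class in $H^1(G_k,\mathrm{PGL}_2(\bar k))$ corresponds to a conic $C$ over $k$ if it is represented by the cocycle $\sigma\mapsto\theta^{-1}\circ\sigma(\theta)$ for an isomorphism $\theta:\mathbb P^1_{\bar k}\to C_{\bar k}$. -/

import Mathlib

open MvPolynomial
open scoped MatrixGroups

namespace CubicMaps

/-! ### Binary forms and transvectants -/

section Forms

variable {K : Type*} [Field K]

/-- Linear substitution `p ↦ p ∘ M`: `X i` is replaced by `∑ j, M i j * X j`. -/
noncomputable def subst (M : Matrix (Fin 2) (Fin 2) K) :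
    MvPolynomial (Fin 2) K →ₐ[K] MvPolynomial (Fin 2) K :=
  bind₁ fun i => ∑ j, C (M i j) * X j

/-- The `r`-th transvectant `(F, G)_r` of binary forms `F` and `G` of orders `m` and `n`,
`(m-r)! (n-r)! / (m! n!) * Ω^r (F(Z) G(W))` at `Z = W = X`, where
`Ω = ∂²/∂Z₀∂W₁ - ∂²/∂W₀∂Z₁`, with `Ω^r` expanded by the binomial theorem. -/
noncomputable def transvectant (m n r : ℕ) (F G : MvPolynomial (Fin 2) K) :
    MvPolynomial (Fin 2) K :=
  C ((((m - r).factorial * (n - r).factorial : ℕ) : K) / ((m.factorial * n.factorial : ℕ) : K)) *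
    ∑ s ∈ Finset.range (r + 1), (-1) ^ s * (r.choose s : MvPolynomial (Fin 2) K) *
      ((⇑(pderiv (R := K) (0 : Fin 2)))^[r - s] ((⇑(pderiv (R := K) (1 : Fin 2)))^[s] F)) *
      ((⇑(pderiv (R := K) (0 : Fin 2)))^[s] ((⇑(pderiv (R := K) (1 : Fin 2)))^[r - s] G))

/-- A set of values of the six basic invariants of a quadratic and a quartic form
(of degrees `2, 2, 3, 3, 4, 6`). -/
structure Invariants (K : Type*) where
  d : K
  i : K
  j : K
  a : K
  b : K
  c : K

namespace Invariants

/-- The invariant `c̃ = d² i / 6 - a² / 2 + d b / 2`. -/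
def ctilde (w : Invariants K) : K := w.d ^ 2 * w.i / 6 - w.a ^ 2 / 2 + w.d * w.b / 2

/-- The weighted action of `α` on `ℙ(2,2,3,3,4,6)`. -/
def scale (α : K) (w : Invariants K) : Invariants K :=
  ⟨α ^ 2 * w.d, α ^ 2 * w.i, α ^ 3 * w.j, α ^ 3 * w.a, α ^ 4 * w.b, α ^ 6 * w.c⟩

/-- Image of a tuple under a field extension. -/
def map {k : Type*} [Field k] (e : k →+* K) (w : Invariants k) : Invariants K :=
  ⟨e w.d, e w.i, e w.j, e w.a, e w.b, e w.c⟩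

end Invariants

/-- `H = (g, g)_2` for a quartic form `g`. -/
noncomputable def covH (g : MvPolynomial (Fin 2) K) : MvPolynomial (Fin 2) K :=
  transvectant 4 4 2 g g

/-- `T = (g, H)_1` for a quartic form `g`. -/
noncomputable def covT (g : MvPolynomial (Fin 2) K) : MvPolynomial (Fin 2) K :=
  transvectant 4 4 1 g (covH g)

/-- The basic invariants of a quadratic form `f` and a quartic form `g`. -/
noncomputable def basicInvariants (f g : MvPolynomial (Fin 2) K) : Invariants K where
  d := constantCoeff (transvectant 2 2 2 f f)
  i := constantCoeff (transvectant 4 4 4 g g)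
  j := constantCoeff (transvectant 4 4 4 (covH g) g)
  a := constantCoeff (transvectant 4 4 4 g (f ^ 2))
  b := constantCoeff (transvectant 4 4 4 (covH g) (f ^ 2))
  c := constantCoeff (transvectant 6 6 6 (covT g) (f ^ 3))

/-- The quadratic form with coefficients the first three entries of an 8-tuple. -/
noncomputable def quadraticOf (v : Fin 8 → K) : MvPolynomial (Fin 2) K :=
  C (v 0) * X 0 ^ 2 + C (v 1) * X 0 * X 1 + C (v 2) * X 1 ^ 2

/-- The quartic form with coefficients the last five entries of an 8-tuple. -/
noncomputable def quarticOf (v : Fin 8 → K) : MvPolynomial (Fin 2) K :=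
  C (v 3) * X 0 ^ 4 + C (v 4) * X 0 ^ 3 * X 1 + C (v 5) * X 0 ^ 2 * X 1 ^ 2 +
    C (v 6) * X 0 * X 1 ^ 3 + C (v 7) * X 1 ^ 4

lemma subst_one (p : MvPolynomial (Fin 2) K) : subst (1 : Matrix (Fin 2) (Fin 2) K) p = p := by
  have h : (fun i : Fin 2 => ∑ j, C ((1 : Matrix (Fin 2) (Fin 2) K) i j) * X j)
      = (X : Fin 2 → MvPolynomial (Fin 2) K) := by
    funext i
    revert i
    refine Fin.forall_fin_two.2 ⟨?_, ?_⟩ <;> simp [Fin.sum_univ_two]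
  rw [subst, h, bind₁_X_left]
  rfl

lemma subst_subst (M N : Matrix (Fin 2) (Fin 2) K) (p : MvPolynomial (Fin 2) K) :
    subst M (subst N p) = subst (N * M) p := by
  have h : (subst M).comp (subst N) = subst (N * M) := by
    apply MvPolynomial.algHom_ext
    intro i
    simp only [subst, AlgHom.comp_apply, bind₁_X_right, Fin.sum_univ_two, map_add, map_mul,
      bind₁_C_right, Matrix.mul_apply]
    ring
  exact DFunLike.congr_fun h p

lemma subst_C (M : Matrix (Fin 2) (Fin 2) K) (c : K) : subst M (C c) = C c := by
  simp [subst]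

lemma subst_isHomogeneous (M : Matrix (Fin 2) (Fin 2) K) {p : MvPolynomial (Fin 2) K} {n : ℕ}
    (hp : p.IsHomogeneous n) : (subst M p).IsHomogeneous n := by
  have h := hp.aeval (fun i : Fin 2 => ∑ j, C (M i j) * X j) (n := 1) (fun i =>
    IsHomogeneous.sum _ _ _ fun j _ => isHomogeneous_C_mul_X _ _)
  rwa [one_mul] at h

lemma subst_scalar (u : K) {p : MvPolynomial (Fin 2) K} {n : ℕ}
    (hp : p.IsHomogeneous n) : subst (Matrix.scalar (Fin 2) u) p = C (u ^ n) * p := by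
  have h : (fun i : Fin 2 => ∑ j, C (Matrix.scalar (Fin 2) u i j) * X j)
      = fun i : Fin 2 => (C u * X i : MvPolynomial (Fin 2) K) := by
    funext i
    fin_cases i <;> simp [Fin.sum_univ_two]
  rw [subst, h]
  conv_lhs => rw [p.as_sum]
  conv_rhs => rw [p.as_sum, Finset.mul_sum]
  rw [map_sum]
  refine Finset.sum_congr rfl fun m hm => ?_
  have hdeg : m 0 + m 1 = n := by
    have := hp (mem_support_iff.mp hm)
    simpa [Finsupp.weight_apply, Finsupp.sum_fintype, Fin.sum_univ_two] using this
  rw [bind₁_monomial, monomial_eq, Finsupp.prod_fintype _ _ (by simp),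
    Finset.prod_subset (Finset.subset_univ m.support) (by
      intro x _ hx
      simp [Finsupp.notMem_support_iff.mp hx])]
  simp only [Fin.prod_univ_two, mul_pow, ← hdeg, pow_add, C_mul, C_pow]
  ring

end Forms

/-! ### Rational maps of degree three and their moduli -/

section Maps

variable {K : Type*} [Field K]

/-- A pair of cubic forms without common factor. Over an algebraically closed field these
represent the rational maps `[F₀ : F₁]` of degree three. -/
@[ext]
structure CubicPair (K : Type*) [Field K] where
  F : Fin 2 → MvPolynomial (Fin 2) K
  homog : ∀ i, (F i).IsHomogeneous 3
  coprime : IsRelPrime (F 0) (F 1)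

namespace CubicPair

/-- The divergence `f = ∂F₀/∂X₀ + ∂F₁/∂X₁`. -/
noncomputable def divergence (F : CubicPair K) : MvPolynomial (Fin 2) K :=
  pderiv 0 (F.F 0) + pderiv 1 (F.F 1)

/-- The fixed point polynomial `g = X₁ F₀ - X₀ F₁`. -/
noncomputable def fixedPoint (F : CubicPair K) : MvPolynomial (Fin 2) K :=
  X 1 * F.F 0 - X 0 * F.F 1

/-- The basic invariants of the forms `f` and `g` attached to a rational map. -/
noncomputable def inv (F : CubicPair K) : Invariants K :=
  basicInvariants F.divergence F.fixedPoint

lemma isRelPrime_conj (M : GL (Fin 2) K) (F : CubicPair K) :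
    IsRelPrime
      (∑ j, C (M.val 0 j) * subst (M⁻¹ : GL (Fin 2) K).val (F.F j))
      (∑ j, C (M.val 1 j) * subst (M⁻¹ : GL (Fin 2) K).val (F.F j)) := by
  intro p h0 h1
  have hM : (M⁻¹ : GL (Fin 2) K).val * M.val = 1 := by
    rw [← Units.val_mul, inv_mul_cancel, Units.val_one]
  have hM' : M.val * (M⁻¹ : GL (Fin 2) K).val = 1 := by
    rw [← Units.val_mul, mul_inv_cancel, Units.val_one]
  have key : ∀ i, p ∣ subst (M⁻¹ : GL (Fin 2) K).val (F.F i) := by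
    have hd : ∀ i, p ∣ ∑ l, C (((M⁻¹ : GL (Fin 2) K).val * M.val) i l) *
        subst (M⁻¹ : GL (Fin 2) K).val (F.F l) := by
      intro i
      have hd := dvd_add (h0.mul_left (C ((M⁻¹ : GL (Fin 2) K).val i 0)))
        (h1.mul_left (C ((M⁻¹ : GL (Fin 2) K).val i 1)))
      convert hd using 1
      simp only [Matrix.mul_apply, Fin.sum_univ_two, C_add, C_mul]
      ring
    rw [hM] at hd
    refine Fin.forall_fin_two.2 ⟨?_, ?_⟩
    · simpa [Fin.sum_univ_two] using hd 0
    · simpa [Fin.sum_univ_two] using hd 1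
  have key' : ∀ i, subst M.val p ∣ F.F i := by
    intro i
    have := map_dvd (subst M.val) (key i)
    rwa [subst_subst, hM, subst_one] at this
  have hu := (F.coprime (key' 0) (key' 1)).map (subst (M⁻¹ : GL (Fin 2) K).val)
  rwa [subst_subst, hM', subst_one] at hu

/-- Conjugation `M ∘ F ∘ M⁻¹`. -/
noncomputable instance : SMul (GL (Fin 2) K) (CubicPair K) where
  smul M F :=
    { F := fun i => ∑ j, C (M.val i j) * subst (M⁻¹ : GL (Fin 2) K).val (F.F j)
      homog := fun _ => IsHomogeneous.sum _ _ _ fun j _ =>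
        (subst_isHomogeneous _ (F.homog j)).C_mul _
      coprime := isRelPrime_conj M F }

lemma smul_F (M : GL (Fin 2) K) (F : CubicPair K) (i : Fin 2) :
    (M • F).F i = ∑ j, C (M.val i j) * subst (M⁻¹ : GL (Fin 2) K).val (F.F j) := rfl

noncomputable instance : MulAction (GL (Fin 2) K) (CubicPair K) where
  one_smul F := by
    ext1
    funext i
    rw [smul_F]
    simp only [inv_one, Units.val_one, subst_one]
    revert i
    refine Fin.forall_fin_two.2 ⟨?_, ?_⟩ <;> simp [Fin.sum_univ_two]
  mul_smul M N F := by
    ext1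
    funext i
    simp only [smul_F, Fin.sum_univ_two, map_add, map_mul, subst_C, subst_subst, mul_inv_rev,
      Units.val_mul, Matrix.mul_apply]
    ring

/-- Two pairs represent the same rational map if they are proportional. -/
instance setoid (K : Type*) [Field K] : Setoid (CubicPair K) where
  r F G := ∃ u : Kˣ, ∀ i, G.F i = C (u : K) * F.F i
  iseqv :=
    { refl := fun F => ⟨1, fun i => by simp⟩
      symm := by
        rintro F G ⟨u, h⟩
        refine ⟨u⁻¹, fun i => ?_⟩
        rw [h i, ← mul_assoc, ← C_mul]
        simp
      trans := by
        rintro F G H ⟨u, h⟩ ⟨v, h'⟩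
        refine ⟨v * u, fun i => ?_⟩
        rw [h' i, h i, ← mul_assoc, ← C_mul]
        simp }

/-- The action of a field automorphism on coefficients. -/
noncomputable def gal {k : Type*} [Field k] [Algebra k K] (σ : K ≃ₐ[k] K) (F : CubicPair K) :
    CubicPair K where
  F i := MvPolynomial.map (σ : K →+* K) (F.F i)
  homog i := (F.homog i).map _
  coprime := by
    intro p h0 h1
    let e := mapEquiv (Fin 2) (σ : K ≃+* K)
    have he : ∀ q, e q = MvPolynomial.map (σ : K →+* K) q := fun q => rfl
    have t : ∀ i, p ∣ e (F.F i) → e.symm p ∣ F.F i := by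
      intro i h
      have := map_dvd e.symm h
      rwa [RingEquiv.symm_apply_apply] at this
    have := (F.coprime (t 0 h0) (t 1 h1)).map e
    rwa [RingEquiv.apply_symm_apply] at this

end CubicPair

/-- `Rat₃(K)`, for `K` algebraically closed: rational maps of degree three. -/
def Rat3 (K : Type*) [Field K] : Type _ := Quotient (CubicPair.setoid K)

namespace Rat3

/-- The rational map `[F₀ : F₁]`. -/
def mk (F : CubicPair K) : Rat3 K := Quotient.mk _ F

noncomputable instance : MulAction (GL (Fin 2) K) (Rat3 K) where
  smul M := Quotient.map (M • ·) (by
    rintro F G ⟨u, h⟩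
    refine ⟨u, fun i => ?_⟩
    simp only [CubicPair.smul_F, h, map_mul, subst_C, Fin.sum_univ_two]
    ring)
  one_smul := by
    rintro ⟨F⟩
    exact congrArg mk (one_smul _ F)
  mul_smul M N := by
    rintro ⟨F⟩
    exact congrArg mk (mul_smul M N F)

lemma scalar_smul (u : Kˣ) (φ : Rat3 K) :
    Matrix.GeneralLinearGroup.scalar (Fin 2) u • φ = φ := by
  induction φ using Quotient.inductionOn with
  | h F =>
    refine Quotient.sound (Setoid.symm ⟨u * (u⁻¹) ^ 3, fun i => ?_⟩)
    have h : ((Matrix.GeneralLinearGroup.scalar (Fin 2) u)⁻¹ : GL (Fin 2) K).val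
        = Matrix.scalar (Fin 2) ((u⁻¹ : Kˣ) : K) := by
      rw [← map_inv, Matrix.GeneralLinearGroup.coe_scalar]
    change (Matrix.GeneralLinearGroup.scalar (Fin 2) u • F).F i = _
    simp only [CubicPair.smul_F, h, subst_scalar _ (F.homog _), Fin.sum_univ_two,
      Matrix.GeneralLinearGroup.coe_scalar]
    fin_cases i <;> simp <;> ring

/-- The conjugation action of `PGL₂`: `γ • φ = γ ∘ φ ∘ γ⁻¹`, so `φ^γ = γ⁻¹ • φ`. -/
noncomputable instance : MulAction PGL(2, K) (Rat3 K) :=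
  Matrix.ProjGenLinGroup.mulActionOfGL scalar_smul

/-- The automorphism group of a rational map. -/
noncomputable def Aut (φ : Rat3 K) : Subgroup PGL(2, K) := MulAction.stabilizer PGL(2, K) φ

/-- The action of a field automorphism on rational maps. -/
noncomputable def gal {k : Type*} [Field k] [Algebra k K] (σ : K ≃ₐ[k] K) : Rat3 K → Rat3 K :=
  Quotient.map (CubicPair.gal σ) (by
    rintro F G ⟨u, h⟩
    refine ⟨Units.map (σ : K →* K) u, fun i => ?_⟩
    simp only [CubicPair.gal, h, map_mul, map_C]
    rfl)

end Rat3

/-- The geometric points of the moduli space `M₃`, `K` algebraically closed: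
rational maps of degree three up to conjugacy. -/
def M3 (K : Type*) [Field K] : Type _ := MulAction.orbitRel.Quotient PGL(2, K) (Rat3 K)

namespace M3

/-- The moduli point `[φ]`. -/
noncomputable def mk (φ : Rat3 K) : M3 K := Quotient.mk (MulAction.orbitRel PGL(2, K) (Rat3 K)) φ

/-- The moduli point of `[F₀ : F₁]`. -/
noncomputable def of (F : CubicPair K) : M3 K := mk (Rat3.mk F)

/-- `P` has a model whose pair `(f, g)` of divergence and fixed point polynomial
has the given 8-tuple of coefficients. -/
def IsModel (P : M3 K) (v : Fin 8 → K) : Prop :=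
  ∃ F : CubicPair K, of F = P ∧ F.divergence = quadraticOf v ∧ F.fixedPoint = quarticOf v

/-- The locus with ideal `(c, c̃)`. -/
def locusC21 (K : Type*) [Field K] : Set (M3 K) :=
  {P | ∃ F : CubicPair K, of F = P ∧ F.inv.c = 0 ∧ F.inv.ctilde = 0}

/-- The locus with ideal `(a, j, c, c̃)`. -/
def locusD41 (K : Type*) [Field K] : Set (M3 K) :=
  {P | ∃ F : CubicPair K, of F = P ∧
    F.inv.a = 0 ∧ F.inv.j = 0 ∧ F.inv.c = 0 ∧ F.inv.ctilde = 0}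

/-- The locus with ideal `(d, a, b, c)`. -/
def locusD42 (K : Type*) [Field K] : Set (M3 K) :=
  {P | ∃ F : CubicPair K, of F = P ∧
    F.inv.d = 0 ∧ F.inv.a = 0 ∧ F.inv.b = 0 ∧ F.inv.c = 0}

/-- The locus with ideal `(d, j, a, b, c)`. -/
def locusD8 (K : Type*) [Field K] : Set (M3 K) :=
  {P | ∃ F : CubicPair K, of F = P ∧
    F.inv.d = 0 ∧ F.inv.j = 0 ∧ F.inv.a = 0 ∧ F.inv.b = 0 ∧ F.inv.c = 0}

/-- The locus with ideal `(c, b, a, i, d)`. -/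
def locusA4 (K : Type*) [Field K] : Set (M3 K) :=
  {P | ∃ F : CubicPair K, of F = P ∧
    F.inv.c = 0 ∧ F.inv.b = 0 ∧ F.inv.a = 0 ∧ F.inv.i = 0 ∧ F.inv.d = 0}

variable (k : Type*) [Field k] [Algebra k K]

/-- `P ∈ M₃(k)`: the point `P` is fixed by all automorphisms of `K` over `k`
(for `k` of characteristic zero and `K` its algebraic closure). -/
def IsRational (P : M3 K) : Prop :=
  ∀ φ : Rat3 K, mk φ = P → ∀ σ : K ≃ₐ[k] K, mk (φ.gal σ) = P

/-- `P` has a model over `k`: it is the class of a map with coefficients in `k`. -/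
def HasModelOver (P : M3 K) : Prop :=
  ∃ (F : CubicPair K) (G : Fin 2 → MvPolynomial (Fin 2) k),
    of F = P ∧ ∀ i, F.F i = MvPolynomial.map (algebraMap k K) (G i)

variable {k}

/-- `w` is a set of weighted projective coordinates for `P` with values in `k`. -/
def HasCoords (P : M3 K) (w : Invariants k) : Prop :=
  ∃ F : CubicPair K, of F = P ∧ ∃ α : Kˣ, F.inv.scale (α : K) = w.map (algebraMap k K)

end M3

end Maps

/-! ### Non-abelian cohomology -/

section Cohomology

variable {G : Type*} [Group G] [TopologicalSpace G]
variable {X : Type*} [Group X] {Y : Type*} [Group Y]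

/-- Continuous 1-cocycles with values in a discrete group on which `G` acts. -/
abbrev Z1 (act : G →* Monoid.End X) : Type _ :=
  {z : G → X // IsLocallyConstant z ∧ ∀ σ τ, z (σ * τ) = z σ * act σ (z τ)}

/-- Cohomologous cocycles: `z' σ = x⁻¹ * z σ * σ x`. -/
def Z1.setoid (act : G →* Monoid.End X) : Setoid (Z1 act) where
  r z z' := ∃ x : X, ∀ σ, z'.1 σ = x⁻¹ * z.1 σ * act σ x
  iseqv :=
    { refl := fun z => ⟨1, fun σ => by simp⟩
      symm := by
        rintro z z' ⟨x, h⟩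
        refine ⟨x⁻¹, fun σ => ?_⟩
        rw [h σ, map_inv]
        group
      trans := by
        rintro z z' z'' ⟨x, h⟩ ⟨y, h'⟩
        refine ⟨x * y, fun σ => ?_⟩
        rw [h' σ, h σ, map_mul]
        group }

/-- The pointed set `H¹(G, X)`. -/
def H1 (act : G →* Monoid.End X) : Type _ := Quotient (Z1.setoid act)

/-- The class of a cocycle. -/
def H1.mk {act : G →* Monoid.End X} (z : Z1 act) : H1 act := Quotient.mk _ z

/-- The map on `H¹` induced by an equivariant homomorphism. -/
def H1.map {actX : G →* Monoid.End X} {actY : G →* Monoid.End Y} (e : X →* Y)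
    (he : ∀ σ x, e (actX σ x) = actY σ (e x)) : H1 actX → H1 actY :=
  Quotient.map
    (fun z => ⟨fun σ => e (z.1 σ), z.2.1.comp e, fun σ τ => by
      change e (z.1 (σ * τ)) = e (z.1 σ) * actY σ (e (z.1 τ))
      rw [z.2.2, map_mul, he]⟩)
    (by
      rintro z z' ⟨x, h⟩
      refine ⟨e x, fun σ => ?_⟩
      change e (z'.1 σ) = _
      rw [h σ, map_mul, map_mul, map_inv, he])

end Cohomology

/-! ### The obstruction to descent -/

section Obstruction

variable (k : Type*) [Field k]

/-- The absolute Galois group with its Krull topology. -/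
noncomputable abbrev GalGrp : Type _ := AlgebraicClosure k ≃ₐ[k] AlgebraicClosure k

/-- The Galois action on `PGL₂` of the algebraic closure. -/
noncomputable def galPGL : GalGrp k →* Monoid.End PGL(2, AlgebraicClosure k) where
  toFun σ := Matrix.ProjGenLinGroup.map (σ : AlgebraicClosure k →+* AlgebraicClosure k)
  map_one' := Matrix.ProjGenLinGroup.map_id
  map_mul' σ τ := Matrix.ProjGenLinGroup.map_comp
    (τ : AlgebraicClosure k →+* AlgebraicClosure k) (σ : AlgebraicClosure k →+* AlgebraicClosure k)

variable {k}

/-- A Galois-stable subgroup. -/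
def IsGalStable (A : Subgroup PGL(2, AlgebraicClosure k)) : Prop :=
  ∀ σ : GalGrp k, ∀ γ ∈ A, galPGL k σ γ ∈ A

/-- The normalizer `N(A)`. -/
noncomputable abbrev nor (A : Subgroup PGL(2, AlgebraicClosure k)) : Subgroup PGL(2, AlgebraicClosure k) :=
  Subgroup.normalizer (A : Set PGL(2, AlgebraicClosure k))

/-- The quotient `Q(A) = N(A) / A`. -/
abbrev quo (A : Subgroup PGL(2, AlgebraicClosure k)) : Type _ := nor A ⧸ A.subgroupOf (nor A)

lemma galPGL_inv_apply (σ : GalGrp k) (γ : PGL(2, AlgebraicClosure k)) :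
    galPGL k σ (galPGL k σ⁻¹ γ) = γ := by
  have : (galPGL k σ * galPGL k σ⁻¹) γ = γ := by
    rw [← map_mul, mul_inv_cancel, map_one]
    rfl
  exact this

lemma galPGL_mem_iff {A : Subgroup PGL(2, AlgebraicClosure k)} (hA : IsGalStable A)
    (σ : GalGrp k) (γ : PGL(2, AlgebraicClosure k)) : galPGL k σ γ ∈ A ↔ γ ∈ A := by
  refine ⟨fun h => ?_, hA σ γ⟩
  have := hA σ⁻¹ _ h
  have e := galPGL_inv_apply σ⁻¹ γ
  rw [inv_inv] at e
  rwa [e] at this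

lemma IsGalStable.nor {A : Subgroup PGL(2, AlgebraicClosure k)} (hA : IsGalStable A) :
    IsGalStable (nor A) := by
  intro σ n hn
  rw [Subgroup.mem_normalizer_iff] at hn ⊢
  intro x
  have h := hn (galPGL k σ⁻¹ x)
  rw [galPGL_mem_iff hA, ← galPGL_mem_iff hA σ (n * _ * _)] at h
  have e : galPGL k σ (n * galPGL k σ⁻¹ x * n⁻¹) = galPGL k σ n * x * (galPGL k σ n)⁻¹ := by
    let m : PGL(2, AlgebraicClosure k) →* PGL(2, AlgebraicClosure k) := galPGL k σ
    change m (n * galPGL k σ⁻¹ x * n⁻¹) = m n * x * (m n)⁻¹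
    have hx : m (galPGL k σ⁻¹ x) = x := galPGL_inv_apply σ x
    rw [map_mul, map_mul, hx, map_inv m]
  rwa [e] at h

/-- The Galois action on a stable subgroup. -/
noncomputable def subAct {N : Subgroup PGL(2, AlgebraicClosure k)} (hN : IsGalStable N) :
    GalGrp k →* Monoid.End N where
  toFun σ := ((galPGL k σ).comp N.subtype).codRestrict N fun n => hN σ n n.2
  map_one' := by
    refine MonoidHom.ext fun n => Subtype.ext ?_
    change galPGL k 1 n = n
    rw [map_one]
    rfl
  map_mul' σ τ := by
    refine MonoidHom.ext fun n => Subtype.ext ?_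
    change galPGL k (σ * τ) n = galPGL k σ (galPGL k τ n)
    rw [map_mul]
    rfl

/-- The Galois action on `Q(A)` for a stable `A`. -/
noncomputable def quoAct {A : Subgroup PGL(2, AlgebraicClosure k)} (hA : IsGalStable A) :
    GalGrp k →* Monoid.End (quo A) where
  toFun σ := QuotientGroup.map _ _ (subAct hA.nor σ) fun n hn => hA σ n hn
  map_one' := by
    refine MonoidHom.ext fun q => ?_
    induction q using QuotientGroup.induction_on with
    | H n =>
      change QuotientGroup.mk (subAct hA.nor 1 n) = QuotientGroup.mk n
      rw [map_one]
      rfl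
  map_mul' σ τ := by
    refine MonoidHom.ext fun q => ?_
    induction q using QuotientGroup.induction_on with
    | H n =>
      change QuotientGroup.mk (subAct hA.nor (σ * τ) n) =
        QuotientGroup.mk (subAct hA.nor σ (subAct hA.nor τ n))
      rw [map_mul]
      rfl

/-- `p : H¹(G_k, N(A)) → H¹(G_k, Q(A))`. -/
noncomputable def toQuo {A : Subgroup PGL(2, AlgebraicClosure k)} (hA : IsGalStable A) :
    H1 (subAct hA.nor) → H1 (quoAct hA) :=
  H1.map (QuotientGroup.mk' (A.subgroupOf (nor A))) fun _ _ => rfl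

/-- `i : H¹(G_k, N(A)) → H¹(G_k, PGL₂)`. -/
noncomputable def toPGL {A : Subgroup PGL(2, AlgebraicClosure k)} (hA : IsGalStable A) :
    H1 (subAct hA.nor) → H1 (galPGL k) :=
  H1.map (nor A).subtype fun _ _ => rfl

/-- `c` is the class `c_φ` in `H¹(G_k, Q(A))`, `A = Aut(φ)`, of the cocycle `σ ↦ γ_σ`
with `σ(φ) = φ^{γ_σ}`. The coset of `γ_σ` is determined by `φ`, so there is at most one such class. -/
def IsDescentClass (φ : Rat3 (AlgebraicClosure k)) (hA : IsGalStable φ.Aut)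
    (c : H1 (quoAct hA)) : Prop :=
  ∃ z : Z1 (quoAct hA), H1.mk z = c ∧ ∀ σ : GalGrp k, ∃ γ : nor φ.Aut,
    QuotientGroup.mk γ = z.1 σ ∧ φ.gal σ = (γ : PGL(2, AlgebraicClosure k))⁻¹ • φ

/-- The cohomological obstruction `I_k(φ) = i(p⁻¹(c_φ))`. -/
def obstruction (φ : Rat3 (AlgebraicClosure k)) (hA : IsGalStable φ.Aut) : Set (H1 (galPGL k)) :=
  toPGL hA '' {x | IsDescentClass φ hA (toQuo hA x)}

/-- The class `c` in `H¹(G_k, PGL₂)` corresponds to the plane conic `q = 0` over `k`: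
there are a cocycle `z` representing `c` and an isomorphism `θ` from `ℙ¹` to the conic over the
algebraic closure (given by three independent binary quadratic forms) with `σ(θ) = θ ∘ z_σ`. -/
def CorrespondsToConic (c : H1 (galPGL k)) (q : MvPolynomial (Fin 3) k) : Prop :=
  ∃ (z : Z1 (galPGL k)) (θ : Fin 3 → MvPolynomial (Fin 2) (AlgebraicClosure k)),
    H1.mk z = c ∧ (∀ n, (θ n).IsHomogeneous 2) ∧ LinearIndependent (AlgebraicClosure k) θ ∧
    aeval θ q = 0 ∧
    ∀ σ : GalGrp k, ∃ (M : GL (Fin 2) (AlgebraicClosure k)) (u : (AlgebraicClosure k)ˣ),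
      Matrix.ProjGenLinGroup.mk M = z.1 σ ∧
      ∀ n, MvPolynomial.map (σ : AlgebraicClosure k →+* AlgebraicClosure k) (θ n) =
        C (u : AlgebraicClosure k) * subst M.val (θ n)

end Obstruction

/-- The left-hand side of the equation
`9 d³ X² + 8 d² Y² - 24 d a Y Z + (-36 d² i + 72 a²) Z² = 0`. -/
def conicC21 {k : Type*} [Field k] (w : Invariants k) (x y z : k) : k :=
  9 * w.d ^ 3 * x ^ 2 + 8 * w.d ^ 2 * y ^ 2 - 24 * w.d * w.a * y * z +
    (-36 * w.d ^ 2 * w.i + 72 * w.a ^ 2) * z ^ 2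

/-- The conic `conicC21 w = 0` has a `k`-point. -/
def ConicHasPoint {k : Type*} [Field k] (w : Invariants k) : Prop :=
  ∃ x y z : k, ¬(x = 0 ∧ y = 0 ∧ z = 0) ∧ conicC21 w x y z = 0

/-- The 8-tuple `[1, 0, c₃, c₄, c₅, c₆, -c₃ c₅, c₃² c₄]` attached to a point `(x, y, z)`. -/
def modelC21 {k : Type*} [Field k] (w : Invariants k) (x y z : k) : Fin 8 → k :=
  let c5 := x / z
  let c6 := y / z
  let c3 := w.d / 2
  let c4 := 2 * w.a / w.d ^ 2 - 1 / (3 * w.d) * c6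
  ![1, 0, c3, c4, c5, c6, -c3 * c5, c3 ^ 2 * c4]

end CubicMaps

/-!
A cubic rational map is determined by its pair of forms `(f, g)`, since `4 F₀ = ∂₁ g + X₀ f` and
`4 F₁ = -∂₀ g + X₁ f`. Hence a moduli point is an orbit of 8-tuples of coefficients under linear
substitution and rescaling (`Related`, `M3.IsModel.related`, `M3.IsModel.of_related`). By
covariance of the transvectants (`transvectant_subst`) the basic invariants of an orbit are
determined up to the weighted action (`basicInvariants_transform`), so everything reduces to
normal forms of tuples.

Suppose `d ≠ 0`. Over the algebraic closure `f` becomes `r X₀ X₁`. Then `c = c̃ = 0`, together with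
the absence of a common factor of `F₀` and `F₁`, means that `g = α X₀⁴ + β X₀² X₁² + γ X₁⁴` with
`α γ ≠ 0` (`M3.IsModel.isSplitForm`), and such pairs are classified by `r²`, `β` and `α γ`
(`IsSplitForm.related`), that is, by `d`, `a` and `i`. A model over `k` can be brought over `k` to
the shape `f = X₀² + c₃ X₁²`, and its coefficients `c₅`, `c₆` then give the point `(c₅ : c₆ : 1)` on
the conic of its own invariants. Conversely, a point of the conic is exactly what makes the
invariants of the tuple `modelC21` agree with the given ones (`M3.HasCoords.isModel_modelC21`).
Coordinates of `P` in `k` differ by a scaling `α` with `α²` and, if `a` or `j` does not vanish, also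
`α³` in `k`; then `α` itself lies in `k` and the two conics are isomorphic over `k`
(`M3.HasCoords.conicHasPoint`). If `a = j = 0`, rescaling by `√(2i)` leads to a conic with an
obvious point (`M3.hasModelOver_of_mem_locusD41`).

If `d = 0`, then `f` is zero, for `f = X₀²` would force `X₀²` to divide `g` and so `X₀` to divide
both `F₀` and `F₁` (`M3.IsModel.divergence_eq_zero`). Moving a root to infinity turns `g` into
`X₀ (X₁³ + p X₀² X₁ + q X₀³)`, where `p` and `q` are multiples of `i` and `j`
(`M3.HasCoords.isModel_cubicTuple`). All the explicit models follow from this.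

Let finally `d = i = 0` and `s² = -3`. The automorphisms of a map with `f = 0` are the linear
symmetries of `g` up to factors. The Hessian of `X₀⁴ + 2 s X₀² X₁² + X₁⁴` is a multiple of
`X₀⁴ - 2 s X₀² X₁² + X₁⁴`, its only other possible Galois conjugate, and symmetries of a form are
symmetries of its Hessian, so the automorphism group is
Galois-stable (`isGalStable_aut_tetrahedral`). For the obstruction, the point has another model,
`descentTuple s`, whose conjugate over `k(s)` is obtained by the substitution `X₀ ↦ X₁`,
`X₁ ↦ 2 X₀`. This substitution has order two in `PGL₂` and so defines a cocycle. Conjugated into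
the normalizer of `Aut(φ)`, it lifts the descent class of any model `φ` with Galois-stable
automorphism group (`mk_mem_obstruction`), and it is also the cocycle of the parametrisation
`conicParam s` of `X² + 3 Y² - 2 Z² = 0` (`correspondsToConic_exchangeCocycle`).
-/


namespace CubicMaps

/-! ### Covariance of transvectants -/

section Covariance

open TensorProduct

variable {K : Type*} [Field K]

lemma subst_X (M : Matrix (Fin 2) (Fin 2) K) (i : Fin 2) :
    subst M (X i) = C (M i 0) * X 0 + C (M i 1) * X 1 := by
  simp [subst, Fin.sum_univ_two]

/-- The chain rule for a linear substitution. -/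
lemma pderiv_subst (M : Matrix (Fin 2) (Fin 2) K) (i : Fin 2) (p : MvPolynomial (Fin 2) K) :
    pderiv i (subst M p)
      = C (M 0 i) * subst M (pderiv 0 p) + C (M 1 i) * subst M (pderiv 1 p) := by
  induction p using MvPolynomial.induction_on with
  | C a => simp
  | add p q hp hq => simp only [map_add, hp, hq]; ring
  | mul_X p n hp =>
    have hX : pderiv i (subst M (X n)) = C (M n i) := by
      rw [subst_X]
      fin_cases i <;> simp [pderiv_X]
    rw [map_mul, pderiv_mul, hp, hX]
    fin_cases n <;> simp [pderiv_X] <;> ring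

/-- The operator `∂ᵢ ⊗ ∂ⱼ` on pairs of polynomials. -/
noncomputable def tensorPderiv (K : Type*) [Field K] (i j : Fin 2) :
    Module.End K (MvPolynomial (Fin 2) K ⊗[K] MvPolynomial (Fin 2) K) :=
  TensorProduct.map (pderiv (R := K) i).toLinearMap (pderiv (R := K) j).toLinearMap

/-- Cayley's operator `Ω = ∂₀ ⊗ ∂₁ - ∂₁ ⊗ ∂₀`. -/
noncomputable def omega (K : Type*) [Field K] :
    Module.End K (MvPolynomial (Fin 2) K ⊗[K] MvPolynomial (Fin 2) K) :=
  (-1 : K) • tensorPderiv K 1 0 + tensorPderiv K 0 1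

/-- Partial derivatives of polynomials commute. -/
lemma commute_pderiv (i j : Fin 2) :
    Commute (S := Module.End K (MvPolynomial (Fin 2) K))
      (pderiv (R := K) i).toLinearMap (pderiv (R := K) j).toLinearMap := by
  refine LinearMap.ext fun p => ?_
  change pderiv i (pderiv j p) = pderiv j (pderiv i p)
  have h : (⁅pderiv (R := K) i, pderiv (R := K) j⁆ :
      Derivation K (MvPolynomial (Fin 2) K) (MvPolynomial (Fin 2) K)) = 0 := by
    refine MvPolynomial.derivation_ext fun n => ?_
    rw [Derivation.commutator_apply]
    simp only [pderiv_X, Derivation.zero_apply]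
    fin_cases i <;> fin_cases j <;> fin_cases n <;> simp
  have := DFunLike.congr_fun h p
  rwa [Derivation.commutator_apply, Derivation.zero_apply, sub_eq_zero] at this

/-- A transvectant is obtained by multiplying out a power of Cayley's operator. -/
lemma transvectant_eq_omega (m n r : ℕ) (F G : MvPolynomial (Fin 2) K) :
    transvectant m n r F G =
      C ((((m - r).factorial * (n - r).factorial : ℕ) : K) /
          ((m.factorial * n.factorial : ℕ) : K)) *
        LinearMap.mul' K (MvPolynomial (Fin 2) K) ((omega K ^ r) (F ⊗ₜ[K] G)) := by
  -- The two summands of `Ω` commute, so that the binomial theorem applies to its powers.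
  have hcomm : Commute ((-1 : K) • tensorPderiv K 1 0) (tensorPderiv K 0 1) := by
    refine Commute.smul_left ?_ _
    change tensorPderiv K 1 0 * tensorPderiv K 0 1 = tensorPderiv K 0 1 * tensorPderiv K 1 0
    simp only [tensorPderiv]
    rw [← TensorProduct.map_mul, ← TensorProduct.map_mul, (commute_pderiv 1 0).eq]
  rw [transvectant, omega, hcomm.add_pow, LinearMap.sum_apply, map_sum]
  congr 1
  refine Finset.sum_congr rfl fun s _ => ?_
  rw [smul_pow, tensorPderiv, tensorPderiv, TensorProduct.map_pow, TensorProduct.map_pow]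
  have hc : ((r.choose s : ℕ) :
      Module.End K (MvPolynomial (Fin 2) K ⊗[K] MvPolynomial (Fin 2) K)) (F ⊗ₜ[K] G) =
        (r.choose s : K) • (F ⊗ₜ[K] G) := by
    rw [Module.End.natCast_apply, Nat.cast_smul_eq_nsmul]
  rw [Module.End.mul_apply, Module.End.mul_apply, hc, map_smul, map_smul,
    LinearMap.smul_apply, map_smul, map_smul, TensorProduct.map_tmul, TensorProduct.map_tmul,
    LinearMap.mul'_apply]
  have hcom : ∀ (a b : ℕ) (p : MvPolynomial (Fin 2) K),
      (⇑(pderiv (R := K) (1 : Fin 2)))^[a] ((⇑(pderiv (R := K) (0 : Fin 2)))^[b] p) =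
      (⇑(pderiv (R := K) (0 : Fin 2)))^[b] ((⇑(pderiv (R := K) (1 : Fin 2)))^[a] p) := by
    intro a b p
    have h : Function.Commute (⇑(pderiv (R := K) (1 : Fin 2))) (⇑(pderiv (R := K) (0 : Fin 2))) :=
      fun p => LinearMap.congr_fun (commute_pderiv (K := K) 1 0).eq p
    exact (h.iterate_iterate a b) p
  simp only [Module.End.pow_apply, Derivation.coeFn_coe,
    smul_eq_C_mul, hcom]
  simp only [C_pow, C_neg, C_1, map_natCast]
  ring

/-- The effect of a linear substitution on Cayley's operator. -/
lemma omega_map_subst (N : Matrix (Fin 2) (Fin 2) K)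
    (x : MvPolynomial (Fin 2) K ⊗[K] MvPolynomial (Fin 2) K) :
    omega K (TensorProduct.map (subst N).toLinearMap (subst N).toLinearMap x) =
      N.det • TensorProduct.map (subst N).toLinearMap (subst N).toLinearMap (omega K x) := by
  induction x using TensorProduct.induction_on with
  | zero => simp
  | add x y hx hy => simp only [map_add, hx, hy, smul_add]
  | tmul F G =>
    simp only [omega, tensorPderiv, LinearMap.add_apply, LinearMap.smul_apply,
      TensorProduct.map_tmul, AlgHom.toLinearMap_apply,
      Derivation.coeFn_coe, pderiv_subst, map_add, map_smul,
      ← smul_eq_C_mul, TensorProduct.tmul_add, TensorProduct.add_tmul, TensorProduct.tmul_smul,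
      ← TensorProduct.smul_tmul', Matrix.det_fin_two]
    module

/-- Transvectants are covariants: `(F ∘ N, G ∘ N)_r = det(N) ^ r (F, G)_r ∘ N`. -/
lemma transvectant_subst (N : Matrix (Fin 2) (Fin 2) K) (m n r : ℕ)
    (F G : MvPolynomial (Fin 2) K) :
    transvectant m n r (subst N F) (subst N G) =
      C (N.det ^ r) * subst N (transvectant m n r F G) := by
  have hpow : ∀ (r : ℕ) (x : MvPolynomial (Fin 2) K ⊗[K] MvPolynomial (Fin 2) K),
      (omega K ^ r) (TensorProduct.map (subst N).toLinearMap (subst N).toLinearMap x) =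
        N.det ^ r • TensorProduct.map (subst N).toLinearMap (subst N).toLinearMap
          ((omega K ^ r) x) := by
    intro r
    induction r with
    | zero => simp
    | succ r ih =>
      intro x
      rw [pow_succ', Module.End.mul_apply, ih, map_smul, omega_map_subst, smul_smul, pow_succ,
        Module.End.mul_apply]
  have hmul : ∀ x : MvPolynomial (Fin 2) K ⊗[K] MvPolynomial (Fin 2) K,
      LinearMap.mul' K (MvPolynomial (Fin 2) K)
        (TensorProduct.map (subst N).toLinearMap (subst N).toLinearMap x) =
      subst N (LinearMap.mul' K (MvPolynomial (Fin 2) K) x) := by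
    intro x
    induction x using TensorProduct.induction_on with
    | zero => simp
    | add x y hx hy => simp only [map_add, hx, hy]
    | tmul F G => simp
  have h := hpow r (F ⊗ₜ[K] G)
  rw [TensorProduct.map_tmul] at h
  simp only [AlgHom.toLinearMap_apply] at h
  rw [transvectant_eq_omega, transvectant_eq_omega, h, map_smul, hmul, map_mul, subst_C,
    smul_eq_C_mul]
  ring

lemma transvectant_C_mul (m n r : ℕ) (a b : K) (F G : MvPolynomial (Fin 2) K) :
    transvectant m n r (C a * F) (C b * G) = C (a * b) * transvectant m n r F G := by
  rw [transvectant_eq_omega, transvectant_eq_omega, ← smul_eq_C_mul F, ← smul_eq_C_mul G,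
    ← TensorProduct.smul_tmul', TensorProduct.tmul_smul, smul_smul, map_smul, map_smul,
    smul_eq_C_mul, C_mul]
  ring

lemma constantCoeff_subst (N : Matrix (Fin 2) (Fin 2) K) (p : MvPolynomial (Fin 2) K) :
    constantCoeff (subst N p) = constantCoeff p := by
  induction p using MvPolynomial.induction_on with
  | C a => simp
  | add p q hp hq => simp only [map_add, hp, hq]
  | mul_X p n hp => simp [subst_X]

lemma covH_transform (N : Matrix (Fin 2) (Fin 2) K) (u : K) (g : MvPolynomial (Fin 2) K) :
    covH (C u * subst N g) = C (u ^ 2 * N.det ^ 2) * subst N (covH g) := by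
  rw [covH, transvectant_C_mul, transvectant_subst, covH, ← mul_assoc, ← C_mul]
  ring_nf

lemma covT_transform (N : Matrix (Fin 2) (Fin 2) K) (u : K) (g : MvPolynomial (Fin 2) K) :
    covT (C u * subst N g) = C (u ^ 3 * N.det ^ 3) * subst N (covT g) := by
  rw [covT, covH_transform, transvectant_C_mul, transvectant_subst, covT, ← mul_assoc, ← C_mul]
  ring_nf

/-- The weights of the basic invariants: a linear substitution and the scalings by `u * det N` and
`u` act as the weighted scaling by `u * det N ^ 2`. -/
lemma basicInvariants_transform (N : Matrix (Fin 2) (Fin 2) K) (u : K)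
    (f g : MvPolynomial (Fin 2) K) :
    basicInvariants (C (u * N.det) * subst N f) (C u * subst N g) =
      (basicInvariants f g).scale (u * N.det ^ 2) := by
  simp only [basicInvariants, Invariants.scale, covH_transform, covT_transform, mul_pow (C _),
    ← map_pow, transvectant_C_mul, transvectant_subst, map_mul constantCoeff, constantCoeff_C,
    constantCoeff_subst, Invariants.mk.injEq]
  refine ⟨?_, ?_, ?_, ?_, ?_, ?_⟩ <;> ring

end Covariance

/-! ### The invariants in terms of coefficients -/

section Formulas

variable {K : Type*} [Field K]

/-- The coefficient of `X₀ ^ m * X₁ ^ n`. -/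
noncomputable def coeff₂ (m n : ℕ) (p : MvPolynomial (Fin 2) K) : K :=
  coeff (Finsupp.single 0 m + Finsupp.single 1 n) p

lemma coeff₂_add (m n : ℕ) (p q : MvPolynomial (Fin 2) K) :
    coeff₂ m n (p + q) = coeff₂ m n p + coeff₂ m n q := coeff_add _ _ _

lemma coeff₂_term (m n m' n' : ℕ) (c : K) :
    coeff₂ m n (C c * X 0 ^ m' * X 1 ^ n') = if m' = m ∧ n' = n then c else 0 := by
  have h : (C c * X 0 ^ m' * X 1 ^ n' : MvPolynomial (Fin 2) K)
      = monomial (Finsupp.single 0 m' + Finsupp.single 1 n') c := by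
    rw [monomial_eq, Finsupp.prod_fintype _ _ (by simp)]
    simp [Fin.prod_univ_two, mul_assoc]
  rw [coeff₂, h, coeff_monomial]
  congr 1
  rw [eq_iff_iff, Finsupp.ext_iff]
  simp [Fin.forall_fin_two]

lemma coeff₂_pderiv_zero (m n : ℕ) (p : MvPolynomial (Fin 2) K) :
    coeff₂ m n (pderiv 0 p) = (m + 1) * coeff₂ (m + 1) n p := by
  rw [coeff₂, coeff_pderiv, coeff₂, Finsupp.single_add, add_right_comm, mul_comm]
  simp

lemma coeff₂_pderiv_one (m n : ℕ) (p : MvPolynomial (Fin 2) K) :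
    coeff₂ m n (pderiv 1 p) = (n + 1) * coeff₂ m (n + 1) p := by
  rw [coeff₂, coeff_pderiv, coeff₂, Finsupp.single_add, add_assoc, mul_comm]
  simp

/-- Constant coefficients of iterated derivatives are coefficients, up to factorials. -/
lemma constantCoeff_iterate_pderiv (m n : ℕ) (p : MvPolynomial (Fin 2) K) :
    constantCoeff ((⇑(pderiv (R := K) (0 : Fin 2)))^[m] ((⇑(pderiv (R := K) (1 : Fin 2)))^[n] p))
      = m.factorial * n.factorial * coeff₂ m n p := by
  -- The factorial on the left keeps the inductive statement free of divisions.
  have h1 : ∀ (n a b : ℕ) (p : MvPolynomial (Fin 2) K),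
      b.factorial * coeff₂ a b ((⇑(pderiv (R := K) (1 : Fin 2)))^[n] p) =
        (b + n).factorial * coeff₂ a (b + n) p := by
    intro n
    induction n with
    | zero => intros; rfl
    | succ n ih =>
      intro a b p
      have e : b + (n + 1) = b + n + 1 := rfl
      rw [Function.iterate_succ_apply, ih, coeff₂_pderiv_one, e, Nat.factorial_succ (b + n)]
      push_cast
      ring
  have h0 : ∀ (n a b : ℕ) (p : MvPolynomial (Fin 2) K),
      a.factorial * coeff₂ a b ((⇑(pderiv (R := K) (0 : Fin 2)))^[n] p) =
        (a + n).factorial * coeff₂ (a + n) b p := by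
    intro n
    induction n with
    | zero => intros; rfl
    | succ n ih =>
      intro a b p
      have e : a + (n + 1) = a + n + 1 := rfl
      rw [Function.iterate_succ_apply, ih, coeff₂_pderiv_zero, e, Nat.factorial_succ (a + n)]
      push_cast
      ring
  have hc : ∀ q : MvPolynomial (Fin 2) K, constantCoeff q = coeff₂ 0 0 q := by
    intro q
    simp [coeff₂, constantCoeff_eq]
  have e0 := h0 m 0 0 ((⇑(pderiv (R := K) (1 : Fin 2)))^[n] p)
  have e1 := h1 n m 0 p
  simp only [Nat.factorial_zero, Nat.cast_one, one_mul, zero_add] at e0 e1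
  rw [hc, e0, e1, mul_assoc]

/-- The transvectant of highest order is the invariant pairing of binary forms. -/
lemma constantCoeff_transvectant [CharZero K] (m : ℕ) (F G : MvPolynomial (Fin 2) K) :
    constantCoeff (transvectant m m m F G) =
      ∑ s ∈ Finset.range (m + 1), (-1) ^ s / (m.choose s : K) * coeff₂ (m - s) s F *
        coeff₂ s (m - s) G := by
  rw [transvectant, map_mul, map_sum, Finset.mul_sum]
  refine Finset.sum_congr rfl fun s hs => ?_
  have hs : s ≤ m := Nat.lt_succ_iff.mp (Finset.mem_range.mp hs)
  have h := Nat.choose_mul_factorial_mul_factorial hs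
  have h' : (m.choose s : K) * s.factorial * (m - s).factorial = m.factorial := by
    exact_mod_cast h
  have hm : (m.factorial : K) ≠ 0 := Nat.cast_ne_zero.mpr m.factorial_ne_zero
  have hb : (m.choose s : K) ≠ 0 := Nat.cast_ne_zero.mpr (Nat.choose_pos hs).ne'
  simp only [map_mul, map_pow, map_neg, map_one, map_natCast, constantCoeff_C,
    constantCoeff_iterate_pderiv, Nat.sub_self, Nat.factorial_zero, Nat.cast_one, mul_one,
    Nat.cast_mul, one_div]
  field_simp
  rw [← h']
  ring

/-- The quartic form with the given binomial coefficients. -/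
noncomputable def binQuartic (a0 a1 a2 a3 a4 : K) : MvPolynomial (Fin 2) K :=
  C a0 * X 0 ^ 4 * X 1 ^ 0 + C (4 * a1) * X 0 ^ 3 * X 1 ^ 1 + C (6 * a2) * X 0 ^ 2 * X 1 ^ 2 +
    C (4 * a3) * X 0 ^ 1 * X 1 ^ 3 + C a4 * X 0 ^ 0 * X 1 ^ 4

lemma quarticOf_eq_binQuartic [CharZero K] (v : Fin 8 → K) :
    quarticOf v = binQuartic (v 3) (v 4 / 4) (v 5 / 6) (v 6 / 4) (v 7) := by
  have h4 : ∀ x : K, 4 * (x / 4) = x := fun x => by field_simp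
  have h6 : 6 * (v 5 / 6) = v 5 := by field_simp
  rw [quarticOf, binQuartic, h4, h4, h6]
  ring

lemma coeff₂_binQuartic (m n : ℕ) (a0 a1 a2 a3 a4 : K) :
    coeff₂ m n (binQuartic a0 a1 a2 a3 a4) =
      (if 4 = m ∧ 0 = n then a0 else 0) + (if 3 = m ∧ 1 = n then 4 * a1 else 0) +
      (if 2 = m ∧ 2 = n then 6 * a2 else 0) + (if 1 = m ∧ 3 = n then 4 * a3 else 0) +
      (if 0 = m ∧ 4 = n then a4 else 0) := by
  simp only [binQuartic, coeff₂_add, coeff₂_term]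

/-- The cubic form with the given binomial coefficients. -/
noncomputable def binCubic (a0 a1 a2 a3 : K) : MvPolynomial (Fin 2) K :=
  C a0 * X 0 ^ 3 + 3 * C a1 * X 0 ^ 2 * X 1 + 3 * C a2 * X 0 * X 1 ^ 2 + C a3 * X 1 ^ 3

/-- The quadratic form with the given binomial coefficients. -/
noncomputable def binQuadratic (a0 a1 a2 : K) : MvPolynomial (Fin 2) K :=
  C a0 * X 0 ^ 2 + 2 * C a1 * X 0 * X 1 + C a2 * X 1 ^ 2

lemma pderiv_binQuartic (a0 a1 a2 a3 a4 : K) :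
    pderiv 0 (binQuartic a0 a1 a2 a3 a4) = 4 * binCubic a0 a1 a2 a3 ∧
      pderiv 1 (binQuartic a0 a1 a2 a3 a4) = 4 * binCubic a1 a2 a3 a4 := by
  constructor <;>
  · simp [binQuartic, binCubic, pderiv_X]
    simp only [map_ofNat]
    ring

lemma pderiv_four_mul_binCubic (a0 a1 a2 a3 : K) :
    pderiv 0 (4 * binCubic a0 a1 a2 a3) = 12 * binQuadratic a0 a1 a2 ∧
      pderiv 1 (4 * binCubic a0 a1 a2 a3) = 12 * binQuadratic a1 a2 a3 := by
  have h3 : (3 : MvPolynomial (Fin 2) K) = C 3 := (map_ofNat C 3).symm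
  have h4 : (4 : MvPolynomial (Fin 2) K) = C 4 := (map_ofNat C 4).symm
  constructor <;>
  · rw [binCubic, h3, h4]
    simp [binQuadratic, pderiv_X]
    simp only [map_ofNat]
    ring

lemma covH_binQuartic [CharZero K] (a0 a1 a2 a3 a4 : K) :
    covH (binQuartic a0 a1 a2 a3 a4) =
      binQuartic (2 * (a0 * a2 - a1 ^ 2)) (a0 * a3 - a1 * a2)
        ((a0 * a4 + 2 * a1 * a3 - 3 * a2 ^ 2) / 3) (a1 * a4 - a2 * a3)
        (2 * (a2 * a4 - a3 ^ 2)) := by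
  have h3 : 6 * ((a0 * a4 + 2 * a1 * a3 - 3 * a2 ^ 2) / 3) =
      2 * (a0 * a4 + 2 * a1 * a3 - 3 * a2 ^ 2) := by ring
  have hk : (C ((((4 - 2).factorial * (4 - 2).factorial : ℕ) : K) /
      (((4).factorial * (4).factorial : ℕ) : K)) : MvPolynomial (Fin 2) K) * 144 = 1 := by
    rw [← map_ofNat C 144, ← C_mul, ← C_1]
    congr 1
    norm_num [Nat.factorial]
  rw [covH, transvectant]
  generalize (C ((((4 - 2).factorial * (4 - 2).factorial : ℕ) : K) /
      (((4).factorial * (4).factorial : ℕ) : K)) : MvPolynomial (Fin 2) K) = k at hk ⊢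
  simp only [Finset.sum_range_succ, Finset.sum_range_zero, Function.iterate_succ_apply,
    Function.iterate_zero_apply, Nat.sub_self, Nat.sub_zero, Nat.reduceSub,
    (pderiv_binQuartic _ _ _ _ _).1, (pderiv_binQuartic _ _ _ _ _).2,
    (pderiv_four_mul_binCubic _ _ _ _).1, (pderiv_four_mul_binCubic _ _ _ _).2,
    Nat.choose_zero_right, Nat.choose_self, Nat.choose_one_right, Nat.cast_ofNat, Nat.cast_one]
  simp only [binQuartic, h3, binQuadratic, C_mul, C_sub, C_add, C_pow, map_ofNat]
  linear_combination (2 * ((C a0 * X 0 ^ 2 + 2 * C a1 * X 0 * X 1 + C a2 * X 1 ^ 2) *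
    (C a2 * X 0 ^ 2 + 2 * C a3 * X 0 * X 1 + C a4 * X 1 ^ 2) -
    (C a1 * X 0 ^ 2 + 2 * C a2 * X 0 * X 1 + C a3 * X 1 ^ 2) ^ 2)) * hk

/-- The sextic form with the given coefficients. -/
noncomputable def sextic (c0 c1 c2 c3 c4 c5 c6 : K) : MvPolynomial (Fin 2) K :=
  C c0 * X 0 ^ 6 * X 1 ^ 0 + C c1 * X 0 ^ 5 * X 1 ^ 1 + C c2 * X 0 ^ 4 * X 1 ^ 2 +
    C c3 * X 0 ^ 3 * X 1 ^ 3 + C c4 * X 0 ^ 2 * X 1 ^ 4 + C c5 * X 0 ^ 1 * X 1 ^ 5 +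
    C c6 * X 0 ^ 0 * X 1 ^ 6

lemma coeff₂_sextic (m n : ℕ) (a0 a1 a2 a3 a4 a5 a6 : K) :
    coeff₂ m n (sextic a0 a1 a2 a3 a4 a5 a6) =
      (if 6 = m ∧ 0 = n then a0 else 0) + (if 5 = m ∧ 1 = n then a1 else 0) +
      (if 4 = m ∧ 2 = n then a2 else 0) + (if 3 = m ∧ 3 = n then a3 else 0) +
      (if 2 = m ∧ 4 = n then a4 else 0) + (if 1 = m ∧ 5 = n then a5 else 0) +
      (if 0 = m ∧ 6 = n then a6 else 0) := by
  simp only [sextic, coeff₂_add, coeff₂_term]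

lemma transvectant_one_binQuartic [CharZero K] (a0 a1 a2 a3 a4 h0 h1 h2 h3 h4 : K) :
    transvectant 4 4 1 (binQuartic a0 a1 a2 a3 a4) (binQuartic h0 h1 h2 h3 h4) =
      sextic (a0 * h1 - a1 * h0) (3 * (a0 * h2 - a2 * h0))
        (3 * (a0 * h3 - a3 * h0) + 6 * (a1 * h2 - a2 * h1))
        (a0 * h4 - a4 * h0 + 8 * (a1 * h3 - a3 * h1))
        (3 * (a1 * h4 - a4 * h1) + 6 * (a2 * h3 - a3 * h2))
        (3 * (a2 * h4 - a4 * h2)) (a3 * h4 - a4 * h3) := by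
  have hk : (C ((((4 - 1).factorial * (4 - 1).factorial : ℕ) : K) /
      (((4).factorial * (4).factorial : ℕ) : K)) : MvPolynomial (Fin 2) K) * 16 = 1 := by
    rw [← map_ofNat C 16, ← C_mul, ← C_1]
    congr 1
    norm_num [Nat.factorial]
  rw [transvectant]
  generalize (C ((((4 - 1).factorial * (4 - 1).factorial : ℕ) : K) /
      (((4).factorial * (4).factorial : ℕ) : K)) : MvPolynomial (Fin 2) K) = k at hk ⊢
  simp only [Finset.sum_range_succ, Finset.sum_range_zero, Function.iterate_succ_apply,
    Function.iterate_zero_apply, Nat.sub_self, Nat.sub_zero,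
    (pderiv_binQuartic _ _ _ _ _).1, (pderiv_binQuartic _ _ _ _ _).2,
    Nat.choose_zero_right, Nat.choose_self, Nat.cast_one]
  simp only [sextic, binCubic, C_mul, C_sub, C_add, map_ofNat]
  linear_combination ((C a0 * X 0 ^ 3 + 3 * C a1 * X 0 ^ 2 * X 1 + 3 * C a2 * X 0 * X 1 ^ 2 +
      C a3 * X 1 ^ 3) * (C h1 * X 0 ^ 3 + 3 * C h2 * X 0 ^ 2 * X 1 + 3 * C h3 * X 0 * X 1 ^ 2 +
      C h4 * X 1 ^ 3) - (C a1 * X 0 ^ 3 + 3 * C a2 * X 0 ^ 2 * X 1 + 3 * C a3 * X 0 * X 1 ^ 2 +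
      C a4 * X 1 ^ 3) * (C h0 * X 0 ^ 3 + 3 * C h1 * X 0 ^ 2 * X 1 + 3 * C h2 * X 0 * X 1 ^ 2 +
      C h3 * X 1 ^ 3)) * hk

/-- The top transvectant of two quartic forms, in terms of binomial coefficients. -/
lemma constantCoeff_transvectant_binQuartic [CharZero K] (a0 a1 a2 a3 a4 h0 h1 h2 h3 h4 : K) :
    constantCoeff (transvectant 4 4 4 (binQuartic a0 a1 a2 a3 a4) (binQuartic h0 h1 h2 h3 h4)) =
      a0 * h4 - 4 * a1 * h3 + 6 * a2 * h2 - 4 * a3 * h1 + a4 * h0 := by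
  rw [constantCoeff_transvectant]
  have c2 : Nat.choose 4 2 = 6 := rfl
  simp [Finset.sum_range_succ, coeff₂_binQuartic, c2]
  ring

lemma constantCoeff_transvectant_sextic [CharZero K]
    (a0 a1 a2 a3 a4 a5 a6 h0 h1 h2 h3 h4 h5 h6 : K) :
    constantCoeff (transvectant 6 6 6 (sextic a0 a1 a2 a3 a4 a5 a6)
      (sextic h0 h1 h2 h3 h4 h5 h6)) =
      a0 * h6 - a1 * h5 / 6 + a2 * h4 / 15 - a3 * h3 / 20 + a4 * h2 / 15 - a5 * h1 / 6
        + a6 * h0 := by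
  rw [constantCoeff_transvectant]
  have c2 : Nat.choose 6 2 = 15 := rfl
  have c3 : Nat.choose 6 3 = 20 := rfl
  have c4 : Nat.choose 6 4 = 15 := rfl
  simp [Finset.sum_range_succ, coeff₂_sextic, c2, c3, c4]
  ring

lemma quadraticOf_sq [CharZero K] (v : Fin 8 → K) :
    quadraticOf v ^ 2 = binQuartic (v 0 ^ 2) (v 0 * v 1 / 2) ((v 1 ^ 2 + 2 * v 0 * v 2) / 6)
      (v 1 * v 2 / 2) (v 2 ^ 2) := by
  have h1 : 4 * (v 0 * v 1 / 2) = 2 * v 0 * v 1 := by ring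
  have h2 : 6 * ((v 1 ^ 2 + 2 * v 0 * v 2) / 6) = v 1 ^ 2 + 2 * v 0 * v 2 := by ring
  have h3 : 4 * (v 1 * v 2 / 2) = 2 * v 1 * v 2 := by ring
  rw [quadraticOf, binQuartic, h1, h2, h3]
  simp only [C_mul, C_add, C_pow, map_ofNat]
  ring

lemma coeff₂_quadraticOf (m n : ℕ) (v : Fin 8 → K) :
    coeff₂ m n (quadraticOf v) =
      (if 2 = m ∧ 0 = n then v 0 else 0) + (if 1 = m ∧ 1 = n then v 1 else 0) +
      (if 0 = m ∧ 2 = n then v 2 else 0) := by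
  have h : quadraticOf v =
      C (v 0) * X 0 ^ 2 * X 1 ^ 0 + C (v 1) * X 0 ^ 1 * X 1 ^ 1 + C (v 2) * X 0 ^ 0 * X 1 ^ 2 := by
    rw [quadraticOf]
    ring
  simp only [h, coeff₂_add, coeff₂_term]

lemma basicInvariants_d [CharZero K] (v : Fin 8 → K) :
    (basicInvariants (quadraticOf v) (quarticOf v)).d = 2 * v 0 * v 2 - v 1 ^ 2 / 2 := by
  rw [basicInvariants, constantCoeff_transvectant]
  simp [Finset.sum_range_succ, coeff₂_quadraticOf]
  ring

lemma basicInvariants_i [CharZero K] (v : Fin 8 → K) :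
    (basicInvariants (quadraticOf v) (quarticOf v)).i =
      2 * v 3 * v 7 - v 4 * v 6 / 2 + v 5 ^ 2 / 6 := by
  simp only [basicInvariants, quarticOf_eq_binQuartic, constantCoeff_transvectant_binQuartic]
  ring

lemma basicInvariants_a [CharZero K] (v : Fin 8 → K) :
    (basicInvariants (quadraticOf v) (quarticOf v)).a =
      v 3 * v 2 ^ 2 - v 4 * v 1 * v 2 / 2 + v 5 * (v 1 ^ 2 + 2 * v 0 * v 2) / 6
        - v 6 * v 0 * v 1 / 2 + v 7 * v 0 ^ 2 := by
  simp only [basicInvariants, quarticOf_eq_binQuartic, quadraticOf_sq,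
    constantCoeff_transvectant_binQuartic]
  ring

lemma basicInvariants_j [CharZero K] (v : Fin 8 → K) :
    (basicInvariants (quadraticOf v) (quarticOf v)).j =
      v 3 * v 5 * v 7 - 3 / 8 * v 3 * v 6 ^ 2 - 3 / 8 * v 4 ^ 2 * v 7 + v 4 * v 5 * v 6 / 8
        - v 5 ^ 3 / 36 := by
  simp only [basicInvariants, quarticOf_eq_binQuartic, covH_binQuartic,
    constantCoeff_transvectant_binQuartic]
  ring

lemma basicInvariants_b [CharZero K] (v : Fin 8 → K) (h0 : v 0 = 0) (h2 : v 2 = 0) :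
    (basicInvariants (quadraticOf v) (quarticOf v)).b =
      v 1 ^ 2 * (v 3 * v 7 / 3 + v 4 * v 6 / 24 - v 5 ^ 2 / 36) := by
  simp only [basicInvariants, quarticOf_eq_binQuartic, quadraticOf_sq, covH_binQuartic,
    constantCoeff_transvectant_binQuartic, h0, h2]
  ring

/-- The invariant `c` when `f` is a multiple of `X₀ X₁`. -/
lemma basicInvariants_c_of_hyperbolic [CharZero K] (v : Fin 8 → K) (h0 : v 0 = 0) (h2 : v 2 = 0) :
    (basicInvariants (quadraticOf v) (quarticOf v)).c =
      v 1 ^ 3 * (v 3 * v 6 ^ 2 - v 4 ^ 2 * v 7) / 32 := by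
  have h : quadraticOf v ^ 3 = sextic 0 0 0 (v 1 ^ 3) 0 0 0 := by
    rw [quadraticOf, sextic, h0, h2]
    simp only [C_0, C_pow]
    ring
  simp only [basicInvariants, h, quarticOf_eq_binQuartic, covT, covH_binQuartic,
    transvectant_one_binQuartic, constantCoeff_transvectant_sextic]
  ring

/-- The invariant `c` when `f` is a multiple of `X₀²` and `X₀` divides `g`. -/
lemma basicInvariants_c_of_square [CharZero K] (v : Fin 8 → K) (h1 : v 1 = 0) (h2 : v 2 = 0)
    (h7 : v 7 = 0) :
    (basicInvariants (quadraticOf v) (quarticOf v)).c = - v 0 ^ 3 * v 6 ^ 3 / 32 := by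
  have h : quadraticOf v ^ 3 = sextic (v 0 ^ 3) 0 0 0 0 0 0 := by
    rw [quadraticOf, sextic, h1, h2]
    simp only [C_0, C_pow]
    ring
  simp only [basicInvariants, h, quarticOf_eq_binQuartic, covT, covH_binQuartic,
    transvectant_one_binQuartic, constantCoeff_transvectant_sextic, h7]
  ring

lemma ctilde_of_hyperbolic [CharZero K] (v : Fin 8 → K) (h0 : v 0 = 0) (h2 : v 2 = 0) :
    (basicInvariants (quadraticOf v) (quarticOf v)).ctilde = - v 1 ^ 4 * v 4 * v 6 / 32 := by
  rw [Invariants.ctilde, basicInvariants_b v h0 h2, basicInvariants_d, basicInvariants_i,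
    basicInvariants_a, h0, h2]
  ring

end Formulas

/-! ### Tuples of coefficients -/

section Tuples

variable {K : Type*} [Field K]

lemma Invariants.scale_scale (α β : K) (w : Invariants K) :
    (w.scale α).scale β = w.scale (β * α) := by
  simp only [Invariants.scale, Invariants.mk.injEq]
  refine ⟨?_, ?_, ?_, ?_, ?_, ?_⟩ <;> ring

lemma Invariants.scale_one (w : Invariants K) : w.scale 1 = w := by
  simp [Invariants.scale]

lemma Invariants.ctilde_scale (α : K) (w : Invariants K) :
    (w.scale α).ctilde = α ^ 6 * w.ctilde := by
  simp only [Invariants.scale, Invariants.ctilde]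
  ring

/-- The basic invariants of an 8-tuple of coefficients. -/
noncomputable def tupleInv (v : Fin 8 → K) : Invariants K :=
  basicInvariants (quadraticOf v) (quarticOf v)

/-- Two 8-tuples are related if the pairs of forms they encode arise from one another by a linear
substitution and the rescaling of the corresponding cubic forms. Conjugation by `N⁻¹` multiplies
the quartic form, but not the quadratic one, by `(det N)⁻¹`; the factor `u` absorbs it. -/
def Related (v v' : Fin 8 → K) : Prop :=
  ∃ (N : Matrix (Fin 2) (Fin 2) K) (u : K), N.det ≠ 0 ∧ u ≠ 0 ∧
    quadraticOf v' = C (u * N.det) * subst N (quadraticOf v) ∧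
    quarticOf v' = C u * subst N (quarticOf v)

lemma Related.trans {v v' v'' : Fin 8 → K} (h : Related v v') (h' : Related v' v'') :
    Related v v'' := by
  obtain ⟨N, u, hN, hu, hf, hg⟩ := h
  obtain ⟨N', u', hN', hu', hf', hg'⟩ := h'
  refine ⟨N * N', u * u', ?_, mul_ne_zero hu hu', ?_, ?_⟩
  · rw [Matrix.det_mul]
    exact mul_ne_zero hN hN'
  · rw [hf', hf, map_mul (subst N'), subst_C, subst_subst, Matrix.det_mul, ← mul_assoc, ← C_mul]
    ring_nf
  · rw [hg', hg, map_mul (subst N'), subst_C, subst_subst, ← mul_assoc, ← C_mul]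
    ring_nf

lemma Related.symm {v v' : Fin 8 → K} (h : Related v v') : Related v' v := by
  obtain ⟨N, u, hN, hu, hf, hg⟩ := h
  have hinv : N * N⁻¹ = 1 := Matrix.mul_nonsing_inv N (isUnit_iff_ne_zero.mpr hN)
  have hdet : N.det * N⁻¹.det = 1 := by rw [← Matrix.det_mul, hinv, Matrix.det_one]
  refine ⟨N⁻¹, u⁻¹, right_ne_zero_of_mul_eq_one hdet, inv_ne_zero hu, ?_, ?_⟩
  · have : u⁻¹ * N⁻¹.det * (u * N.det) = 1 := by
      rw [mul_mul_mul_comm, inv_mul_cancel₀ hu, mul_comm (N⁻¹.det), hdet, one_mul]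
    rw [hf, map_mul (subst N⁻¹), subst_C, subst_subst, hinv, subst_one, ← mul_assoc, ← C_mul,
      this, C_1, one_mul]
  · rw [hg, map_mul (subst N⁻¹), subst_C, subst_subst, hinv, subst_one, ← mul_assoc, ← C_mul,
      inv_mul_cancel₀ hu, C_1, one_mul]

lemma Related.tupleInv_eq {v v' : Fin 8 → K} (h : Related v v') :
    ∃ α : K, α ≠ 0 ∧ tupleInv v' = (tupleInv v).scale α := by
  obtain ⟨N, u, hN, hu, hf, hg⟩ := h
  refine ⟨u * N.det ^ 2, mul_ne_zero hu (pow_ne_zero 2 hN), ?_⟩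
  rw [tupleInv, hf, hg, basicInvariants_transform, tupleInv]

/-- The substitution `X₀ ↦ p X₀ + q X₁`, `X₁ ↦ r X₀ + s X₁` and the scaling factor `u` in terms
of coefficients. -/
lemma related_of_eq {v v' : Fin 8 → K} (p q r s u : K) (hdet : p * s - q * r ≠ 0) (hu : u ≠ 0)
    (h0 : v' 0 = u * (p * s - q * r) * (v 0 * p ^ 2 + v 1 * p * r + v 2 * r ^ 2))
    (h1 : v' 1 = u * (p * s - q * r) *
      (2 * v 0 * p * q + v 1 * (p * s + q * r) + 2 * v 2 * r * s))
    (h2 : v' 2 = u * (p * s - q * r) * (v 0 * q ^ 2 + v 1 * q * s + v 2 * s ^ 2))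
    (h3 : v' 3 = u * (v 3 * p ^ 4 + v 4 * p ^ 3 * r + v 5 * p ^ 2 * r ^ 2 + v 6 * p * r ^ 3 +
      v 7 * r ^ 4))
    (h4 : v' 4 = u * (4 * v 3 * p ^ 3 * q + v 4 * (p ^ 3 * s + 3 * p ^ 2 * q * r) +
      v 5 * (2 * p ^ 2 * r * s + 2 * p * q * r ^ 2) + v 6 * (3 * p * r ^ 2 * s + q * r ^ 3) +
      4 * v 7 * r ^ 3 * s))
    (h5 : v' 5 = u * (6 * v 3 * p ^ 2 * q ^ 2 + v 4 * (3 * p ^ 2 * q * s + 3 * p * q ^ 2 * r) +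
      v 5 * (p ^ 2 * s ^ 2 + 4 * p * q * r * s + q ^ 2 * r ^ 2) +
      v 6 * (3 * p * r * s ^ 2 + 3 * q * r ^ 2 * s) + 6 * v 7 * r ^ 2 * s ^ 2))
    (h6 : v' 6 = u * (4 * v 3 * p * q ^ 3 + v 4 * (q ^ 3 * r + 3 * p * q ^ 2 * s) +
      v 5 * (2 * q ^ 2 * r * s + 2 * p * q * s ^ 2) + v 6 * (p * s ^ 3 + 3 * q * r * s ^ 2) +
      4 * v 7 * r * s ^ 3))
    (h7 : v' 7 = u * (v 3 * q ^ 4 + v 4 * q ^ 3 * s + v 5 * q ^ 2 * s ^ 2 + v 6 * q * s ^ 3 +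
      v 7 * s ^ 4)) :
    Related v v' := by
  have hd : (!![p, q; r, s] : Matrix (Fin 2) (Fin 2) K).det = p * s - q * r := by
    rw [Matrix.det_fin_two_of]
  refine ⟨!![p, q; r, s], u, by rwa [hd], hu, ?_, ?_⟩
  · rw [hd, quadraticOf, quadraticOf, h0, h1, h2]
    simp only [map_add, map_mul, map_pow, map_sub, subst_X, subst_C, Matrix.of_apply,
      Matrix.cons_val', Matrix.cons_val_zero, Matrix.cons_val_one, Matrix.cons_val_fin_one,
      map_ofNat]
    ring
  · rw [quarticOf, quarticOf, h3, h4, h5, h6, h7]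
    simp only [map_add, map_mul, map_pow, subst_X, subst_C, Matrix.of_apply,
      Matrix.cons_val', Matrix.cons_val_zero, Matrix.cons_val_one, Matrix.cons_val_fin_one,
      map_ofNat]
    ring

lemma eq_of_coeff₂_eq {p q : MvPolynomial (Fin 2) K} {d : ℕ} (hp : p.IsHomogeneous d)
    (hq : q.IsHomogeneous d) (h : ∀ m n, m + n = d → coeff₂ m n p = coeff₂ m n q) : p = q := by
  ext m
  have hm : m = Finsupp.single 0 (m 0) + Finsupp.single 1 (m 1) := by
    ext i
    fin_cases i <;> simp
  have hdeg : m.degree = m 0 + m 1 := by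
    simp [Finsupp.degree_eq_sum, Fin.sum_univ_two]
  by_cases hd : m 0 + m 1 = d
  · rw [hm]
    exact h _ _ hd
  · rw [hp.coeff_eq_zero (by rwa [hdeg]), hq.coeff_eq_zero (by rwa [hdeg])]

lemma isHomogeneous_term (c : K) (m n : ℕ) :
    (C c * X 0 ^ m * X 1 ^ n : MvPolynomial (Fin 2) K).IsHomogeneous (m + n) :=
  (isHomogeneous_C_mul_X_pow c 0 m).mul (isHomogeneous_X_pow 1 n)

lemma quadraticOf_isHomogeneous (v : Fin 8 → K) : (quadraticOf v).IsHomogeneous 2 := by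
  have h : quadraticOf v =
      C (v 0) * X 0 ^ 2 * X 1 ^ 0 + C (v 1) * X 0 ^ 1 * X 1 ^ 1 + C (v 2) * X 0 ^ 0 * X 1 ^ 2 := by
    rw [quadraticOf]
    ring
  rw [h]
  exact ((isHomogeneous_term _ 2 0).add (isHomogeneous_term _ 1 1)).add (isHomogeneous_term _ 0 2)

lemma quarticOf_eq_sum (v : Fin 8 → K) : quarticOf v =
    C (v 3) * X 0 ^ 4 * X 1 ^ 0 + C (v 4) * X 0 ^ 3 * X 1 ^ 1 + C (v 5) * X 0 ^ 2 * X 1 ^ 2 +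
      C (v 6) * X 0 ^ 1 * X 1 ^ 3 + C (v 7) * X 0 ^ 0 * X 1 ^ 4 := by
  rw [quarticOf]
  ring

lemma quarticOf_isHomogeneous (v : Fin 8 → K) : (quarticOf v).IsHomogeneous 4 := by
  rw [quarticOf_eq_sum]
  exact ((((isHomogeneous_term _ 4 0).add (isHomogeneous_term _ 3 1)).add
    (isHomogeneous_term _ 2 2)).add (isHomogeneous_term _ 1 3)).add (isHomogeneous_term _ 0 4)

lemma coeff₂_quarticOf (m n : ℕ) (v : Fin 8 → K) :
    coeff₂ m n (quarticOf v) =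
      (if 4 = m ∧ 0 = n then v 3 else 0) + (if 3 = m ∧ 1 = n then v 4 else 0) +
      (if 2 = m ∧ 2 = n then v 5 else 0) + (if 1 = m ∧ 3 = n then v 6 else 0) +
      (if 0 = m ∧ 4 = n then v 7 else 0) := by
  simp only [quarticOf_eq_sum, coeff₂_add, coeff₂_term]

/-- The 8-tuple of coefficients of a quadratic and a quartic form. -/
noncomputable def tupleOf (f g : MvPolynomial (Fin 2) K) : Fin 8 → K :=
  ![coeff₂ 2 0 f, coeff₂ 1 1 f, coeff₂ 0 2 f, coeff₂ 4 0 g, coeff₂ 3 1 g, coeff₂ 2 2 g,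
    coeff₂ 1 3 g, coeff₂ 0 4 g]

lemma quadraticOf_tupleOf {f : MvPolynomial (Fin 2) K} (hf : f.IsHomogeneous 2)
    (g : MvPolynomial (Fin 2) K) : quadraticOf (tupleOf f g) = f := by
  refine eq_of_coeff₂_eq (quadraticOf_isHomogeneous _) hf fun m n hmn => ?_
  obtain ⟨rfl, rfl⟩ | ⟨rfl, rfl⟩ | ⟨rfl, rfl⟩ :
    (m = 2 ∧ n = 0) ∨ (m = 1 ∧ n = 1) ∨ (m = 0 ∧ n = 2) := by omega
  all_goals simp [coeff₂_quadraticOf, tupleOf]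

lemma quarticOf_tupleOf {g : MvPolynomial (Fin 2) K} (hg : g.IsHomogeneous 4)
    (f : MvPolynomial (Fin 2) K) : quarticOf (tupleOf f g) = g := by
  refine eq_of_coeff₂_eq (quarticOf_isHomogeneous _) hg fun m n hmn => ?_
  obtain ⟨rfl, rfl⟩ | ⟨rfl, rfl⟩ | ⟨rfl, rfl⟩ | ⟨rfl, rfl⟩ | ⟨rfl, rfl⟩ :
    (m = 4 ∧ n = 0) ∨ (m = 3 ∧ n = 1) ∨ (m = 2 ∧ n = 2) ∨ (m = 1 ∧ n = 3) ∨ (m = 0 ∧ n = 4) := by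
    omega
  all_goals simp [coeff₂_quarticOf, tupleOf]

end Tuples

/-! ### Models of moduli points -/

section Models

variable {K : Type*} [Field K]

namespace CubicPair

/-- A cubic pair is determined by its divergence and its fixed point polynomial. -/
lemma four_mul_F (F : CubicPair K) :
    4 * F.F 0 = pderiv 1 F.fixedPoint + X 0 * F.divergence ∧
      4 * F.F 1 = -pderiv 0 F.fixedPoint + X 1 * F.divergence := by
  have e0 := (F.homog 0).sum_X_mul_pderiv
  have e1 := (F.homog 1).sum_X_mul_pderiv
  simp only [Fin.sum_univ_two, nsmul_eq_mul, Nat.cast_ofNat] at e0 e1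
  simp only [fixedPoint, divergence, map_sub, pderiv_mul, pderiv_X_self,
    pderiv_X_of_ne (zero_ne_one : (0 : Fin 2) ≠ 1), pderiv_X_of_ne (one_ne_zero : (1 : Fin 2) ≠ 0)]
  constructor
  · linear_combination -e0
  · linear_combination -e1

lemma divergence_isHomogeneous (F : CubicPair K) : F.divergence.IsHomogeneous 2 :=
  (F.homog 0).pderiv.add (F.homog 1).pderiv

lemma fixedPoint_isHomogeneous (F : CubicPair K) : F.fixedPoint.IsHomogeneous 4 :=
  ((isHomogeneous_X K 1).mul (F.homog 0)).sub ((isHomogeneous_X K 0).mul (F.homog 1))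

lemma divergence_smul (M : GL (Fin 2) K) (F : CubicPair K) :
    (M • F).divergence = subst (M⁻¹ : GL (Fin 2) K).val F.divergence := by
  have h : (M⁻¹ : GL (Fin 2) K).val * M.val = 1 := by
    rw [← Units.val_mul, inv_mul_cancel, Units.val_one]
  have e : ∀ i j, (C ((M⁻¹ : GL (Fin 2) K).val i 0) * C (M.val 0 j) +
      C ((M⁻¹ : GL (Fin 2) K).val i 1) * C (M.val 1 j) : MvPolynomial (Fin 2) K) =
      C ((1 : Matrix (Fin 2) (Fin 2) K) i j) := by
    intro i j
    rw [← h, Matrix.mul_apply, Fin.sum_univ_two, C_add, C_mul, C_mul]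
  have e00 := e 0 0
  have e01 := e 0 1
  have e10 := e 1 0
  have e11 := e 1 1
  simp only [Matrix.one_apply_eq, Matrix.one_apply_ne (zero_ne_one : (0 : Fin 2) ≠ 1),
    Matrix.one_apply_ne (one_ne_zero : (1 : Fin 2) ≠ 0), C_0, C_1] at e00 e01 e10 e11
  simp only [divergence, smul_F, Fin.sum_univ_two, map_add, pderiv_C_mul, pderiv_subst]
  linear_combination subst (M⁻¹ : GL (Fin 2) K).val (pderiv 0 (F.F 0)) * e00 +
    subst (M⁻¹ : GL (Fin 2) K).val (pderiv 1 (F.F 0)) * e10 +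
    subst (M⁻¹ : GL (Fin 2) K).val (pderiv 0 (F.F 1)) * e01 +
    subst (M⁻¹ : GL (Fin 2) K).val (pderiv 1 (F.F 1)) * e11

lemma fixedPoint_smul (M : GL (Fin 2) K) (F : CubicPair K) :
    (M • F).fixedPoint = C M.val.det * subst (M⁻¹ : GL (Fin 2) K).val F.fixedPoint := by
  have hX : ∀ i, (X i : MvPolynomial (Fin 2) K) =
      C (M.val i 0) * subst (M⁻¹ : GL (Fin 2) K).val (X 0) +
        C (M.val i 1) * subst (M⁻¹ : GL (Fin 2) K).val (X 1) := by
    intro i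
    have h : subst (M⁻¹ : GL (Fin 2) K).val (subst M.val (X i)) = X i := by
      rw [subst_subst, ← Units.val_mul, mul_inv_cancel, Units.val_one, subst_one]
    rw [subst_X, map_add, map_mul, map_mul, subst_C, subst_C] at h
    exact h.symm
  simp only [fixedPoint, smul_F, Fin.sum_univ_two, map_sub, map_mul, Matrix.det_fin_two]
  linear_combination (C (M.val 0 0) * subst (M⁻¹ : GL (Fin 2) K).val (F.F 0) +
      C (M.val 0 1) * subst (M⁻¹ : GL (Fin 2) K).val (F.F 1)) * hX 1 -
    (C (M.val 1 0) * subst (M⁻¹ : GL (Fin 2) K).val (F.F 0) +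
      C (M.val 1 1) * subst (M⁻¹ : GL (Fin 2) K).val (F.F 1)) * hX 0

/-- The pair `(c F₀, c F₁)`. -/
noncomputable def rescale (c : Kˣ) (F : CubicPair K) : CubicPair K where
  F i := C (c : K) * F.F i
  homog i := (F.homog i).C_mul _
  coprime := by
    intro p h0 h1
    have hu : IsUnit (C (c : K) : MvPolynomial (Fin 2) K) := c.isUnit.map C
    exact F.coprime (hu.dvd_mul_left.mp h0) (hu.dvd_mul_left.mp h1)

lemma divergence_of_proportional {F G : CubicPair K} {c : K} (h : ∀ i, G.F i = C c * F.F i) :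
    G.divergence = C c * F.divergence := by
  simp only [divergence, h, pderiv_C_mul]
  ring

lemma fixedPoint_of_proportional {F G : CubicPair K} {c : K} (h : ∀ i, G.F i = C c * F.F i) :
    G.fixedPoint = C c * F.fixedPoint := by
  simp only [fixedPoint, h]
  ring

lemma proportional_of_forms [CharZero K] {F G : CubicPair K} {c : K}
    (hf : G.divergence = C c * F.divergence) (hg : G.fixedPoint = C c * F.fixedPoint) (i : Fin 2) :
    G.F i = C c * F.F i := by
  have h4 : (4 : MvPolynomial (Fin 2) K) ≠ 0 := by norm_num
  have hG := G.four_mul_F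
  have hF := F.four_mul_F
  rw [hf, hg, pderiv_C_mul, pderiv_C_mul] at hG
  refine mul_left_cancel₀ h4 ?_
  fin_cases i
  · change 4 * G.F 0 = 4 * (C c * F.F 0)
    linear_combination hG.1 - C c * hF.1
  · change 4 * G.F 1 = 4 * (C c * F.F 1)
    linear_combination hG.2 - C c * hF.2

end CubicPair

namespace M3

lemma of_eq_of_iff {F G : CubicPair K} :
    of F = of G ↔ ∃ (M : GL (Fin 2) K) (c : Kˣ), ∀ i, G.F i = C (c : K) * (M • F).F i := by
  constructor
  · intro h
    obtain ⟨γ, hγ⟩ := (Quotient.exact h.symm : MulAction.orbitRel PGL(2, K) (Rat3 K) _ _)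
    induction γ using Matrix.ProjGenLinGroup.induction_on with
    | mk M =>
      have h' : Rat3.mk (M • F) = Rat3.mk G := hγ
      obtain ⟨c, hc⟩ := Quotient.exact h'
      exact ⟨M, c, hc⟩
  · rintro ⟨M, c, h⟩
    have h' : Rat3.mk (M • F) = Rat3.mk G := Quotient.sound ⟨c, h⟩
    refine (Quotient.sound (s := MulAction.orbitRel PGL(2, K) (Rat3 K))
      (⟨Matrix.ProjGenLinGroup.mk M, ?_⟩ :
        MulAction.orbitRel PGL(2, K) (Rat3 K) (Rat3.mk G) (Rat3.mk F))).symm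
    exact h'

variable {P : M3 K} {v v' : Fin 8 → K}

lemma exists_of_eq (P : M3 K) : ∃ F : CubicPair K, of F = P := by
  obtain ⟨φ, rfl⟩ := Quotient.exists_rep P
  obtain ⟨F, rfl⟩ := Quotient.exists_rep φ
  exact ⟨F, rfl⟩

lemma isModel_tupleOf (F : CubicPair K) :
    (of F).IsModel (tupleOf F.divergence F.fixedPoint) :=
  ⟨F, rfl, (quadraticOf_tupleOf F.divergence_isHomogeneous _).symm,
    (quarticOf_tupleOf F.fixedPoint_isHomogeneous _).symm⟩

lemma exists_isModel (P : M3 K) : ∃ v, P.IsModel v := by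
  obtain ⟨F, rfl⟩ := exists_of_eq P
  exact ⟨_, isModel_tupleOf F⟩

/-- The models of a moduli point form a single orbit of tuples. -/
lemma IsModel.related (h : P.IsModel v) (h' : P.IsModel v') : Related v v' := by
  obtain ⟨F, hF, hf, hg⟩ := h
  obtain ⟨G, hG, hf', hg'⟩ := h'
  obtain ⟨M, c, hc⟩ := of_eq_of_iff.mp (hF.trans hG.symm)
  have hdet : M.val.det * (M⁻¹ : GL (Fin 2) K).val.det = 1 := by
    rw [← Matrix.det_mul, ← Units.val_mul, mul_inv_cancel, Units.val_one, Matrix.det_one]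
  refine ⟨(M⁻¹ : GL (Fin 2) K).val, c * M.val.det, right_ne_zero_of_mul_eq_one hdet,
    mul_ne_zero c.ne_zero (left_ne_zero_of_mul_eq_one hdet), ?_, ?_⟩
  · rw [← hf', ← hf, CubicPair.divergence_of_proportional hc, CubicPair.divergence_smul,
      mul_assoc, hdet, mul_one]
  · rw [← hg', ← hg, CubicPair.fixedPoint_of_proportional hc, CubicPair.fixedPoint_smul, C_mul,
      mul_assoc]

lemma IsModel.of_related (h : P.IsModel v) (hv : Related v v') : P.IsModel v' := by
  obtain ⟨F, hF, hf, hg⟩ := h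
  obtain ⟨N, u, hN, hu, hf', hg'⟩ := hv
  let M : GL (Fin 2) K := (Matrix.GeneralLinearGroup.mkOfDetNeZero N hN)⁻¹
  have hM : (M⁻¹ : GL (Fin 2) K).val = N := by
    rw [inv_inv]
    rfl
  have hdet : M.val.det * N.det = 1 := by
    rw [← hM, ← Matrix.det_mul, ← Units.val_mul, mul_inv_cancel, Units.val_one, Matrix.det_one]
  let c : Kˣ := Units.mk0 (u * N.det) (mul_ne_zero hu hN)
  have hc : ∀ i, ((M • F).rescale c).F i = C (u * N.det) * (M • F).F i := fun i => rfl
  refine ⟨(M • F).rescale c, ?_, ?_, ?_⟩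
  · rw [← hF]
    exact (of_eq_of_iff.mpr ⟨M, c, hc⟩).symm
  · rw [CubicPair.divergence_of_proportional hc, CubicPair.divergence_smul, hf, hM, hf']
  · rw [CubicPair.fixedPoint_of_proportional hc, CubicPair.fixedPoint_smul, hg, hM, hg',
      ← mul_assoc, ← C_mul, mul_assoc u, mul_comm N.det, hdet, mul_one]

lemma IsModel.exists_inv_eq (h : P.IsModel v) :
    ∃ F : CubicPair K, of F = P ∧ F.inv = tupleInv v := by
  obtain ⟨F, hF, hf, hg⟩ := h
  exact ⟨F, hF, by rw [CubicPair.inv, hf, hg, tupleInv]⟩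

lemma IsModel.inv_eq_scale (h : P.IsModel v) {F : CubicPair K} (hF : of F = P) :
    ∃ α : K, α ≠ 0 ∧ F.inv = (tupleInv v).scale α := by
  subst hF
  obtain ⟨α, hα, e⟩ := (h.related (isModel_tupleOf F)).tupleInv_eq
  refine ⟨α, hα, ?_⟩
  rw [← e, tupleInv, quadraticOf_tupleOf F.divergence_isHomogeneous,
    quarticOf_tupleOf F.fixedPoint_isHomogeneous, CubicPair.inv]

lemma IsModel.hasCoords_iff {k : Type*} [Field k] [Algebra k K] (h : P.IsModel v)
    {w : Invariants k} :
    P.HasCoords w ↔ ∃ α : K, α ≠ 0 ∧ (tupleInv v).scale α = w.map (algebraMap k K) := by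
  constructor
  · rintro ⟨F, hF, α, hα⟩
    obtain ⟨β, hβ, e⟩ := h.inv_eq_scale hF
    rw [e, Invariants.scale_scale] at hα
    exact ⟨_, mul_ne_zero α.ne_zero hβ, hα⟩
  · rintro ⟨α, hα, e⟩
    obtain ⟨F, hF, e'⟩ := h.exists_inv_eq
    exact ⟨F, hF, Units.mk0 α hα, by rw [e', Units.val_mk0, e]⟩

/-- Weighted projective coordinates are realized exactly by a suitable rescaling of a model. -/
lemma IsModel.exists_tupleInv_eq {k : Type*} [Field k] [Algebra k K] (h : P.IsModel v)
    {w : Invariants k} (hw : P.HasCoords w) :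
    ∃ α : K, α ≠ 0 ∧ P.IsModel (fun n => α * v n) ∧
      tupleInv (fun n => α * v n) = w.map (algebraMap k K) := by
  obtain ⟨α, hα, e⟩ := h.hasCoords_iff.mp hw
  have hf : quadraticOf (fun n => α * v n) =
      C (α * (1 : Matrix (Fin 2) (Fin 2) K).det) * subst 1 (quadraticOf v) := by
    rw [subst_one, Matrix.det_one, mul_one, quadraticOf, quadraticOf]
    simp only [C_mul]
    ring
  have hg : quarticOf (fun n => α * v n) = C α * subst 1 (quarticOf v) := by
    rw [subst_one, quarticOf, quarticOf]
    simp only [C_mul]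
    ring
  refine ⟨α, hα, h.of_related ⟨1, α, ?_, hα, hf, hg⟩, ?_⟩
  · rw [Matrix.det_one]
    exact one_ne_zero
  · rw [← e, tupleInv, hf, hg, basicInvariants_transform, Matrix.det_one, one_pow, mul_one,
      tupleInv]

lemma IsModel.inv_of_mem_locusC21 (h : P.IsModel v) (hP : P ∈ locusC21 K) :
    (tupleInv v).c = 0 ∧ (tupleInv v).ctilde = 0 := by
  obtain ⟨F, hF, hc, hct⟩ := hP
  obtain ⟨α, hα, e⟩ := h.inv_eq_scale hF
  rw [e, Invariants.ctilde_scale] at hct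
  rw [e] at hc
  exact ⟨(mul_eq_zero.mp hc).resolve_left (pow_ne_zero 6 hα),
    (mul_eq_zero.mp hct).resolve_left (pow_ne_zero 6 hα)⟩

/-- If `X₀` divides `f` and `X₀²` divides `g`, then `X₀` is a common factor of the cubic forms. -/
lemma IsModel.nondegenerate_left [CharZero K] (h : P.IsModel v) (h2 : v 2 = 0) (h6 : v 6 = 0)
    (h7 : v 7 = 0) : False := by
  obtain ⟨F, -, hf, hg⟩ := h
  have h4 : IsUnit (4 : MvPolynomial (Fin 2) K) := by
    rw [← map_ofNat C 4]
    exact (isUnit_iff_ne_zero.mpr (by norm_num : (4 : K) ≠ 0)).map C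
  have e := F.four_mul_F
  rw [hf, hg, quadraticOf, quarticOf, h2, h6, h7] at e
  have hX : IsUnit (X 0 : MvPolynomial (Fin 2) K) := by
    refine F.coprime (h4.dvd_mul_left.mp ?_) (h4.dvd_mul_left.mp ?_)
    · rw [e.1]
      exact Dvd.intro (C (v 4) * X 0 ^ 2 + 2 * C (v 5) * X 0 * X 1 + C (v 0) * X 0 ^ 2 +
        C (v 1) * X 0 * X 1) (by simp [pderiv_X]; ring)
    · rw [e.2]
      exact Dvd.intro (-(4 * C (v 3) * X 0 ^ 2 + 3 * C (v 4) * X 0 * X 1 + 2 * C (v 5) * X 1 ^ 2)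
        + C (v 0) * X 0 * X 1 + C (v 1) * X 1 ^ 2) (by simp [pderiv_X]; ring)
  have := hX.map constantCoeff
  simp at this

/-- If `X₁` divides `f` and `X₁²` divides `g`, then `X₁` is a common factor of the cubic forms. -/
lemma IsModel.nondegenerate_right [CharZero K] (h : P.IsModel v) (h0 : v 0 = 0) (h3 : v 3 = 0)
    (h4 : v 4 = 0) : False := by
  refine (h.of_related (v' := ![-v 2, -v 1, -v 0, v 7, v 6, v 5, v 4, v 3])
    (related_of_eq 0 1 1 0 1 (by norm_num) one_ne_zero ?_ ?_ ?_ ?_ ?_ ?_ ?_ ?_)).nondegenerate_left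
      ?_ ?_ ?_
  all_goals simp [h0, h3, h4]

/-- A `k`-model is the same as a model whose 8-tuple has entries in `k`. -/
lemma hasModelOver_iff {k : Type*} [Field k] [CharZero k] [Algebra k K] :
    P.HasModelOver k ↔ ∃ v : Fin 8 → k, P.IsModel (algebraMap k K ∘ v) := by
  have hmap : ∀ (m n : ℕ) (p : MvPolynomial (Fin 2) k),
      coeff₂ m n (map (algebraMap k K) p) = algebraMap k K (coeff₂ m n p) :=
    fun m n p => coeff_map _ _ _
  constructor
  · rintro ⟨F, G, rfl, hG⟩
    refine ⟨tupleOf (pderiv 0 (G 0) + pderiv 1 (G 1)) (X 1 * G 0 - X 0 * G 1), ?_⟩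
    convert! isModel_tupleOf F using 1
    have hf : F.divergence = map (algebraMap k K) (pderiv 0 (G 0) + pderiv 1 (G 1)) := by
      simp only [CubicPair.divergence, hG, pderiv_map, map_add]
    have hg : F.fixedPoint = map (algebraMap k K) (X 1 * G 0 - X 0 * G 1) := by
      simp only [CubicPair.fixedPoint, hG, map_sub, map_mul, map_X]
    rw [hf, hg]
    funext n
    fin_cases n <;> exact (hmap _ _ _).symm
  · rintro ⟨v, F, hF, hf, hg⟩
    have hf' : quadraticOf (algebraMap k K ∘ v) = map (algebraMap k K) (quadraticOf v) := by
      simp [quadraticOf]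
    have hg' : quarticOf (algebraMap k K ∘ v) = map (algebraMap k K) (quarticOf v) := by
      simp [quarticOf]
    have h4 : (C (1 / 4) * 4 : MvPolynomial (Fin 2) k) = 1 := by
      rw [← map_ofNat C 4, ← C_mul, ← C_1]
      norm_num
    have h4' := congrArg (map (algebraMap k K)) h4
    rw [map_mul, map_one, map_ofNat] at h4'
    have e := F.four_mul_F
    rw [hf, hg, hf', hg', pderiv_map, pderiv_map] at e
    refine ⟨F, ![C (1 / 4) * (pderiv 1 (quarticOf v) + X 0 * quadraticOf v),
      C (1 / 4) * (-pderiv 0 (quarticOf v) + X 1 * quadraticOf v)], hF, fun i => ?_⟩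
    fin_cases i
    · change F.F 0 = map _ (C (1 / 4) * (pderiv 1 (quarticOf v) + X 0 * quadraticOf v))
      rw [map_mul, map_add, map_mul, map_X, ← e.1, ← mul_assoc, h4', one_mul]
    · change F.F 1 = map _ (C (1 / 4) * (-pderiv 0 (quarticOf v) + X 1 * quadraticOf v))
      rw [map_mul, map_add, map_mul, map_X, map_neg, ← e.2, ← mul_assoc, h4', one_mul]

end M3

end Models

/-! ### Normal forms with `f ≠ 0` -/

section NormalForms

variable {K : Type*} [Field K]

/-- The result of a linear substitution and a rescaling, in terms of coefficients. -/
lemma exists_related (v : Fin 8 → K) (p q r s u : K) (hdet : p * s - q * r ≠ 0) (hu : u ≠ 0) :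
    ∃ v' : Fin 8 → K, Related v v' ∧
      v' 0 = u * (p * s - q * r) * (v 0 * p ^ 2 + v 1 * p * r + v 2 * r ^ 2) ∧
      v' 1 = u * (p * s - q * r) *
        (2 * v 0 * p * q + v 1 * (p * s + q * r) + 2 * v 2 * r * s) ∧
      v' 2 = u * (p * s - q * r) * (v 0 * q ^ 2 + v 1 * q * s + v 2 * s ^ 2) ∧
      v' 3 = u * (v 3 * p ^ 4 + v 4 * p ^ 3 * r + v 5 * p ^ 2 * r ^ 2 + v 6 * p * r ^ 3 +
        v 7 * r ^ 4) ∧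
      v' 4 = u * (4 * v 3 * p ^ 3 * q + v 4 * (p ^ 3 * s + 3 * p ^ 2 * q * r) +
        v 5 * (2 * p ^ 2 * r * s + 2 * p * q * r ^ 2) + v 6 * (3 * p * r ^ 2 * s + q * r ^ 3) +
        4 * v 7 * r ^ 3 * s) ∧
      v' 5 = u * (6 * v 3 * p ^ 2 * q ^ 2 + v 4 * (3 * p ^ 2 * q * s + 3 * p * q ^ 2 * r) +
        v 5 * (p ^ 2 * s ^ 2 + 4 * p * q * r * s + q ^ 2 * r ^ 2) +
        v 6 * (3 * p * r * s ^ 2 + 3 * q * r ^ 2 * s) + 6 * v 7 * r ^ 2 * s ^ 2) ∧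
      v' 6 = u * (4 * v 3 * p * q ^ 3 + v 4 * (q ^ 3 * r + 3 * p * q ^ 2 * s) +
        v 5 * (2 * q ^ 2 * r * s + 2 * p * q * s ^ 2) + v 6 * (p * s ^ 3 + 3 * q * r * s ^ 2) +
        4 * v 7 * r * s ^ 3) ∧
      v' 7 = u * (v 3 * q ^ 4 + v 4 * q ^ 3 * s + v 5 * q ^ 2 * s ^ 2 + v 6 * q * s ^ 3 +
        v 7 * s ^ 4) :=
  ⟨![_, _, _, _, _, _, _, _],
    related_of_eq p q r s u hdet hu rfl rfl rfl rfl rfl rfl rfl rfl,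
    rfl, rfl, rfl, rfl, rfl, rfl, rfl, rfl⟩

/-- Over any field of characteristic zero a nonzero quadratic form can be brought to the shape
`X₀² + c X₁²`, up to scaling. -/
lemma exists_related_diagonal [CharZero K] (v : Fin 8 → K) (hv : ¬(v 0 = 0 ∧ v 1 = 0 ∧ v 2 = 0)) :
    ∃ v' : Fin 8 → K, Related v v' ∧ v' 0 = 1 ∧ v' 1 = 0 := by
  have key : ∀ v : Fin 8 → K, v 0 ≠ 0 → ∃ v' : Fin 8 → K, Related v v' ∧ v' 0 = 1 ∧ v' 1 = 0 := by
    intro v h0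
    obtain ⟨v', h, e0, e1, -⟩ := exists_related v 1 (-v 1 / (2 * v 0)) 0 1 (1 / v 0)
      (by simp) (one_div_ne_zero h0)
    refine ⟨v', h, ?_, ?_⟩
    · rw [e0]
      field_simp
      ring
    · rw [e1]
      field_simp
      ring
  -- If `v 0 = 0`, the substitution `X₁ ↦ X₀ + X₁` or the exchange of the variables helps.
  by_cases h0 : v 0 = 0
  · by_cases h2 : v 2 = 0
    · have h1 : v 1 ≠ 0 := fun h1 => hv ⟨h0, h1, h2⟩
      obtain ⟨v', h, e0, -⟩ := exists_related v 1 0 1 1 1 (by simp) one_ne_zero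
      obtain ⟨v'', h', e⟩ := key v' (by rw [e0, h0, h2]; simpa using h1)
      exact ⟨v'', h.trans h', e⟩
    · obtain ⟨v', h, e0, -⟩ := exists_related v 0 1 1 0 1 (by simp) one_ne_zero
      obtain ⟨v'', h', e⟩ := key v' (by rw [e0]; simpa using h2)
      exact ⟨v'', h.trans h', e⟩
  · exact key v h0

/-- The forms `f = r X₀ X₁` and `g = α X₀⁴ + β X₀² X₁² + γ X₁⁴`, with `r`, `α` and `γ` nonzero. -/
structure IsSplitForm (v : Fin 8 → K) : Prop where
  h0 : v 0 = 0
  h1 : v 1 ≠ 0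
  h2 : v 2 = 0
  h3 : v 3 ≠ 0
  h4 : v 4 = 0
  h6 : v 6 = 0
  h7 : v 7 ≠ 0

/-- The substitution that turns `X₀² - t⁻² X₁²` into a multiple of `X₀ X₁`. -/
lemma exists_related_hyperbolic [CharZero K] (v : Fin 8 → K) (h0 : v 0 = 1) (h1 : v 1 = 0)
    {t u : K} (ht : t ^ 2 * v 2 = -1) (hu : u ≠ 0) :
    ∃ v' : Fin 8 → K, Related v v' ∧ v' 0 = 0 ∧ v' 1 = -8 * u * t ∧ v' 2 = 0 ∧
      v' 3 = u * (v 3 + v 4 * t + v 5 * t ^ 2 + v 6 * t ^ 3 + v 7 * t ^ 4) ∧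
      v' 4 = u * (4 * v 3 + 2 * v 4 * t - 2 * v 6 * t ^ 3 - 4 * v 7 * t ^ 4) ∧
      v' 5 = u * (6 * v 3 - 2 * v 5 * t ^ 2 + 6 * v 7 * t ^ 4) ∧
      v' 6 = u * (4 * v 3 - 2 * v 4 * t + 2 * v 6 * t ^ 3 - 4 * v 7 * t ^ 4) ∧
      v' 7 = u * (v 3 - v 4 * t + v 5 * t ^ 2 - v 6 * t ^ 3 + v 7 * t ^ 4) := by
  have ht0 : t ≠ 0 := by
    rintro rfl
    simp at ht
  obtain ⟨v', h, e0, e1, e2, e3, e4, e5, e6, e7⟩ := exists_related v 1 1 t (-t) u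
    (by
      have : (1 : K) * -t - 1 * t = -2 * t := by ring
      rw [this]
      exact mul_ne_zero (by norm_num) ht0) hu
  rw [h0, h1] at e0 e1 e2
  refine ⟨v', h, ?_, ?_, ?_, ?_, ?_, ?_, ?_, ?_⟩
  · linear_combination e0 - 2 * u * t * ht
  · linear_combination e1 + 4 * u * t * ht
  · linear_combination e2 - 2 * u * t * ht
  · linear_combination e3
  · linear_combination e4
  · linear_combination e5
  · linear_combination e6
  · linear_combination e7

namespace M3

variable [CharZero K] {P : M3 K} {v : Fin 8 → K}

/-- For `f = r X₀ X₁` with `r ≠ 0`, the vanishing of `c` and `c̃` makes `g` a form in the squares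
of the variables; otherwise one of the variables would be a common factor. -/
lemma IsModel.isSplitForm (h : P.IsModel v) (hP : P ∈ locusC21 K) (h0 : v 0 = 0)
    (h1 : v 1 ≠ 0) (h2 : v 2 = 0) : IsSplitForm v := by
  obtain ⟨hc, hct⟩ := h.inv_of_mem_locusC21 hP
  rw [tupleInv, basicInvariants_c_of_hyperbolic v h0 h2] at hc
  rw [tupleInv, ctilde_of_hyperbolic v h0 h2] at hct
  have hc' : v 3 * v 6 ^ 2 = v 4 ^ 2 * v 7 := by
    have h32 : (32 : K) ≠ 0 := by norm_num
    have := (div_eq_zero_iff.mp hc).resolve_right h32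
    exact sub_eq_zero.mp ((mul_eq_zero.mp this).resolve_left (pow_ne_zero 3 h1))
  have h46 : v 4 = 0 ∨ v 6 = 0 := by
    have h32 : (32 : K) ≠ 0 := by norm_num
    have := (div_eq_zero_iff.mp hct).resolve_right h32
    rcases mul_eq_zero.mp this with h | h
    · exact Or.inl ((mul_eq_zero.mp h).resolve_left (neg_ne_zero.mpr (pow_ne_zero 4 h1)))
    · exact Or.inr h
  have hdegl := fun h6 h7 => h.nondegenerate_left h2 h6 h7
  have hdegr := fun h3 h4 => h.nondegenerate_right h0 h3 h4
  rcases h46 with h4 | h6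
  · have h3 : v 3 ≠ 0 := fun h3 => hdegr h3 h4
    have h6 : v 6 = 0 := by
      rw [h4] at hc'
      have : v 3 * v 6 ^ 2 = 0 := by rw [hc']; ring
      simpa [h3] using this
    exact ⟨h0, h1, h2, h3, h4, h6, fun h7 => hdegl h6 h7⟩
  · have h7 : v 7 ≠ 0 := fun h7 => hdegl h6 h7
    have h4 : v 4 = 0 := by
      rw [h6] at hc'
      have : v 4 ^ 2 * v 7 = 0 := by rw [← hc']; ring
      simpa [h7] using this
    exact ⟨h0, h1, h2, fun h3 => hdegr h3 h4, h4, h6, h7⟩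

variable [IsAlgClosed K]

/-- If `f = X₀² + c X₁²` with `c ≠ 0`, the equations of the locus express the last two
coefficients of `g` in terms of the first two. -/
lemma IsModel.of_diagonal (h : P.IsModel v) (hP : P ∈ locusC21 K) (h0 : v 0 = 1)
    (h1 : v 1 = 0) (h2 : v 2 ≠ 0) : v 6 = -v 2 * v 4 ∧ v 7 = v 2 ^ 2 * v 3 := by
  obtain ⟨t, ht⟩ := IsAlgClosed.exists_pow_nat_eq (-(v 2)⁻¹) (n := 2) (by norm_num)
  have ht' : t ^ 2 * v 2 = -1 := by
    rw [ht]
    field_simp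
  have ht0 : t ≠ 0 := by
    rintro rfl
    simp at ht'
  obtain ⟨v', hv, e0, e1, e2, -, e4, -, e6, -⟩ :=
    exists_related_hyperbolic v h0 h1 ht' one_ne_zero
  have hs := (h.of_related hv).isSplitForm hP e0
    (by rw [e1]; simpa using ht0) e2
  have e4 := hs.h4.symm.trans e4
  have e6 := hs.h6.symm.trans e6
  constructor
  · have : t * (4 * (v 6 + v 2 * v 4)) = 0 := by
      linear_combination -v 2 * e4 + v 2 * e6 + 4 * t * v 6 * ht'
    have := (mul_eq_zero.mp this).resolve_left ht0
    linear_combination this / 4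
  · linear_combination v 2 ^ 2 / 8 * e4 + v 2 ^ 2 / 8 * e6 - v 7 * (t ^ 2 * v 2 - 1) * ht'

end M3

/-- Split forms are classified by `r²`, `β` and `α γ`. -/
lemma IsSplitForm.related [IsAlgClosed K] {v v' : Fin 8 → K} (h : IsSplitForm v)
    (h' : IsSplitForm v')
    (e1 : v' 1 ^ 2 = v 1 ^ 2) (e5 : v' 5 = v 5) (e37 : v' 3 * v' 7 = v 3 * v 7) :
    Related v v' := by
  have h3 := h.h3
  have h3' := h'.h3
  have h7' := h'.h7
  -- A diagonal substitution of determinant one if `r' = r`, composed with the exchange of the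
  -- variables if `r' = -r`.
  rcases sq_eq_sq_iff_eq_or_eq_neg.mp e1 with e1 | e1
  · obtain ⟨t, ht⟩ := IsAlgClosed.exists_pow_nat_eq (v' 3 / v 3) (n := 4) (by norm_num)
    have ht0 : t ≠ 0 := by
      rintro rfl
      rw [zero_pow four_ne_zero, eq_comm, div_eq_zero_iff] at ht
      exact ht.elim h3' h3
    have ht' : v' 3 = v 3 * t ^ 4 := by
      rw [ht]
      field_simp
    have ht7 : v' 7 * t ^ 4 = v 7 := by
      refine mul_left_cancel₀ h3 ?_
      rw [← e37, ht']
      ring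
    refine related_of_eq t 0 0 t⁻¹ 1 (by simp [ht0]) one_ne_zero ?_ ?_ ?_ ?_ ?_ ?_ ?_ ?_ <;>
      simp only [h.h0, h'.h0, h.h2, h'.h2, h.h4, h'.h4, h.h6, h'.h6, e1, e5, ht', ← ht7] <;>
      field_simp <;> ring_nf
  · obtain ⟨t, ht⟩ := IsAlgClosed.exists_pow_nat_eq (v' 7 / v 3) (n := 4) (by norm_num)
    have ht0 : t ≠ 0 := by
      rintro rfl
      rw [zero_pow four_ne_zero, eq_comm, div_eq_zero_iff] at ht
      exact ht.elim h7' h3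
    have ht' : v' 7 = v 3 * t ^ 4 := by
      rw [ht]
      field_simp
    have ht7 : v' 3 * t ^ 4 = v 7 := by
      refine mul_left_cancel₀ h3 ?_
      rw [← e37, ht']
      ring
    refine related_of_eq 0 t t⁻¹ 0 1 (by simp [ht0]) one_ne_zero ?_ ?_ ?_ ?_ ?_ ?_ ?_ ?_ <;>
      simp only [h.h0, h'.h0, h.h2, h'.h2, h.h4, h'.h4, h.h6, h'.h6, e1, e5, ht', ← ht7] <;>
      field_simp <;> ring_nf

end NormalForms

/-! ### Change of the base field -/

section BaseChange

variable {k K : Type*} [Field k] [Field K]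

lemma map_quadraticOf (e : k →+* K) (v : Fin 8 → k) :
    map e (quadraticOf v) = quadraticOf (e ∘ v) := by
  simp [quadraticOf]

lemma map_quarticOf (e : k →+* K) (v : Fin 8 → k) :
    map e (quarticOf v) = quarticOf (e ∘ v) := by
  simp [quarticOf]

lemma map_subst (e : k →+* K) (N : Matrix (Fin 2) (Fin 2) k) (p : MvPolynomial (Fin 2) k) :
    map e (subst N p) = subst (N.map e) (map e p) := by
  induction p using MvPolynomial.induction_on with
  | C a => simp
  | add p q hp hq => simp only [map_add, hp, hq]
  | mul_X p n hp => simp [hp, subst_X]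

lemma Related.map (e : k →+* K) {v v' : Fin 8 → k} (h : Related v v') :
    Related (e ∘ v) (e ∘ v') := by
  obtain ⟨N, u, hN, hu, hf, hg⟩ := h
  have hdet : (N.map e).det = e N.det := (RingHom.map_det e N).symm
  refine ⟨N.map e, e u, ?_, (map_ne_zero e).mpr hu, ?_, ?_⟩
  · rw [hdet]
    exact (map_ne_zero e).mpr hN
  · rw [← map_quadraticOf, hf, map_mul, map_C, map_subst, map_quadraticOf, hdet, map_mul]
  · rw [← map_quarticOf, hg, map_mul, map_C, map_subst, map_quarticOf]

lemma map_transvectant (e : k →+* K) (m n r : ℕ) (F G : MvPolynomial (Fin 2) k) :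
    map e (transvectant m n r F G) = transvectant m n r (map e F) (map e G) := by
  have hit : ∀ (i : Fin 2) (s : ℕ) (p : MvPolynomial (Fin 2) k),
      map e ((⇑(pderiv (R := k) i))^[s] p) = (⇑(pderiv (R := K) i))^[s] (map e p) :=
    fun i s p => (Function.Semiconj.iterate_right
      (f := map e) (fun p => (pderiv_map (φ := e) (f := p) (i := i)).symm) s) p
  simp only [transvectant, map_mul, map_sum, map_pow, map_neg, map_one, map_natCast, map_C, hit,
    map_div₀]

lemma tupleInv_comp (e : k →+* K) (v : Fin 8 → k) : tupleInv (e ∘ v) = (tupleInv v).map e := by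
  have hcc : ∀ p : MvPolynomial (Fin 2) k, constantCoeff (map e p) = e (constantCoeff p) :=
    fun p => constantCoeff_map e p
  simp only [tupleInv, basicInvariants, covT, covH, Invariants.map, ← map_quadraticOf,
    ← map_quarticOf, ← map_pow, ← map_transvectant, hcc]

end BaseChange

/-! ### The conic for `d ≠ 0` -/

section Conic

variable {k : Type*} [Field k]

/-- The line through a point at infinity and a suitable affine point meets the conic in an affine
point. -/
lemma ConicHasPoint.exists_affine [CharZero k] {w : Invariants k} (hd : w.d ≠ 0)
    (h : ConicHasPoint w) :
    ∃ x y z : k, z ≠ 0 ∧ conicC21 w x y z = 0 := by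
  obtain ⟨x, y, z, hne, hC⟩ := h
  by_cases hz : z = 0
  · subst hz
    have hC' : 9 * w.d ^ 3 * x ^ 2 + 8 * w.d ^ 2 * y ^ 2 = 0 := by
      rw [conicC21] at hC
      linear_combination hC
    have hy : y ≠ 0 := by
      rintro rfl
      have : 9 * w.d ^ 3 * x ^ 2 = 0 := by linear_combination hC'
      have hx : x = 0 := by simpa [hd] using this
      exact hne ⟨hx, rfl, rfl⟩
    -- The point `(t x, t y + m, 1)` lies on the conic for a single `t` as soon as the
    -- coefficient `16 d² m y - 24 d a y` of `t` does not vanish, which the choice of `m` ensures.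
    let m := 3 * w.a / (2 * w.d) + 1
    have hm : 16 * w.d ^ 2 * m * y - 24 * w.d * w.a * y = 16 * w.d ^ 2 * y := by
      simp only [m]
      field_simp
      ring
    let t := -(8 * w.d ^ 2 * m ^ 2 - 24 * w.d * w.a * m +
      (-36 * w.d ^ 2 * w.i + 72 * w.a ^ 2)) / (16 * w.d ^ 2 * y)
    have ht : t * (16 * w.d ^ 2 * y) = -(8 * w.d ^ 2 * m ^ 2 - 24 * w.d * w.a * m +
        (-36 * w.d ^ 2 * w.i + 72 * w.a ^ 2)) := by
      have : (16 * w.d ^ 2 * y) ≠ 0 := by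
        refine mul_ne_zero (mul_ne_zero (by norm_num) (pow_ne_zero 2 hd)) hy
      exact div_mul_cancel₀ _ this
    refine ⟨t * x, t * y + m, 1, one_ne_zero, ?_⟩
    rw [conicC21]
    linear_combination t ^ 2 * hC' + t * hm + ht
  · exact ⟨x, y, z, hz, hC⟩

lemma conicC21_scale (w : Invariants k) {β : k} (hβ : β ≠ 0) (x y z : k) :
    conicC21 (w.scale β) x y z = β ^ 6 * conicC21 w x (y / β) z := by
  simp only [conicC21, Invariants.scale]
  field_simp

variable {K : Type*} [Field K] [Algebra k K]

namespace M3

variable {P : M3 K}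

/-- Away from the locus `a = j = 0` the coordinates of a point in the base field are unique up to
scaling by the base field, and so the conic does not depend on their choice. -/
lemma HasCoords.conicHasPoint (hP : P ∈ locusC21 K) (hP' : P ∉ locusD41 K)
    {w w' : Invariants k} (hw : P.HasCoords w) (hd : w.d ≠ 0) (hw' : P.HasCoords w')
    (hC : ConicHasPoint w') : ConicHasPoint w := by
  obtain ⟨v, hv⟩ := P.exists_isModel
  obtain ⟨α₀, hα₀, e⟩ := hv.hasCoords_iff.mp hw
  obtain ⟨α₁, hα₁, e'⟩ := hv.hasCoords_iff.mp hw'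
  set ι := algebraMap k K
  obtain ⟨α, hα, hs⟩ : ∃ α : K, α ≠ 0 ∧ w'.map ι = (w.map ι).scale α := by
    refine ⟨α₁ / α₀, div_ne_zero hα₁ hα₀, ?_⟩
    rw [← e, ← e', Invariants.scale_scale, div_mul_cancel₀ _ hα₀]
  have sd : ι w'.d = α ^ 2 * ι w.d := congrArg Invariants.d hs
  have si : ι w'.i = α ^ 2 * ι w.i := congrArg Invariants.i hs
  have sj : ι w'.j = α ^ 3 * ι w.j := congrArg Invariants.j hs
  have sa : ι w'.a = α ^ 3 * ι w.a := congrArg Invariants.a hs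
  have h2 : α ^ 2 = ι (w'.d / w.d) := by
    rw [map_div₀, sd, mul_div_cancel_right₀ _ ((map_ne_zero ι).mpr hd)]
  have h3 : ∃ β : k, α ^ 3 = ι β := by
    by_cases ha : w.a = 0
    · by_cases hj : w.j = 0
      · refine absurd ?_ hP'
        obtain ⟨F, hF, eF⟩ := hv.exists_inv_eq
        obtain ⟨hc, hct⟩ := hv.inv_of_mem_locusC21 hP
        have ea := congrArg Invariants.a e
        have ej := congrArg Invariants.j e
        simp only [Invariants.scale, Invariants.map, ha, hj, map_zero, mul_eq_zero,
          pow_eq_zero_iff three_ne_zero, hα₀, false_or] at ea ej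
        exact ⟨F, hF, by rw [eF, ea], by rw [eF, ej], by rw [eF, hc], by rw [eF, hct]⟩
      · exact ⟨w'.j / w.j, by rw [map_div₀, sj, mul_div_cancel_right₀ _ ((map_ne_zero ι).mpr hj)]⟩
    · exact ⟨w'.a / w.a, by rw [map_div₀, sa, mul_div_cancel_right₀ _ ((map_ne_zero ι).mpr ha)]⟩
  obtain ⟨β, h3⟩ := h3
  -- Since `α = α³ / α²`, the scaling factor lies in the base field.
  obtain ⟨δ, rfl⟩ : ∃ δ : k, α = ι δ := by
    refine ⟨β / (w'.d / w.d), ?_⟩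
    rw [map_div₀, ← h3, ← h2]
    field_simp
  have hδ : δ ≠ 0 := (map_ne_zero ι).mp hα
  obtain ⟨x, y, z, hne, hC⟩ := hC
  have hconic : conicC21 w' x y z = conicC21 (w.scale δ) x y z := by
    have sd : w'.d = δ ^ 2 * w.d := ι.injective (by rw [sd, map_mul, map_pow])
    have si : w'.i = δ ^ 2 * w.i := ι.injective (by rw [si, map_mul, map_pow])
    have sa : w'.a = δ ^ 3 * w.a := ι.injective (by rw [sa, map_mul, map_pow])
    simp only [conicC21, Invariants.scale, sd, si, sa]
  rw [hconic, conicC21_scale w hδ] at hC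
  refine ⟨x, y / δ, z, ?_, (mul_eq_zero.mp hC).resolve_left (pow_ne_zero 6 hδ)⟩
  rintro ⟨hx, hy, hz⟩
  exact hne ⟨hx, (div_eq_zero_iff.mp hy).resolve_right hδ, hz⟩

variable [CharZero k] [IsAlgClosed K]

/-- For `d ≠ 0` there is a split model on which the invariants take the given values. -/
lemma HasCoords.exists_isSplitForm (hP : P ∈ locusC21 K) {w : Invariants k} (hw : P.HasCoords w)
    (hd : w.d ≠ 0) :
    ∃ v : Fin 8 → K, P.IsModel v ∧ IsSplitForm v ∧ v 1 ^ 2 = -2 * algebraMap k K w.d ∧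
      v 1 ^ 2 * v 5 = 6 * algebraMap k K w.a ∧
      2 * v 3 * v 7 + v 5 ^ 2 / 6 = algebraMap k K w.i := by
  have : CharZero K := charZero_of_injective_algebraMap (algebraMap k K).injective
  obtain ⟨v₀, h₀⟩ := P.exists_isModel
  have hd' : ∀ v : Fin 8 → K, P.IsModel v → 2 * v 0 * v 2 - v 1 ^ 2 / 2 ≠ 0 := by
    intro v h
    obtain ⟨α, hα, e⟩ := h.hasCoords_iff.mp hw
    have e := congrArg Invariants.d e
    simp only [Invariants.scale, Invariants.map, tupleInv, basicInvariants_d] at e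
    refine right_ne_zero_of_mul (a := α ^ 2) ?_
    rw [e]
    exact (map_ne_zero _).mpr hd
  obtain ⟨v₁, hv₁, h10, h11⟩ := exists_related_diagonal v₀ (by
    rintro ⟨h0, h1, -⟩
    apply hd' v₀ h₀
    rw [h0, h1]
    ring)
  have h₁ := h₀.of_related hv₁
  have h12 : v₁ 2 ≠ 0 := by
    intro h12
    apply hd' v₁ h₁
    rw [h11, h12]
    ring
  obtain ⟨t, ht⟩ := IsAlgClosed.exists_pow_nat_eq (-(v₁ 2)⁻¹) (n := 2) (by norm_num)
  have ht' : t ^ 2 * v₁ 2 = -1 := by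
    rw [ht]
    field_simp
  obtain ⟨v₂, hv₂, h20, h21, h22, -⟩ :=
    exists_related_hyperbolic v₁ h10 h11 ht' one_ne_zero
  obtain ⟨α, hα, h₃, e⟩ := (h₁.of_related hv₂).exists_tupleInv_eq hw
  have ht0 : t ≠ 0 := by
    rintro rfl
    simp at ht'
  have hs := h₃.isSplitForm hP (by simp [h20]) (by simp [h21, hα, ht0]) (by simp [h22])
  generalize (fun n => α * v₂ n) = v at h₃ hs e
  refine ⟨v, h₃, hs, ?_⟩
  have ed := congrArg Invariants.d e
  have ea := congrArg Invariants.a e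
  have ei := congrArg Invariants.i e
  simp only [tupleInv, basicInvariants_d, basicInvariants_a, basicInvariants_i, Invariants.map,
    hs.h0, hs.h2, hs.h4] at ed ea ei
  refine ⟨?_, ?_, ?_⟩
  · linear_combination -2 * ed
  · linear_combination 6 * ea
  · linear_combination ei

/-- An affine point of the conic gives a model over the base field: the equation of the conic says
that the split forms of the tuple `modelC21` and of a suitable model of `P` have the same `r²`, `β`
and `α γ`. -/
lemma HasCoords.isModel_modelC21 (hP : P ∈ locusC21 K) {w : Invariants k} (hw : P.HasCoords w)
    (hd : w.d ≠ 0) {x y z : k} (hz : z ≠ 0) (hC : conicC21 w x y z = 0) :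
    P.IsModel (algebraMap k K ∘ modelC21 w x y z) := by
  have : CharZero K := charZero_of_injective_algebraMap (algebraMap k K).injective
  obtain ⟨v, h, hs, ed, ea, ei⟩ := hw.exists_isSplitForm hP hd
  set e := algebraMap k K with he
  let c4 : k := 2 * w.a / w.d ^ 2 - 1 / (3 * w.d) * (y / z)
  have hc4 : 3 * w.d ^ 2 * c4 = 6 * w.a - w.d * (y / z) := by
    simp only [c4]
    field_simp
    ring
  have hC' : 9 * w.d ^ 3 * (x / z) ^ 2 + 8 * w.d ^ 2 * (y / z) ^ 2 - 24 * w.d * w.a * (y / z) +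
      (-36 * w.d ^ 2 * w.i + 72 * w.a ^ 2) = 0 := by
    have : 9 * w.d ^ 3 * (x / z) ^ 2 + 8 * w.d ^ 2 * (y / z) ^ 2 - 24 * w.d * w.a * (y / z) +
        (-36 * w.d ^ 2 * w.i + 72 * w.a ^ 2) = conicC21 w x y z / z ^ 2 := by
      rw [conicC21]
      field_simp
    rw [this, hC, zero_div]
  have hm : modelC21 w x y z = ![1, 0, w.d / 2, c4, x / z, y / z, -(w.d / 2) * (x / z),
      (w.d / 2) ^ 2 * c4] := rfl
  have hc4 := congrArg e hc4
  have hC' := congrArg e hC'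
  simp only [map_mul, map_add, map_sub, map_pow, map_neg, map_ofNat, map_zero] at hc4 hC'
  have hD : e w.d ≠ 0 := (map_ne_zero e).mpr hd
  generalize modelC21 w x y z = m at *
  have m0 : (e ∘ m) 0 = 1 := by simp [hm]
  have m1 : (e ∘ m) 1 = 0 := by simp [hm]
  have m2 : (e ∘ m) 2 = e w.d / 2 := by
    simp [hm, map_ofNat]
  have m3 : (e ∘ m) 3 = e c4 := by simp [hm]
  have m4 : (e ∘ m) 4 = e (x / z) := by simp [hm]
  have m5 : (e ∘ m) 5 = e (y / z) := by simp [hm]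
  have m6 : (e ∘ m) 6 = -(e w.d / 2) * e (x / z) := by
    simp [hm, map_ofNat]
  have m7 : (e ∘ m) 7 = (e w.d / 2) ^ 2 * e c4 := by
    simp [hm, map_ofNat]
  generalize e ∘ m = M at *
  generalize e w.d = D at *
  generalize e w.a = A at *
  generalize e w.i = I at *
  generalize e c4 = C4 at *
  generalize e (x / z) = X at *
  generalize e (y / z) = Y at *
  obtain ⟨t, ht⟩ := IsAlgClosed.exists_pow_nat_eq (-(D / 2)⁻¹) (n := 2) (by norm_num)
  have ht' : t ^ 2 * D = -2 := by
    rw [ht]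
    field_simp
  have ht0 : t ≠ 0 := by
    rintro rfl
    simp at ht'
  -- The scaling factor `-D / 8 = 1 / (4 t²)` preserves the values of the invariants.
  have hu : -D / 8 ≠ 0 := div_ne_zero (neg_ne_zero.mpr hD) (by norm_num)
  obtain ⟨v', hv, e0, e1, e2, e3, e4, e5, e6, e7⟩ :=
    exists_related_hyperbolic M m0 m1 (t := t) (by rw [m2]; linear_combination ht' / 2) hu
  simp only [m3, m4, m5, m6, m7] at e3 e4 e5 e6 e7
  have hv1 : v' 1 ^ 2 = v 1 ^ 2 := by
    rw [e1, ed]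
    linear_combination D * ht'
  have hv5D : D * v 5 = -3 * A := by
    linear_combination v 5 / 2 * ed - ea / 2
  have hv5 : v' 5 = v 5 := by
    refine mul_left_cancel₀ hD ?_
    rw [hv5D, e5]
    linear_combination -hc4 / 2 + (D * Y / 4 - 3 / 16 * D ^ 2 * C4 * (D * t ^ 2 - 2)) * ht'
  have hv37 : v' 3 * v' 7 = v 3 * v 7 := by
    have h3 : v' 3 = -D / 8 * (2 * C4 + 2 * X * t + Y * t ^ 2) := by
      rw [e3]
      linear_combination -D / 8 * (-X * t / 2 + C4 / 4 * (D * t ^ 2 - 2)) * ht'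
    have h7 : v' 7 = -D / 8 * (2 * C4 - 2 * X * t + Y * t ^ 2) := by
      rw [e7]
      linear_combination -D / 8 * (X * t / 2 + C4 / 4 * (D * t ^ 2 - 2)) * ht'
    have h16 : 16 * (v' 3 * v' 7) = (D * C4 - Y) ^ 2 + 2 * D * X ^ 2 := by
      rw [h3, h7]
      linear_combination (D * C4 * Y + Y ^ 2 / 4 * (D * t ^ 2 - 2) - D * X ^ 2) * ht'
    have hD2 : 144 * D ^ 2 ≠ 0 := mul_ne_zero (by norm_num) (pow_ne_zero 2 hD)
    refine mul_left_cancel₀ hD2 ?_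
    linear_combination 9 * D ^ 2 * h16 + (3 * D ^ 2 * C4 - 3 * D * Y + 6 * A - 4 * D * Y) * hc4 +
      2 * hC' - 72 * D ^ 2 * ei + 12 * (D * v 5 - 3 * A) * hv5D
  have hv4 : v' 4 = 0 := by
    rw [e4]
    linear_combination -D / 8 * (X * t - C4 * (D * t ^ 2 - 2)) * ht'
  have hv6 : v' 6 = 0 := by
    rw [e6]
    linear_combination -D / 8 * (-X * t - C4 * (D * t ^ 2 - 2)) * ht'
  have h37 : v' 3 * v' 7 ≠ 0 := by
    rw [hv37]
    exact mul_ne_zero hs.h3 hs.h7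
  have hs' : IsSplitForm v' :=
    ⟨e0, by rw [e1]; simp [hD, ht0], e2, left_ne_zero_of_mul h37, hv4, hv6,
      right_ne_zero_of_mul h37⟩
  exact h.of_related ((hs.related hs' hv1 hv5 hv37).trans hv.symm)

/-- A model over the base field can be diagonalized over the base field, and then gives a point on
the conic attached to its own invariants. -/
lemma HasModelOver.exists_conicHasPoint (hP : P ∈ locusC21 K) {w : Invariants k}
    (hw : P.HasCoords w) (hd : w.d ≠ 0) (h : P.HasModelOver k) :
    ∃ w' : Invariants k, P.HasCoords w' ∧ ConicHasPoint w' := by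
  have : CharZero K := charZero_of_injective_algebraMap (algebraMap k K).injective
  obtain ⟨v₀, h₀⟩ := hasModelOver_iff.mp h
  have hd' : ∀ v : Fin 8 → k, P.IsModel (algebraMap k K ∘ v) →
      2 * v 0 * v 2 - v 1 ^ 2 / 2 ≠ 0 := by
    intro v h hv
    obtain ⟨α, hα, e⟩ := h.hasCoords_iff.mp hw
    have e := congrArg Invariants.d e
    rw [tupleInv_comp] at e
    simp only [Invariants.scale, Invariants.map, tupleInv, basicInvariants_d, hv, map_zero,
      mul_zero] at e
    exact hd ((map_eq_zero _).mp e.symm)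
  obtain ⟨v, hv, h10, h11⟩ := exists_related_diagonal v₀ (by
    rintro ⟨h0, h1, -⟩
    apply hd' v₀ h₀
    rw [h0, h1]
    ring)
  have h₁ := h₀.of_related (hv.map (algebraMap k K))
  have h12 : v 2 ≠ 0 := by
    intro h12
    apply hd' v h₁
    rw [h11, h12]
    ring
  obtain ⟨e6, e7⟩ := h₁.of_diagonal hP (by simp [h10]) (by simp [h11])
    ((map_ne_zero (algebraMap k K)).mpr h12)
  have e6 : v 6 = -v 2 * v 4 := (algebraMap k K).injective (by simpa using e6)
  have e7 : v 7 = v 2 ^ 2 * v 3 := (algebraMap k K).injective (by simpa using e7)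
  refine ⟨tupleInv v, h₁.hasCoords_iff.mpr ⟨1, one_ne_zero, ?_⟩, v 4, v 5, 1, by simp, ?_⟩
  · rw [Invariants.scale_one, tupleInv_comp]
  · simp only [conicC21, tupleInv, basicInvariants_d, basicInvariants_i, basicInvariants_a, h10,
      h11, e6, e7]
    ring

lemma hasModelOver_iff_exists (hP : P ∈ locusC21 K) {w : Invariants k}
    (hw : P.HasCoords w) (hd : w.d ≠ 0) :
    P.HasModelOver k ↔ ∃ w' : Invariants k, P.HasCoords w' ∧ ConicHasPoint w' := by
  refine ⟨fun h => h.exists_conicHasPoint hP hw hd, ?_⟩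
  rintro ⟨w', hw', hC⟩
  have hd' : w'.d ≠ 0 := by
    obtain ⟨v, hv⟩ := P.exists_isModel
    obtain ⟨α, hα, e⟩ := hv.hasCoords_iff.mp hw
    obtain ⟨β, hβ, e'⟩ := hv.hasCoords_iff.mp hw'
    have e := congrArg Invariants.d e
    have e' := congrArg Invariants.d e'
    simp only [Invariants.scale, Invariants.map] at e e'
    rw [← map_ne_zero (algebraMap k K), ← e] at hd
    rw [← map_ne_zero (algebraMap k K), ← e']
    exact mul_ne_zero (pow_ne_zero 2 hβ) (right_ne_zero_of_mul hd)
  obtain ⟨x, y, z, hz, hC⟩ := hC.exists_affine hd'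
  exact hasModelOver_iff.mpr ⟨_, hw'.isModel_modelC21 hP hd' hz hC⟩

/-- On the locus `a = j = 0` the coordinates may be rescaled by the square root of any nonzero
element of the base field; rescaling by a square root of `2 i` gives a conic with a point. -/
lemma hasModelOver_of_mem_locusD41 (hP : P ∈ locusC21 K) (hP' : P ∈ locusD41 K)
    {w : Invariants k} (hw : P.HasCoords w) (hd : w.d ≠ 0) : P.HasModelOver k := by
  have : CharZero K := charZero_of_injective_algebraMap (algebraMap k K).injective
  obtain ⟨v, hv, hs, ed, ea, ei⟩ := hw.exists_isSplitForm hP hd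
  obtain ⟨α, hα, e⟩ := hv.hasCoords_iff.mp hw
  obtain ⟨F, hF, hFa, hFj, hFc, -⟩ := hP'
  obtain ⟨β, hβ, e'⟩ := hv.inv_eq_scale hF
  have hva : (tupleInv v).a = 0 := by simpa [e', Invariants.scale, hβ] using hFa
  have hvj : (tupleInv v).j = 0 := by simpa [e', Invariants.scale, hβ] using hFj
  have hvc : (tupleInv v).c = 0 := by simpa [e', Invariants.scale, hβ] using hFc
  have hwa : w.a = 0 := by
    have := congrArg Invariants.a e
    simpa [Invariants.scale, Invariants.map, hva] using this.symm
  have hi : w.i ≠ 0 := by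
    intro hi
    rw [hwa, map_zero, mul_zero, mul_eq_zero] at ea
    have h5 : v 5 = 0 := ea.resolve_left (pow_ne_zero 2 hs.h1)
    rw [h5, hi, map_zero] at ei
    have : v 3 * v 7 = 0 := by linear_combination ei / 2
    exact mul_ne_zero hs.h3 hs.h7 this
  obtain ⟨δ, hδ⟩ := IsAlgClosed.exists_pow_nat_eq (algebraMap k K (2 * w.i)) (n := 2) (by norm_num)
  have hδ0 : δ ≠ 0 := by
    rintro rfl
    rw [zero_pow two_ne_zero, eq_comm, map_eq_zero] at hδ
    simp [hi] at hδ
  let w' : Invariants k := ⟨2 * w.i * w.d, 2 * w.i * w.i, 0, 0, (2 * w.i) ^ 2 * w.b, 0⟩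
  have hw' : P.HasCoords w' := by
    refine hv.hasCoords_iff.mpr ⟨δ * α, mul_ne_zero hδ0 hα, ?_⟩
    have e4 : δ ^ 4 = algebraMap k K ((2 * w.i) ^ 2) := by
      rw [map_pow, ← hδ]
      ring
    have ed := congrArg Invariants.d e
    have ei := congrArg Invariants.i e
    have eb := congrArg Invariants.b e
    simp only [Invariants.scale, Invariants.map] at ed ei eb
    rw [← Invariants.scale_scale]
    simp only [w', Invariants.scale, Invariants.map, ed, ei, eb, hva, hvj, hvc, hδ, e4, map_mul,
      map_zero, mul_zero]
  have hd' : w'.d ≠ 0 := mul_ne_zero (mul_ne_zero two_ne_zero hi) hd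
  -- For `a = 0` the conic has the point `(0, y, 1)` as soon as `2 y² = 9 i`, and here `i` has
  -- become `2 i²`.
  have hC : conicC21 w' 0 (3 * w.i) 1 = 0 := by
    simp only [conicC21, w']
    ring
  exact (hasModelOver_iff_exists hP hw' hd').mpr
    ⟨w', hw', 0, 3 * w.i, 1, by simp, hC⟩

end M3

end Conic

/-! ### Normal forms with `f = 0` -/

section ZeroDivergence

variable {K : Type*} [Field K]

/-- The 8-tuple of the forms `f = 0` and `g = X₀ (X₁³ + p X₀² X₁ + q X₀³)`. -/
def cubicTuple (p q : K) : Fin 8 → K := ![0, 0, 0, q, p, 0, 1, 0]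

lemma related_cubicTuple (p q : K) {t : K} (ht : t ≠ 0) :
    Related (cubicTuple p q) (cubicTuple (t ^ 2 * p) (t ^ 3 * q)) := by
  refine related_of_eq t 0 0 1 t⁻¹ (by simpa using ht) (inv_ne_zero ht) ?_ ?_ ?_ ?_ ?_ ?_ ?_ ?_ <;>
    simp [cubicTuple] <;> field_simp

lemma tupleInv_cubicTuple [CharZero K] (p q : K) :
    (tupleInv (cubicTuple p q)).i = -p / 2 ∧ (tupleInv (cubicTuple p q)).j = -3 / 8 * q := by
  rw [tupleInv, basicInvariants_i, basicInvariants_j]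
  constructor <;> simp [cubicTuple] <;> ring

/-- A quartic form without double roots can be brought to the shape
`X₀ (X₁³ + p X₀² X₁ + q X₀³)`, by moving a root to infinity and completing the cube. -/
lemma exists_related_cubicTuple [CharZero K] [IsAlgClosed K] (v : Fin 8 → K) (h0 : v 0 = 0)
    (h1 : v 1 = 0) (h2 : v 2 = 0) (hv : ∀ v', Related v v' → v' 7 = 0 → v' 6 ≠ 0) :
    ∃ p q, Related v (cubicTuple p q) := by
  obtain ⟨v', hv', h0', h1', h2', h7'⟩ : ∃ v', Related v v' ∧ v' 0 = 0 ∧ v' 1 = 0 ∧ v' 2 = 0 ∧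
      v' 7 = 0 := by
    by_cases h3 : v 3 = 0
    · obtain ⟨v', h, e0, e1, e2, -, -, -, -, e7⟩ := exists_related v 0 1 1 0 1 (by simp) one_ne_zero
      exact ⟨v', h, by simp [e0, h2], by simp [e1, h1], by simp [e2, h0], by simp [e7, h3]⟩
    · let Q : Polynomial K := .C (v 3) * .X ^ 4 + .C (v 4) * .X ^ 3 + .C (v 5) * .X ^ 2 +
        .C (v 6) * .X + .C (v 7)
      have hQ : Q.degree ≠ 0 := by
        have : Q.degree = 4 := by
          simp only [Q]
          compute_degree!
        rw [this]
        norm_num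
      obtain ⟨t, ht⟩ := IsAlgClosed.exists_root Q hQ
      have ht' : v 3 * t ^ 4 + v 4 * t ^ 3 + v 5 * t ^ 2 + v 6 * t + v 7 = 0 := by
        simpa [Q, Polynomial.IsRoot] using ht
      obtain ⟨v', h, e0, e1, e2, -, -, -, -, e7⟩ := exists_related v 1 t 0 1 1 (by simp) one_ne_zero
      refine ⟨v', h, by simp [e0, h0], by simp [e1, h0, h1], by simp [e2, h0, h1, h2], ?_⟩
      rw [e7]
      linear_combination ht'
  have h6' := hv v' hv' h7'
  -- `X₁ ↦ X₁ - v' 5 / (3 v' 6) X₀` completes the cube.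
  obtain ⟨v'', hv'', e0, e1, e2, -, -, e5, e6, e7⟩ :=
    exists_related v' 1 0 (-v' 5 / (3 * v' 6)) 1 (1 / v' 6) (by simp) (one_div_ne_zero h6')
  have hc : v'' = cubicTuple (v'' 4) (v'' 3) := by
    funext n
    fin_cases n
    · change v'' 0 = 0
      simp [e0, h0', h1', h2']
    · change v'' 1 = 0
      simp [e1, h0', h1', h2']
    · change v'' 2 = 0
      simp [e2, h0', h1', h2']
    · rfl
    · rfl
    · change v'' 5 = 0
      rw [e5, h7']
      field_simp
      ring
    · change v'' 6 = 1
      rw [e6, h7']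
      field_simp
      ring
    · change v'' 7 = 0
      simp [e7, h7']
  exact ⟨_, _, hc ▸ hv'.trans hv''⟩

/-- The condition says that `g` has no double roots: the discriminant of a quartic form is a
multiple of `i³ - 6 j²`. -/
lemma exists_related_cubicTuple_of_discr [CharZero K] [IsAlgClosed K] (v : Fin 8 → K)
    (h0 : v 0 = 0) (h1 : v 1 = 0) (h2 : v 2 = 0)
    (hv : (tupleInv v).i ^ 3 ≠ 6 * (tupleInv v).j ^ 2) : ∃ p q, Related v (cubicTuple p q) := by
  refine exists_related_cubicTuple v h0 h1 h2 fun v' h h7 h6 => hv ?_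
  obtain ⟨α, hα, e⟩ := h.tupleInv_eq
  have ei : (tupleInv v').i = α ^ 2 * (tupleInv v).i := congrArg Invariants.i e
  have ej : (tupleInv v').j = α ^ 3 * (tupleInv v).j := congrArg Invariants.j e
  have key : (tupleInv v').i ^ 3 = 6 * (tupleInv v').j ^ 2 := by
    rw [tupleInv, basicInvariants_i, basicInvariants_j, h6, h7]
    ring
  rw [ei, ej] at key
  refine mul_left_cancel₀ (pow_ne_zero 6 hα) ?_
  linear_combination key

namespace M3

variable [CharZero K] {P : M3 K} {v : Fin 8 → K}

/-- On the locus `c = c̃ = 0` the divergence vanishes as soon as its discriminant does: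
if `f = X₀²`, then `a = c = 0` forces `X₀²` to divide `g`. -/
lemma IsModel.divergence_eq_zero (h : P.IsModel v) (hP : P ∈ locusC21 K)
    (hd : (tupleInv v).d = 0) : v 0 = 0 ∧ v 1 = 0 ∧ v 2 = 0 := by
  by_contra hne
  obtain ⟨v', hv, h0, h1⟩ := exists_related_diagonal v hne
  obtain ⟨α, hα, e⟩ := hv.tupleInv_eq
  have h' := h.of_related hv
  have hd' : (tupleInv v').d = 0 := by rw [e, Invariants.scale, hd, mul_zero]
  have h2 : v' 2 = 0 := by
    rw [tupleInv, basicInvariants_d, h0, h1] at hd'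
    linear_combination hd' / 2
  obtain ⟨hc, hct⟩ := h'.inv_of_mem_locusC21 hP
  have ha : (tupleInv v').a = 0 := by
    rw [Invariants.ctilde, hd'] at hct
    have : (tupleInv v').a ^ 2 = 0 := by linear_combination -2 * hct
    exact pow_eq_zero_iff two_ne_zero |>.mp this
  have h7 : v' 7 = 0 := by
    rw [tupleInv, basicInvariants_a, h0, h1, h2] at ha
    linear_combination ha
  have h6 : v' 6 = 0 := by
    rw [tupleInv, basicInvariants_c_of_square v' h1 h2 h7, h0] at hc
    have : v' 6 ^ 3 = 0 := by linear_combination -32 * hc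
    exact pow_eq_zero_iff three_ne_zero |>.mp this
  exact h'.nondegenerate_left h2 h6 h7

lemma IsModel.inv_of_divergence_eq_zero (h : P.IsModel v) (hv : v 0 = 0 ∧ v 1 = 0 ∧ v 2 = 0) :
    ∃ F : CubicPair K, of F = P ∧ F.inv.d = 0 ∧ F.inv.a = 0 ∧ F.inv.b = 0 ∧ F.inv.c = 0 ∧
      F.inv.i = (tupleInv v).i ∧ F.inv.j = (tupleInv v).j := by
  obtain ⟨h0, h1, h2⟩ := hv
  obtain ⟨F, hF, e⟩ := h.exists_inv_eq
  refine ⟨F, hF, ?_, ?_, ?_, ?_, by rw [e], by rw [e]⟩ <;> rw [e, tupleInv]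
  · simp [basicInvariants_d, h0, h1]
  · simp [basicInvariants_a, h0, h1, h2]
  · simp [basicInvariants_b v h0 h2, h1]
  · simp [basicInvariants_c_of_hyperbolic v h0 h2, h1]

/-- For `p = q = 0` the cubic forms would have the common factor `X₁`. -/
lemma IsModel.cubicTuple_ne_zero {p q : K} (h : P.IsModel (cubicTuple p q)) : p ≠ 0 ∨ q ≠ 0 := by
  by_contra! hpq
  obtain ⟨rfl, rfl⟩ := hpq
  exact h.nondegenerate_right rfl rfl rfl

variable [IsAlgClosed K]

/-- For `d = 0` the point is determined by the coordinates `i` and `j`. -/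
lemma HasCoords.isModel_cubicTuple {k : Type*} [Field k] [Algebra k K] (hP : P ∈ locusC21 K)
    {w : Invariants k} (hw : P.HasCoords w) (hd : w.d = 0) :
    P.IsModel (cubicTuple (-2 * algebraMap k K w.i) (-8 / 3 * algebraMap k K w.j)) := by
  obtain ⟨v, h⟩ := P.exists_isModel
  obtain ⟨α, hα, e⟩ := h.hasCoords_iff.mp hw
  have ed := congrArg Invariants.d e
  have hd' : (tupleInv v).d = 0 := by
    simpa [Invariants.scale, Invariants.map, hd, hα] using ed
  obtain ⟨h0, h1, h2⟩ := h.divergence_eq_zero hP hd'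
  obtain ⟨p, q, hpq⟩ := exists_related_cubicTuple v h0 h1 h2 fun v' hv' h7 h6 => by
    have h' := h.of_related hv'
    have hd'' : (tupleInv v').d = 0 := by
      obtain ⟨β, -, e⟩ := hv'.tupleInv_eq
      rw [e, Invariants.scale, hd', mul_zero]
    exact h'.nondegenerate_left (h'.divergence_eq_zero hP hd'').2.2 h6 h7
  have h' := h.of_related hpq
  obtain ⟨β, hβ, e'⟩ := h'.hasCoords_iff.mp hw
  have ei := congrArg Invariants.i e'
  have ej := congrArg Invariants.j e'
  simp only [Invariants.scale, Invariants.map, (tupleInv_cubicTuple p q).1,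
    (tupleInv_cubicTuple p q).2] at ei ej
  convert h'.of_related (related_cubicTuple p q hβ) using 2
  · rw [← ei]
    ring
  · rw [← ej]
    ring

lemma HasCoords.exists_inv {k : Type*} [Field k] [Algebra k K] (hP : P ∈ locusC21 K)
    {w : Invariants k} (hw : P.HasCoords w) (hd : w.d = 0) :
    ∃ F : CubicPair K, of F = P ∧ F.inv.d = 0 ∧ F.inv.a = 0 ∧ F.inv.b = 0 ∧ F.inv.c = 0 ∧
      F.inv.i = algebraMap k K w.i ∧ F.inv.j = algebraMap k K w.j := by
  obtain ⟨F, hF, h1, h2, h3, h4, h5, h6⟩ :=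
    (hw.isModel_cubicTuple hP hd).inv_of_divergence_eq_zero ⟨rfl, rfl, rfl⟩
  refine ⟨F, hF, h1, h2, h3, h4, ?_, ?_⟩
  · rw [h5, (tupleInv_cubicTuple _ _).1]
    ring
  · rw [h6, (tupleInv_cubicTuple _ _).2]
    ring

/-- If `d = i = 0`, every separable quartic form with `i = 0` gives a model. -/
lemma IsModel.of_i_eq_zero {q : K} (h : P.IsModel (cubicTuple 0 q)) (hv0 : v 0 = 0)
    (hv1 : v 1 = 0) (hv2 : v 2 = 0) (hi : (tupleInv v).i = 0) (hj : (tupleInv v).j ≠ 0) :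
    P.IsModel v := by
  obtain ⟨p', q', hv⟩ := exists_related_cubicTuple_of_discr v hv0 hv1 hv2 (by
    rw [hi, zero_pow three_ne_zero]
    exact (mul_ne_zero (by norm_num) (pow_ne_zero 2 hj)).symm)
  obtain ⟨α, hα, e⟩ := hv.tupleInv_eq
  have ei := congrArg Invariants.i e
  have ej := congrArg Invariants.j e
  simp only [Invariants.scale, (tupleInv_cubicTuple p' q').1, (tupleInv_cubicTuple p' q').2, hi,
    mul_zero] at ei ej
  have hp' : p' = 0 := by linear_combination -2 * ei
  have hq' : q' ≠ 0 := by
    rintro rfl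
    rw [mul_zero, eq_comm] at ej
    exact mul_ne_zero (pow_ne_zero 3 hα) hj ej
  have hq : q ≠ 0 := h.cubicTuple_ne_zero.resolve_left (by simp)
  obtain ⟨t, ht⟩ := IsAlgClosed.exists_pow_nat_eq (q' / q) (n := 3) (by norm_num)
  have ht0 : t ≠ 0 := by
    rintro rfl
    rw [zero_pow three_ne_zero, eq_comm, div_eq_zero_iff] at ht
    exact ht.elim hq' hq
  have h' := h.of_related (related_cubicTuple 0 q ht0)
  rw [mul_zero, ht, div_mul_cancel₀ _ hq, ← hp'] at h'
  exact h'.of_related hv.symm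

/-- If `d = j = 0`, every separable quartic form with `j = 0` gives a model. -/
lemma IsModel.of_j_eq_zero {p : K} (h : P.IsModel (cubicTuple p 0)) (hv0 : v 0 = 0)
    (hv1 : v 1 = 0) (hv2 : v 2 = 0) (hi : (tupleInv v).i ≠ 0) (hj : (tupleInv v).j = 0) :
    P.IsModel v := by
  obtain ⟨p', q', hv⟩ := exists_related_cubicTuple_of_discr v hv0 hv1 hv2 (by
    rw [hj, zero_pow two_ne_zero, mul_zero]
    exact pow_ne_zero 3 hi)
  obtain ⟨α, hα, e⟩ := hv.tupleInv_eq
  have ei := congrArg Invariants.i e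
  have ej := congrArg Invariants.j e
  simp only [Invariants.scale, (tupleInv_cubicTuple p' q').1, (tupleInv_cubicTuple p' q').2, hj,
    mul_zero] at ei ej
  have hq' : q' = 0 := by linear_combination -8 / 3 * ej
  have hp' : p' ≠ 0 := by
    rintro rfl
    rw [neg_zero, zero_div, eq_comm] at ei
    exact mul_ne_zero (pow_ne_zero 2 hα) hi ei
  have hp : p ≠ 0 := h.cubicTuple_ne_zero.resolve_right (by simp)
  obtain ⟨t, ht⟩ := IsAlgClosed.exists_pow_nat_eq (p' / p) (n := 2) (by norm_num)
  have ht0 : t ≠ 0 := by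
    rintro rfl
    rw [zero_pow two_ne_zero, eq_comm, div_eq_zero_iff] at ht
    exact ht.elim hp' hp
  have h' := h.of_related (related_cubicTuple p 0 ht0)
  rw [mul_zero, ht, div_mul_cancel₀ _ hp, ← hq'] at h'
  exact h'.of_related hv.symm

end M3

end ZeroDivergence

/-! ### The loci with `d = 0` -/

namespace M3

variable {k : Type*} [Field k] [CharZero k] {K : Type*} [Field K] [Algebra k K] [IsAlgClosed K]
  {P : M3 K} {w : Invariants k}

lemma HasCoords.mem_locusD42 (hP : P ∈ locusC21 K) (hw : P.HasCoords w) (hd : w.d = 0) :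
    P ∈ locusD42 K := by
  have : CharZero K := charZero_of_injective_algebraMap (algebraMap k K).injective
  obtain ⟨F, hF, h1, h2, h3, h4, -⟩ := hw.exists_inv hP hd
  exact ⟨F, hF, h1, h2, h3, h4⟩

lemma HasCoords.mem_locusD8 (hP : P ∈ locusC21 K) (hw : P.HasCoords w) (hd : w.d = 0)
    (hj : w.j = 0) : P ∈ locusD8 K := by
  have : CharZero K := charZero_of_injective_algebraMap (algebraMap k K).injective
  obtain ⟨F, hF, h1, h2, h3, h4, -, h6⟩ := hw.exists_inv hP hd
  exact ⟨F, hF, h1, by rw [h6, hj, map_zero], h2, h3, h4⟩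

lemma HasCoords.mem_locusA4 (hP : P ∈ locusC21 K) (hw : P.HasCoords w) (hd : w.d = 0)
    (hi : w.i = 0) : P ∈ locusA4 K := by
  have : CharZero K := charZero_of_injective_algebraMap (algebraMap k K).injective
  obtain ⟨F, hF, h1, h2, h3, h4, h5, -⟩ := hw.exists_inv hP hd
  exact ⟨F, hF, h4, h3, h2, by rw [h5, hi, map_zero], h1⟩

lemma HasCoords.isModel_locusD42 (hP : P ∈ locusC21 K) (hw : P.HasCoords w) (hd : w.d = 0)
    (hi : w.i ≠ 0) (hj : w.j ≠ 0) :
    P.IsModel (algebraMap k K ∘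
      ![0, 0, 0, -27 * w.i ^ 3, -27 * w.i ^ 3, 0, 24 * w.j ^ 2, 0]) := by
  have : CharZero K := charZero_of_injective_algebraMap (algebraMap k K).injective
  have hI : algebraMap k K w.i ≠ 0 := (map_ne_zero _).mpr hi
  have hJ : algebraMap k K w.j ≠ 0 := (map_ne_zero _).mpr hj
  refine (hw.isModel_cubicTuple hP hd).of_related (related_of_eq
    (3 * algebraMap k K w.i / (4 * algebraMap k K w.j)) 0 0 1
    (32 * algebraMap k K w.j ^ 3 / algebraMap k K w.i) ?_ ?_ ?_ ?_ ?_ ?_ ?_ ?_ ?_ ?_)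
  · simp [hI, hJ]
  · simp [hI, hJ]
  all_goals simp [cubicTuple, map_ofNat]
  all_goals field_simp
  all_goals norm_num

lemma HasCoords.isModel_locusD8 (hP : P ∈ locusC21 K) (hw : P.HasCoords w) (hd : w.d = 0)
    (hj : w.j = 0) : P.IsModel (algebraMap k K ∘ ![0, 0, 0, 1, 0, 0, 0, 1]) := by
  have : CharZero K := charZero_of_injective_algebraMap (algebraMap k K).injective
  have h := hw.isModel_cubicTuple hP hd
  rw [hj, map_zero, mul_zero] at h
  refine h.of_j_eq_zero ?_ ?_ ?_ ?_ ?_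
  all_goals simp [tupleInv, basicInvariants_i, basicInvariants_j]

end M3

/-! ### Galois conjugates of rational maps -/

section GaloisAction

namespace CubicPair

variable {k K : Type*} [Field k] [Field K] [Algebra k K]

lemma divergence_gal (σ : K ≃ₐ[k] K) (F : CubicPair K) :
    (F.gal σ).divergence = MvPolynomial.map (σ : K →+* K) F.divergence := by
  simp only [divergence, gal, map_add, pderiv_map]

lemma fixedPoint_gal (σ : K ≃ₐ[k] K) (F : CubicPair K) :
    (F.gal σ).fixedPoint = MvPolynomial.map (σ : K →+* K) F.fixedPoint := by
  simp only [fixedPoint, gal, map_sub, map_mul, map_X]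

lemma gal_smul (σ : K ≃ₐ[k] K) (M : GL (Fin 2) K) (F : CubicPair K) :
    (M • F).gal σ = Matrix.GeneralLinearGroup.map (σ : K →+* K) M • F.gal σ := by
  have h : ((Matrix.GeneralLinearGroup.map (σ : K →+* K) M)⁻¹ : GL (Fin 2) K).val =
      (M⁻¹ : GL (Fin 2) K).val.map (σ : K →+* K) := by
    rw [← map_inv]
    rfl
  ext1
  funext i
  rw [smul_F, h]
  change MvPolynomial.map (σ : K →+* K) ((M • F).F i) = _
  rw [smul_F, map_sum]
  refine Finset.sum_congr rfl fun j _ => ?_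
  rw [map_mul, map_C, map_subst]
  rfl

lemma gal_mul (σ τ : K ≃ₐ[k] K) (F : CubicPair K) : F.gal (σ * τ) = (F.gal τ).gal σ := by
  ext1
  funext i
  exact (MvPolynomial.map_map (τ : K →+* K) (σ : K →+* K) (F.F i)).symm

lemma gal_one (F : CubicPair K) : F.gal (1 : K ≃ₐ[k] K) = F := by
  ext1
  funext i
  exact MvPolynomial.map_id (F.F i)

end CubicPair

namespace Rat3

variable {k : Type*} [Field k]

lemma gal_mul (σ τ : GalGrp k) (φ : Rat3 (AlgebraicClosure k)) :
    φ.gal (σ * τ) = (φ.gal τ).gal σ := by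
  induction φ using Quotient.inductionOn with
  | h F => exact congrArg mk (F.gal_mul σ τ)

lemma gal_one (φ : Rat3 (AlgebraicClosure k)) : φ.gal (1 : GalGrp k) = φ := by
  induction φ using Quotient.inductionOn with
  | h F => exact congrArg mk F.gal_one

lemma gal_smul (σ : GalGrp k) (γ : PGL(2, AlgebraicClosure k)) (φ : Rat3 (AlgebraicClosure k)) :
    (γ • φ).gal σ = galPGL k σ γ • φ.gal σ := by
  induction φ using Quotient.inductionOn with
  | h F =>
    induction γ using Matrix.ProjGenLinGroup.induction_on with
    | mk M => exact congrArg mk (F.gal_smul σ M)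

lemma mem_aut_gal_iff (σ : GalGrp k) (γ : PGL(2, AlgebraicClosure k))
    (φ : Rat3 (AlgebraicClosure k)) : galPGL k σ γ ∈ (φ.gal σ).Aut ↔ γ ∈ φ.Aut := by
  rw [Aut, Aut, MulAction.mem_stabilizer_iff, MulAction.mem_stabilizer_iff, ← gal_smul]
  refine ⟨fun h => ?_, fun h => by rw [h]⟩
  have h' := congrArg (Rat3.gal σ⁻¹) h
  rwa [← gal_mul, ← gal_mul, inv_mul_cancel, gal_one, gal_one] at h'

/-- If the automorphism group of `φ` is Galois-stable, every conjugation carrying `φ` to a Galois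
conjugate normalises it. -/
lemma mem_nor_of_gal_eq {φ : Rat3 (AlgebraicClosure k)} (hA : IsGalStable φ.Aut) (σ : GalGrp k)
    {γ : PGL(2, AlgebraicClosure k)} (h : φ.gal σ = γ⁻¹ • φ) : γ ∈ nor φ.Aut := by
  -- `x ∈ Aut φ` iff `x ∈ Aut (σ φ)`, by stability of `Aut φ`, and `Aut (σ φ) = γ⁻¹ (Aut φ) γ`.
  have key : ∀ x, x ∈ φ.Aut ↔ γ * x * γ⁻¹ ∈ φ.Aut := by
    intro x
    have hx := galPGL_inv_apply σ x
    rw [← hx, galPGL_mem_iff hA, ← mem_aut_gal_iff σ, hx, h, Aut, Aut,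
      MulAction.mem_stabilizer_iff, MulAction.mem_stabilizer_iff, mul_smul, mul_smul,
      eq_inv_smul_iff]
  exact Subgroup.mem_normalizer_iff.mpr key

end Rat3

end GaloisAction

section DivergenceFree

variable {K : Type*} [Field K] [CharZero K]

lemma Rat3.mk_eq_mk_iff {F G : CubicPair K} (hF : F.divergence = 0) (hG : G.divergence = 0) :
    Rat3.mk F = Rat3.mk G ↔ ∃ u : K, u ≠ 0 ∧ G.fixedPoint = C u * F.fixedPoint := by
  constructor
  · intro h
    obtain ⟨u, hu⟩ := Quotient.exact h
    exact ⟨u, u.ne_zero, CubicPair.fixedPoint_of_proportional hu⟩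
  · rintro ⟨u, hu, h⟩
    refine Quotient.sound ⟨Units.mk0 u hu, fun i => ?_⟩
    exact CubicPair.proportional_of_forms (by rw [hF, hG, mul_zero]) h i

lemma Rat3.mk_smul_eq_mk_iff {F G : CubicPair K} (hF : F.divergence = 0) (hG : G.divergence = 0)
    (M : GL (Fin 2) K) :
    (Matrix.ProjGenLinGroup.mk M)⁻¹ • Rat3.mk F = Rat3.mk G ↔
      ∃ u : K, u ≠ 0 ∧ G.fixedPoint = C u * subst M.val F.fixedPoint := by
  have e : (Matrix.ProjGenLinGroup.mk M)⁻¹ • Rat3.mk F = Rat3.mk (M⁻¹ • F) := rfl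
  have hd : (M⁻¹ : GL (Fin 2) K).val.det ≠ 0 :=
    (M⁻¹).det.ne_zero
  rw [e, mk_eq_mk_iff (by rw [CubicPair.divergence_smul, hF, map_zero]) hG,
    CubicPair.fixedPoint_smul, inv_inv]
  constructor
  · rintro ⟨u, hu, h⟩
    exact ⟨u * _, mul_ne_zero hu hd, by rw [h, C_mul, mul_assoc]⟩
  · rintro ⟨u, hu, h⟩
    refine ⟨u * ((M⁻¹ : GL (Fin 2) K).val.det)⁻¹, mul_ne_zero hu (inv_ne_zero hd), ?_⟩
    rw [h, ← mul_assoc, ← C_mul, inv_mul_cancel_right₀ hd]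

/-- The automorphisms of a map without divergence are the linear substitutions which preserve its
fixed point form up to a factor. -/
lemma Rat3.mem_aut_mk_iff {F : CubicPair K} (hF : F.divergence = 0) (M : GL (Fin 2) K) :
    Matrix.ProjGenLinGroup.mk M ∈ (Rat3.mk F).Aut ↔
      ∃ u : K, u ≠ 0 ∧ F.fixedPoint = C u * subst M.val F.fixedPoint := by
  rw [← mk_smul_eq_mk_iff hF hF, ← inv_mem_iff]
  rfl

end DivergenceFree

/-! ### The tetrahedral quartics -/

section Tetrahedral

variable {K : Type*} [Field K]

lemma quarticOf_tetrahedral [CharZero K] (s : K) :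
    quarticOf ![0, 0, 0, 1, 0, 2 * s, 0, 1] = binQuartic 1 0 (s / 3) 0 1 := by
  rw [quarticOf_eq_binQuartic]
  simp only [Matrix.cons_val]
  congr 1 <;> ring

lemma binQuartic_C_mul (c a0 a1 a2 a3 a4 : K) :
    binQuartic (c * a0) (c * a1) (c * a2) (c * a3) (c * a4) = C c * binQuartic a0 a1 a2 a3 a4 := by
  simp only [binQuartic, C_mul]
  ring

variable [CharZero K]

lemma ne_zero_of_sq_eq_neg_three {s : K} (hs : s ^ 2 = -3) : s ≠ 0 := by
  rintro rfl
  norm_num at hs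

/-- The Hessians of the two tetrahedral quartics exchange them. -/
lemma covH_tetrahedral {s : K} (hs : s ^ 2 = -3) :
    covH (binQuartic 1 0 (s / 3) 0 1) = C (2 * s / 3) * binQuartic 1 0 (-s / 3) 0 1 := by
  rw [covH_binQuartic, ← binQuartic_C_mul]
  congr 1
  · ring
  · ring
  · linear_combination hs / 9
  · ring
  · ring

/-- A linear symmetry up to a factor of a tetrahedral quartic is also one of its Hessian. -/
lemma subst_tetrahedral {s : K} (hs : s ^ 2 = -3) {N : Matrix (Fin 2) (Fin 2) K} (hN : N.det ≠ 0)
    {u : K} (hu : u ≠ 0)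
    (h : binQuartic 1 0 (s / 3) 0 1 = C u * subst N (binQuartic 1 0 (s / 3) 0 1)) :
    ∃ v : K, v ≠ 0 ∧
      binQuartic 1 0 (-s / 3) 0 1 = C v * subst N (binQuartic 1 0 (-s / 3) 0 1) := by
  have hs0 := ne_zero_of_sq_eq_neg_three hs
  refine ⟨u ^ 2 * N.det ^ 2, mul_ne_zero (pow_ne_zero 2 hu) (pow_ne_zero 2 hN), ?_⟩
  have h' := congrArg covH h
  rw [covH_transform, covH_tetrahedral hs, map_mul (subst N), subst_C] at h'
  refine mul_left_cancel₀ (a := C (2 * s / 3)) ?_ ?_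
  · rw [Ne, C_eq_zero]
    exact div_ne_zero (mul_ne_zero two_ne_zero hs0) three_ne_zero
  · rw [h']
    ring

end Tetrahedral

/-! ### Continuity of the Galois action -/

section Continuity

variable {k : Type*} [Field k]

/-- Stabilizers in the Krull topology are open. -/
lemma isLocallyConstant_apply (x : AlgebraicClosure k) :
    IsLocallyConstant fun σ : GalGrp k => σ x := by
  rw [IsLocallyConstant.iff_eventually_eq]
  intro σ
  have ho := stabilizer_isOpen_of_isIntegral (K := k) x
  have hc : Continuous fun τ : GalGrp k => σ⁻¹ * τ := continuous_const_mul _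
  filter_upwards [(ho.preimage hc).mem_nhds (by simp)] with τ hτ
  have h : σ⁻¹ (τ x) = x := hτ
  have h' := congrArg σ h
  rwa [← AlgEquiv.mul_apply, mul_inv_cancel] at h'

lemma isLocallyConstant_galPGL (γ : PGL(2, AlgebraicClosure k)) :
    IsLocallyConstant fun σ : GalGrp k => galPGL k σ γ := by
  induction γ using Matrix.ProjGenLinGroup.induction_on with
  | mk M =>
    rw [IsLocallyConstant.iff_eventually_eq]
    intro σ
    have h : ∀ i j, ∀ᶠ τ in nhds σ, (τ : GalGrp k) (M.val i j) = σ (M.val i j) := fun i j =>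
      (isLocallyConstant_apply (k := k) (M.val i j)).eventually_eq σ
    filter_upwards [Filter.eventually_all.mpr fun i => Filter.eventually_all.mpr (h i)] with τ hτ
    change Matrix.ProjGenLinGroup.mk _ = Matrix.ProjGenLinGroup.mk _
    congr 1
    exact Units.ext (Matrix.ext hτ)

end Continuity

/-! ### Stability of the tetrahedral group -/

section Descent

variable {k : Type*} [Field k]

lemma gal_sqrt {s : AlgebraicClosure k} (hs : s ^ 2 = -3) (σ : GalGrp k) :
    σ s = s ∨ σ s = -s := by
  rw [← sq_eq_sq_iff_eq_or_eq_neg, ← map_pow, hs, map_neg, map_ofNat]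

lemma map_binQuartic (σ : GalGrp k) (a0 a1 a2 a3 a4 : AlgebraicClosure k) :
    MvPolynomial.map (σ : AlgebraicClosure k →+* AlgebraicClosure k) (binQuartic a0 a1 a2 a3 a4) =
      binQuartic (σ a0) (σ a1) (σ a2) (σ a3) (σ a4) := by
  simp [binQuartic, map_ofNat]

lemma map_binQuartic_tetrahedral (σ : GalGrp k) (s : AlgebraicClosure k) :
    MvPolynomial.map (σ : AlgebraicClosure k →+* AlgebraicClosure k)
      (binQuartic 1 0 (s / 3) 0 1) = binQuartic 1 0 (σ s / 3) 0 1 := by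
  rw [map_binQuartic, map_one, map_zero, map_div₀, map_ofNat]

/-- The tetrahedral group of `X₀⁴ + 2s X₀² X₁² + X₁⁴` is Galois-stable: a Galois conjugate of the
quartic is the quartic itself or its Hessian. -/
lemma isGalStable_aut_tetrahedral [CharZero k] {s : AlgebraicClosure k} (hs : s ^ 2 = -3)
    {F : CubicPair (AlgebraicClosure k)} (hf : F.divergence = 0)
    (hg : F.fixedPoint = binQuartic 1 0 (s / 3) 0 1) : IsGalStable (Rat3.mk F).Aut := by
  intro σ γ hγ
  induction γ using Matrix.ProjGenLinGroup.induction_on with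
  | mk M =>
    rw [Rat3.mem_aut_mk_iff hf, hg] at hγ
    obtain ⟨u, hu, h⟩ := hγ
    -- The matrix is a symmetry of the conjugate by `σ⁻¹`; apply `σ` to this.
    obtain ⟨v, hv, h'⟩ : ∃ v, v ≠ 0 ∧ binQuartic 1 0 (σ.symm s / 3) 0 1 =
        C v * subst M.val (binQuartic 1 0 (σ.symm s / 3) 0 1) := by
      rcases gal_sqrt hs σ.symm with e | e
      · exact ⟨u, hu, by rwa [e]⟩
      · rw [e]
        exact subst_tetrahedral hs M.det.ne_zero hu h
    have key := congrArg (MvPolynomial.map (σ : AlgebraicClosure k →+* AlgebraicClosure k)) h'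
    rw [map_mul, map_C, map_subst, map_binQuartic_tetrahedral, AlgEquiv.apply_symm_apply,
      ← hg] at key
    exact (Rat3.mem_aut_mk_iff hf _).mpr ⟨σ v, (map_ne_zero σ).mpr hv, key⟩

end Descent

/-! ### Elements of the obstruction set -/

section Obstruction

variable {k : Type*} [Field k]

/-- If `ψ` is conjugate to `φ` and its Galois conjugates are obtained from `ψ` by a cocycle `z`
with values in `PGL₂`, then the class of `z` belongs to the obstruction set of `φ`: conjugating `z`
by an isomorphism between `φ` and `ψ` gives a cocycle with values in `N(Aut φ)`. -/
lemma mk_mem_obstruction {φ ψ : Rat3 (AlgebraicClosure k)} (hA : IsGalStable φ.Aut)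
    (h : PGL(2, AlgebraicClosure k)) (hφ : φ = h • ψ) (z : Z1 (galPGL k))
    (hz : ∀ σ : GalGrp k, ψ.gal σ = (z.1 σ)⁻¹ • ψ) : H1.mk z ∈ obstruction φ hA := by
  let n : GalGrp k → PGL(2, AlgebraicClosure k) := fun σ => h * z.1 σ * (galPGL k σ h)⁻¹
  have hn : ∀ σ, φ.gal σ = (n σ)⁻¹ • φ := by
    intro σ
    simp only [n]
    rw [hφ, Rat3.gal_smul, hz, smul_smul, smul_smul]
    congr 1
    group
  have hnor : ∀ σ, n σ ∈ nor φ.Aut := fun σ => Rat3.mem_nor_of_gal_eq hA σ (hn σ)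
  have hconst : IsLocallyConstant n :=
    ((IsLocallyConstant.const h).mul z.2.1).mul (isLocallyConstant_galPGL h).inv
  have hcocycle : ∀ σ τ, n (σ * τ) = n σ * galPGL k σ (n τ) := by
    intro σ τ
    have e : galPGL k (σ * τ) h = galPGL k σ (galPGL k τ h) := by
      rw [map_mul]
      rfl
    let m : PGL(2, AlgebraicClosure k) →* PGL(2, AlgebraicClosure k) := galPGL k σ
    change h * z.1 (σ * τ) * (galPGL k (σ * τ) h)⁻¹ =
      h * z.1 σ * (m h)⁻¹ * m (h * z.1 τ * (galPGL k τ h)⁻¹)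
    rw [z.2.2, e, map_mul, map_mul, map_inv]
    change h * (z.1 σ * m (z.1 τ)) * (m (galPGL k τ h))⁻¹ = _
    group
  let zN : Z1 (subAct hA.nor) := ⟨fun σ => ⟨n σ, hnor σ⟩,
    IsLocallyConstant.desc _ Subtype.val hconst Subtype.val_injective,
    fun σ τ => Subtype.ext (hcocycle σ τ)⟩
  refine ⟨H1.mk zN, ⟨_, rfl, fun σ => ⟨zN.1 σ, rfl, hn σ⟩⟩, ?_⟩
  refine Quotient.sound ⟨h, fun σ => ?_⟩
  change z.1 σ = h⁻¹ * (h * z.1 σ * (galPGL k σ h)⁻¹) * galPGL k σ h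
  group

end Obstruction

/-! ### The obstruction for `d = i = 0` -/

section Descent

variable (K : Type*) [Field K] [CharZero K]

/-- The substitution `X₀ ↦ X₁`, `X₁ ↦ 2 X₀`. Its class in `PGL₂` has order two. -/
noncomputable def exchange : GL (Fin 2) K :=
  Matrix.GeneralLinearGroup.mkOfDetNeZero !![0, 1; 2, 0] (by simp [Matrix.det_fin_two_of])

lemma exchange_val : (exchange K).val = !![0, 1; 2, 0] := rfl

lemma mk_exchange_mul_self :
    Matrix.ProjGenLinGroup.mk (exchange K) * Matrix.ProjGenLinGroup.mk (exchange K) = 1 := by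
  rw [← map_mul, ← Matrix.ProjGenLinGroup.mk_scalar (Units.mk0 (2 : K) two_ne_zero)]
  congr 1
  apply Units.ext
  rw [Units.val_mul, exchange_val, Matrix.GeneralLinearGroup.coe_scalar]
  ext i j
  fin_cases i <;> fin_cases j <;> simp [Matrix.mul_apply, Fin.sum_univ_two]

variable {k : Type*} [Field k] [CharZero k]

lemma galPGL_exchange (σ : GalGrp k) :
    galPGL k σ (Matrix.ProjGenLinGroup.mk (exchange (AlgebraicClosure k))) =
      Matrix.ProjGenLinGroup.mk (exchange (AlgebraicClosure k)) := by
  change Matrix.ProjGenLinGroup.mk _ = _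
  congr 1
  apply Units.ext
  change (exchange (AlgebraicClosure k)).val.map σ = (exchange (AlgebraicClosure k)).val
  rw [exchange_val]
  ext i j
  fin_cases i <;> fin_cases j <;> simp [map_ofNat]

open Classical in
/-- The cocycle `Gal(k(√-3)/k) → PGL₂`, inflated to the absolute Galois group, sending the
nontrivial element to the class of `exchange`. -/
noncomputable def exchangeCocycle {s : AlgebraicClosure k} (hs : s ^ 2 = -3) : Z1 (galPGL k) :=
  ⟨fun σ => if σ s = s then 1 else Matrix.ProjGenLinGroup.mk (exchange (AlgebraicClosure k)),
    (isLocallyConstant_apply s).comp fun x =>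
      if x = s then 1 else Matrix.ProjGenLinGroup.mk (exchange (AlgebraicClosure k)), by
    intro σ τ
    have hs0 := ne_zero_of_sq_eq_neg_three hs
    have hne : -s ≠ s := fun h => hs0 (by linear_combination -h / 2)
    have h1 : galPGL k σ 1 = 1 := map_one _
    rcases gal_sqrt hs σ with hσ | hσ <;> rcases gal_sqrt hs τ with hτ | hτ <;>
      simp [AlgEquiv.mul_apply, hσ, hτ, hne, h1, galPGL_exchange, mk_exchange_mul_self]⟩

lemma exchangeCocycle_of_eq {s : AlgebraicClosure k} (hs : s ^ 2 = -3) {σ : GalGrp k}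
    (hσ : σ s = s) : (exchangeCocycle hs).1 σ = 1 := if_pos hσ

lemma exchangeCocycle_of_eq_neg {s : AlgebraicClosure k} (hs : s ^ 2 = -3) {σ : GalGrp k}
    (hσ : σ s = -s) :
    (exchangeCocycle hs).1 σ = Matrix.ProjGenLinGroup.mk (exchange (AlgebraicClosure k)) := by
  refine if_neg fun h => ?_
  rw [hσ] at h
  exact ne_zero_of_sq_eq_neg_three hs (by linear_combination -h / 2)

/-- The 8-tuple of `f = 0` and a quartic form which has `i = 0` if `s² = -3`, and which `exchange`
then maps to a multiple of its conjugate over `k(s)`. -/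
def descentTuple {K : Type*} [Field K] (s : K) : Fin 8 → K :=
  ![0, 0, 0, -4 * s, -8 * s, 12, 4 * s, s]

lemma quadraticOf_eq_zero {K : Type*} [Field K] {v : Fin 8 → K} (h0 : v 0 = 0) (h1 : v 1 = 0)
    (h2 : v 2 = 0) : quadraticOf v = 0 := by
  simp [quadraticOf, h0, h1, h2]

lemma map_quarticOf_descentTuple {s : AlgebraicClosure k} {σ : GalGrp k} (hσ : σ s = -s) :
    MvPolynomial.map (σ : AlgebraicClosure k →+* AlgebraicClosure k)
      (quarticOf (descentTuple s)) =
    C (4⁻¹) * subst (exchange (AlgebraicClosure k)).val (quarticOf (descentTuple s)) := by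
  have h4 :
      (C (4⁻¹ : AlgebraicClosure k) : MvPolynomial (Fin 2) (AlgebraicClosure k)) * 4 = 1 := by
    rw [← map_ofNat C 4, ← C_mul, inv_mul_cancel₀ (by norm_num), C_1]
  rw [map_quarticOf, exchange_val]
  simp only [quarticOf, descentTuple, Function.comp_apply, Matrix.cons_val, map_add, map_mul,
    map_neg, map_pow, subst_X, subst_C, RingHom.coe_coe, hσ, Matrix.of_apply, map_ofNat, C_0, C_1]
  linear_combination (4 * C s * X 0 ^ 4 + 8 * C s * X 0 ^ 3 * X 1 + 12 * X 0 ^ 2 * X 1 ^ 2 -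
    4 * C s * X 0 * X 1 ^ 3 - C s * X 1 ^ 4) * (-h4)

/-- The Galois conjugates of the map with the tuple `descentTuple` are described by
`exchangeCocycle`. -/
lemma gal_mk_descentTuple {s : AlgebraicClosure k} (hs : s ^ 2 = -3)
    {F : CubicPair (AlgebraicClosure k)} (hf : F.divergence = 0)
    (hg : F.fixedPoint = quarticOf (descentTuple s)) (σ : GalGrp k) :
    (Rat3.mk F).gal σ = ((exchangeCocycle hs).1 σ)⁻¹ • Rat3.mk F := by
  have e : (Rat3.mk F).gal σ = Rat3.mk (F.gal σ) := rfl
  have hf' : (F.gal σ).divergence = 0 := by rw [CubicPair.divergence_gal, hf, map_zero]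
  rcases gal_sqrt hs σ with hσ | hσ
  · rw [exchangeCocycle_of_eq hs hσ, inv_one, one_smul, e, eq_comm, Rat3.mk_eq_mk_iff hf hf']
    refine ⟨1, one_ne_zero, ?_⟩
    rw [C_1, one_mul, CubicPair.fixedPoint_gal, hg, map_quarticOf]
    congr 1
    funext n
    fin_cases n <;> simp [descentTuple, hσ, map_ofNat]
  · rw [exchangeCocycle_of_eq_neg hs hσ, e, eq_comm, Rat3.mk_smul_eq_mk_iff hf hf']
    refine ⟨4⁻¹, inv_ne_zero (by norm_num), ?_⟩
    rw [CubicPair.fixedPoint_gal, hg, map_quarticOf_descentTuple hσ]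

/-- For `s² = -3`, a parametrisation of the conic `X² + 3Y² - 2Z² = 0` over `k(s)`. It is chosen
so that the conjugation `s ↦ -s` acts on it as `exchange`, up to the factor `-1/2`. -/
noncomputable def conicParam {K : Type*} [Field K] (s : K) : Fin 3 → MvPolynomial (Fin 2) K :=
  ![C s * (2 * X 0 ^ 2 + X 1 ^ 2), 2 * X 0 ^ 2 - X 1 ^ 2, C (2 * s) * X 0 * X 1]

lemma conicParam_eq {K : Type*} [Field K] (s : K) :
    conicParam s 0 = quadraticOf ![2 * s, 0, s, 0, 0, 0, 0, 0] ∧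
    conicParam s 1 = quadraticOf ![2, 0, -1, 0, 0, 0, 0, 0] ∧
    conicParam s 2 = quadraticOf ![0, 2 * s, 0, 0, 0, 0, 0, 0] := by
  refine ⟨?_, ?_, ?_⟩ <;>
    simp only [conicParam, quadraticOf, Matrix.cons_val, C_0, C_1, C_neg, C_mul, map_ofNat] <;> ring

lemma linearIndependent_conicParam {K : Type*} [Field K] [CharZero K] {s : K} (hs : s ≠ 0) :
    LinearIndependent K (conicParam s) := by
  obtain ⟨e0, e1, e2⟩ := conicParam_eq s
  rw [Fintype.linearIndependent_iff]
  intro a ha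
  rw [Fin.sum_univ_three, e0, e1, e2] at ha
  -- Compare the coefficients of `X₀²`, `X₀ X₁` and `X₁²`.
  have hsmul : ∀ (m n : ℕ) (c : K) (p : MvPolynomial (Fin 2) K),
      coeff₂ m n (c • p) = c * coeff₂ m n p := fun m n c p => coeff_smul _ _ _
  have h : ∀ m n, coeff₂ m n (a 0 • quadraticOf ![2 * s, 0, s, 0, 0, 0, 0, 0] +
      a 1 • quadraticOf ![2, 0, -1, 0, 0, 0, 0, 0] +
      a 2 • quadraticOf ![0, 2 * s, 0, 0, 0, 0, 0, 0]) = 0 := fun m n => by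
    rw [ha]
    exact coeff_zero _
  have h20 := h 2 0
  have h11 := h 1 1
  have h02 := h 0 2
  simp [coeff₂_add, hsmul, coeff₂_quadraticOf] at h20 h11 h02
  have ha0 : a 0 = 0 := by
    have : a 0 * (4 * s) = 0 := by linear_combination h20 + 2 * h02
    exact (mul_eq_zero.mp this).resolve_right (mul_ne_zero (by norm_num) hs)
  intro n
  fin_cases n
  · exact ha0
  · change a 1 = 0
    linear_combination s * ha0 - h02
  · exact h11.resolve_right hs

lemma correspondsToConic_exchangeCocycle {s : AlgebraicClosure k} (hs : s ^ 2 = -3) :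
    CorrespondsToConic (H1.mk (exchangeCocycle hs))
      (X 0 ^ 2 + 3 * X 1 ^ 2 - 2 * X 2 ^ 2) := by
  have hs0 := ne_zero_of_sq_eq_neg_three hs
  have hC : (C s : MvPolynomial (Fin 2) (AlgebraicClosure k)) ^ 2 = -3 := by
    rw [← C_pow, hs, C_neg, map_ofNat]
  have h2 :
      (C (2⁻¹ : AlgebraicClosure k) : MvPolynomial (Fin 2) (AlgebraicClosure k)) * 2 = 1 := by
    rw [← map_ofNat C 2, ← C_mul, inv_mul_cancel₀ two_ne_zero, C_1]
  obtain ⟨e0, e1, e2⟩ := conicParam_eq s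
  refine ⟨exchangeCocycle hs, conicParam s, rfl, ?_, linearIndependent_conicParam hs0, ?_, ?_⟩
  · intro n
    fin_cases n
    · exact e0 ▸ quadraticOf_isHomogeneous _
    · exact e1 ▸ quadraticOf_isHomogeneous _
    · exact e2 ▸ quadraticOf_isHomogeneous _
  · simp only [map_sub, map_add, map_mul, map_pow, aeval_X, map_ofNat, conicParam, Matrix.cons_val]
    linear_combination ((2 * X 0 ^ 2 + X 1 ^ 2) ^ 2 - 8 * X 0 ^ 2 * X 1 ^ 2) * hC
  · intro σ
    rcases gal_sqrt hs σ with hσ | hσ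
    · refine ⟨1, 1, ?_, fun n => ?_⟩
      · rw [exchangeCocycle_of_eq hs hσ, map_one]
      · rw [Units.val_one, Units.val_one, C_1, one_mul, subst_one]
        fin_cases n <;> simp [conicParam, hσ, map_ofNat]
    · refine ⟨exchange _, Units.mk0 (-2⁻¹) (by simp), ?_, fun n => ?_⟩
      · rw [exchangeCocycle_of_eq_neg hs hσ]
      · rw [Units.val_mk0, exchange_val]
        fin_cases n
        · simp [conicParam, hσ, map_ofNat, subst_X]
          linear_combination -(C s * (2 * X 0 ^ 2 + X 1 ^ 2)) * h2
        · simp [conicParam, map_ofNat, subst_X]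
          linear_combination (X 1 ^ 2 - 2 * X 0 ^ 2) * h2
        · simp [conicParam, hσ, map_ofNat, subst_X]
          linear_combination -(2 * C s * X 0 * X 1) * h2

namespace M3

variable {P : M3 (AlgebraicClosure k)} {w : Invariants k}

lemma HasCoords.isModel_tetrahedral (hP : P ∈ locusC21 (AlgebraicClosure k)) (hw : P.HasCoords w)
    (hd : w.d = 0) (hi : w.i = 0) {s : AlgebraicClosure k} (hs : s ^ 2 = -3) :
    P.IsModel ![0, 0, 0, 1, 0, 2 * s, 0, 1] := by
  have hs0 := ne_zero_of_sq_eq_neg_three hs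
  have h := hw.isModel_cubicTuple hP hd
  rw [hi, map_zero, mul_zero] at h
  refine h.of_i_eq_zero rfl rfl rfl ?_ ?_
  · rw [tupleInv, basicInvariants_i]
    simp only [Matrix.cons_val]
    linear_combination 2 / 3 * hs
  · have e : (tupleInv ![0, 0, 0, 1, 0, 2 * s, 0, 1]).j = 8 / 3 * s := by
      rw [tupleInv, basicInvariants_j]
      simp only [Matrix.cons_val]
      linear_combination -2 / 9 * s * hs
    rw [e]
    exact mul_ne_zero (by norm_num) hs0

lemma HasCoords.isModel_descentTuple (hP : P ∈ locusC21 (AlgebraicClosure k))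
    (hw : P.HasCoords w) (hd : w.d = 0) (hi : w.i = 0) {s : AlgebraicClosure k}
    (hs : s ^ 2 = -3) : P.IsModel (descentTuple s) := by
  have h := hw.isModel_cubicTuple hP hd
  rw [hi, map_zero, mul_zero] at h
  refine h.of_i_eq_zero rfl rfl rfl ?_ ?_
  · rw [tupleInv, basicInvariants_i]
    simp only [descentTuple, Matrix.cons_val]
    linear_combination 8 * hs
  · have e : (tupleInv (descentTuple s)).j = 240 := by
      rw [tupleInv, basicInvariants_j]
      simp only [descentTuple, Matrix.cons_val]
      linear_combination -96 * hs
    rw [e]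
    norm_num

/-- For `d = i = 0` the cocycle attached to the conic `X² + 3Y² - 2Z² = 0` describes the Galois
conjugates of a model, so that its class lies in every obstruction set. -/
lemma HasCoords.exists_mem_obstruction (hP : P ∈ locusC21 (AlgebraicClosure k))
    (hw : P.HasCoords w) (hd : w.d = 0) (hi : w.i = 0) (φ : Rat3 (AlgebraicClosure k))
    (hA : IsGalStable φ.Aut) (hφ : mk φ = P) :
    ∃ c ∈ obstruction φ hA, CorrespondsToConic c (X 0 ^ 2 + 3 * X 1 ^ 2 - 2 * X 2 ^ 2) := by
  obtain ⟨s, hs⟩ := IsAlgClosed.exists_pow_nat_eq (-3 : AlgebraicClosure k) two_pos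
  obtain ⟨F, hF, hf, hg⟩ := hw.isModel_descentTuple hP hd hi hs
  rw [quadraticOf_eq_zero rfl rfl rfl] at hf
  have h : mk φ = mk (Rat3.mk F) := hφ.trans hF.symm
  obtain ⟨h, hh⟩ := (Quotient.exact h : MulAction.orbitRel PGL(2, AlgebraicClosure k) _ _ _)
  exact ⟨_, mk_mem_obstruction hA h hh.symm _ (gal_mk_descentTuple hs hf hg),
    correspondsToConic_exchangeCocycle hs⟩

end M3

end Descent

end CubicMaps

theorem mainTheorem4 {k : Type*} [Field k] [CharZero k]
    (P : CubicMaps.M3 (AlgebraicClosure k)) (hPk : P.IsRational k)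
    (hP : P ∈ CubicMaps.M3.locusC21 (AlgebraicClosure k))
    (d i j a b : k) (hw : P.HasCoords (⟨d, i, j, a, b, 0⟩ : CubicMaps.Invariants k)) :
    (d ≠ 0 →
      (P.HasModelOver k ↔
        ∃ w : CubicMaps.Invariants k, P.HasCoords w ∧ CubicMaps.ConicHasPoint w) ∧
      (P ∉ CubicMaps.M3.locusD41 (AlgebraicClosure k) →
        (P.HasModelOver k ↔ CubicMaps.ConicHasPoint ⟨d, i, j, a, b, 0⟩)) ∧
      (P ∈ CubicMaps.M3.locusD41 (AlgebraicClosure k) → P.HasModelOver k) ∧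
      (CubicMaps.ConicHasPoint ⟨d, i, j, a, b, 0⟩ →
        ∃ x y z : k, z ≠ 0 ∧ CubicMaps.conicC21 ⟨d, i, j, a, b, 0⟩ x y z = 0) ∧
      (∀ x y z : k, z ≠ 0 → CubicMaps.conicC21 ⟨d, i, j, a, b, 0⟩ x y z = 0 →
        P.IsModel (algebraMap k (AlgebraicClosure k) ∘
          CubicMaps.modelC21 ⟨d, i, j, a, b, 0⟩ x y z))) ∧
    (d = 0 → P ∈ CubicMaps.M3.locusD42 (AlgebraicClosure k) ∧
      (i ≠ 0 → j ≠ 0 → P.IsModel (algebraMap k (AlgebraicClosure k) ∘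
        ![0, 0, 0, -27 * i ^ 3, -27 * i ^ 3, 0, 24 * j ^ 2, 0]))) ∧
    (d = 0 → j = 0 → P ∈ CubicMaps.M3.locusD8 (AlgebraicClosure k) ∧
      P.IsModel (algebraMap k (AlgebraicClosure k) ∘ ![0, 0, 0, 1, 0, 0, 0, 1])) ∧
    (d = 0 → i = 0 → P ∈ CubicMaps.M3.locusA4 (AlgebraicClosure k) ∧
      (∀ s : AlgebraicClosure k, s ^ 2 = -3 →
        P.IsModel ![0, 0, 0, 1, 0, 2 * s, 0, 1] ∧
        ∀ F : CubicMaps.CubicPair (AlgebraicClosure k),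
          F.divergence = CubicMaps.quadraticOf ![0, 0, 0, 1, 0, 2 * s, 0, 1] →
          F.fixedPoint = CubicMaps.quarticOf ![0, 0, 0, 1, 0, 2 * s, 0, 1] →
          CubicMaps.IsGalStable (CubicMaps.Rat3.mk F).Aut) ∧
      (∀ (φ : CubicMaps.Rat3 (AlgebraicClosure k)) (hA : CubicMaps.IsGalStable φ.Aut),
        CubicMaps.M3.mk φ = P →
        ∃ c ∈ CubicMaps.obstruction φ hA,
          CubicMaps.CorrespondsToConic c
            (MvPolynomial.X 0 ^ 2 + 3 * MvPolynomial.X 1 ^ 2 - 2 * MvPolynomial.X 2 ^ 2))) := by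
  refine ⟨fun hd => ⟨CubicMaps.M3.hasModelOver_iff_exists hP hw hd,
    fun hP' => ⟨fun h => ?_,
      fun h => (CubicMaps.M3.hasModelOver_iff_exists hP hw hd).mpr ⟨_, hw, h⟩⟩,
    fun hP' => CubicMaps.M3.hasModelOver_of_mem_locusD41 hP hP' hw hd, fun h => h.exists_affine hd,
    fun x y z hz hC => hw.isModel_modelC21 hP hd hz hC⟩,
    fun hd => ⟨hw.mem_locusD42 hP hd, fun hi hj => ?_⟩,
    fun hd hj => ⟨hw.mem_locusD8 hP hd hj, hw.isModel_locusD8 hP hd hj⟩,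
    fun hd hi => ⟨hw.mem_locusA4 hP hd hi, fun s hs => ⟨hw.isModel_tetrahedral hP hd hi hs,
      fun F hf hg => ?_⟩, hw.exists_mem_obstruction hP hd hi⟩⟩
  · obtain ⟨w, hw', hC⟩ := (CubicMaps.M3.hasModelOver_iff_exists hP hw hd).mp h
    exact hw.conicHasPoint hP hP' hd hw' hC
  · have h := hw.isModel_locusD42 hP hd hi hj
    dsimp only at h
    exact h
  · exact CubicMaps.isGalStable_aut_tetrahedral hs
      (hf.trans (CubicMaps.quadraticOf_eq_zero rfl rfl rfl))
      (hg.trans (CubicMaps.quarticOf_tetrahedral s))
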